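/- **Theorem 11.5.** Let $0<q<1$, $a>0$ and let $k\ge 1$ be an integer. Write $(x;q)_n=\prod_{l=0}^{n-1}(1-xq^l)$, $(-a;q)_\infty=\prod_{l\ge0}(1+aq^l)$, and $${}_r\varphi_t\left({a_1,\dots,a_r\atop b_1,\dots,b_t}\Big|\,q,z\right)=\sum_{n\ge0}\frac{\prod_i(a_i;q)_n}{\prod_j(b_j;q)_n}\Bigl((-1)^nq^{\binom n2}\Bigr)^{1+t-r}\frac{z^n}{(q;q)_n},\qquad G_q(u,v;z)={}_2\varphi_0\left({u,v\atop -}\Big|\,q,z\right).$$ For $x\ge 0$ put $\pi_x=q^{-x}$ and $\omega(x)=\frac{a^x}{(q;q)_x}q^{\binom x2}$. Let $P_n(\zeta)=(-1)^na^nq^{-n^2}\,{}_2\varphi_1\left({q^{-n},\,\zeta\atop 0}\Big|\,q,-\frac{q^{n+1}}a\right)$ be the normalized (monic) $q$-Charlier polynomials and $\|P_n\|_\omega^2=\sum_{x\ge0}P_n(\pi_x)^2\omega(x)$. Let $$K(\pi_x,\pi_y)=\begin{cases}\|P_{k-1}\|_\omega^{-2}\sqrt{\omega(x)\omega(y)}\,\dfrac{P_k(\pi_x)P_{k-1}(\pi_y)-P_{k-1}(\pi_x)P_k(\pi_y)}{\pi_x-\pi_y},&x\ne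 y,\\[2mm]\|P_{k-1}\|_\omega^{-2}\,\omega(x)\bigl(P_k'(\pi_x)P_{k-1}(\pi_x)-P_{k-1}'(\pi_x)P_k(\pi_x)\bigr),&x=y,\end{cases}$$ and for $s\ge k$ let $D_s=\det\bigl(1-K|_{Y_s\times Y_s}\bigr)$, $Y_s=\{\pi_x:x\ge s\}$, be the Fredholm determinant $\sum_{n\ge 0}\frac{(-1)^n}{n!}\sum_{x_1,\dots,x_n\ge s}\det[K(\pi_{x_i},\pi_{x_j})]_{i,j=1}^n$. Then $D_s\neq0$ for all $s\ge k$, $G_q(q^{-k},q^{-k};-q^{2k}/a)\ne0$, and there are real sequences $p_s,q_s,r_s,\alpha_s,\beta_s,\gamma_s,h_s,\epsilon_s,u_s$ $(s\ge k)$ with $p_s,q_s,r_s,\epsilon_s\neq0$ such that the following relations hold for all $s\ge k$; since no denominator vanishes, these relations and the initial conditions below determine the sequences and all $D_s$, $s\ge k$. *(1) Recurrence relations.* $$\frac{D_{s+2}}{D_{s+1}}-\frac{D_{s+1}}{D_s}=\frac{a^{s-1}}{(q;q)_{s+1}}\,q^{\binom{s+1}2}\,u_s\,h_s^2,\qquad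 u_s=q^k\,\frac{p_s}{q_s^2}\,(p_s\beta_s+aq^{-k}q_s),$$ $$\epsilon_s=a(q^{-s-1}-1)+q^{k-1}(aq^{-k}p_s-r_s\beta_s),$$ $$p_{s+1}=-q^{-1}p_s^{-1}\epsilon_s^{-1}(p_s\beta_s+aq^{-k}q_s)(r_s\alpha_s-p_s\gamma_s+q^{k-s-1}r_s),$$ $$q_{s+1}=q^{-1}q_s^{-1}\epsilon_s^{-1}(p_s\beta_s+aq^{-k}q_s)^2,\qquad r_{s+1}=q^{-1}r_s^{-1}\epsilon_s^{-1}(r_s\alpha_s-p_s\gamma_s+q^{k-s-1}r_s)^2,$$ $$\alpha_{s+1}=\alpha_s+q^{k-1}p_s-q^kp_{s+1},\quad\beta_{s+1}=\beta_s-q^kq_{s+1},\quad\gamma_{s+1}=\gamma_s+q^{k-1}r_s,\quad h_{s+1}=\frac{p_s\beta_s+aq^{-k}q_s}{aq_s}\,h_s.$$ *(2) Initial conditions.* $$D_k=(-a;q)_\infty^{-k}\,a^{-\binom k2}\prod_{n=0}^{k-1}\Bigl[(-a^{-1}q;q)_n^{-1}q^{\binom{n+1}2}\Bigr],$$ $$D_{k+1}=(-a;q)_\infty^{-k}\,\frac{a^{k-\binom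 k2}}{(q;q)_k}\,q^{-\binom k2}\,G_q(q^{-k},q^{-k};-q^{2k}/a)\prod_{n=0}^{k-1}\Bigl[(-a^{-1}q;q)_n^{-1}q^{\binom{n+1}2}\Bigr],$$ $$p_k=(1-q^{-k})\frac{G_q(q^{-k},q^{1-k};-q^{2k-1}/a)}{G_q(q^{-k},q^{-k};-q^{2k}/a)},\qquad q_k=\frac{(q;q)_k^2\,q^{-k(k+1)}}{G_q(q^{-k},q^{-k};-q^{2k}/a)},$$ $$r_k=\frac{q^{k^2}(1-q^{-k})}{(q;q)_k(q;q)_{k-1}}\cdot\frac{G_q(q^{-k},q^{1-k};-q^{2k-1}/a)^2}{G_q(q^{-k},q^{-k};-q^{2k}/a)},$$ $$\alpha_k=-1-q^kp_k,\quad\beta_k=-q^kq_k,\quad\gamma_k=\frac{q^{k^2-1}}{(q;q)_{k-1}^2}\,G_q(q^{1-k},q^{1-k};-q^{2k-2}/a),\quad h_k=q^{-k^2}(q;q)_k.$$ *(3) Lax pair.* These sequences are the entries of the associated Lax pair: for every $s\ge k$ there is a matrix function $m_s:\mathbb C\setminus\{\pi_0,\dots,\pi_{s-1}\}\to\mathrm{Mat}(2,\mathbb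 C)$, analytic, with at most simple poles at $\pi_x$ $(x<s)$ where $\operatorname{Res}_{\zeta=\pi_x}m_s(\zeta)=\lim_{\zeta\to\pi_x}m_s(\zeta)\begin{pmatrix}0&\omega(x)\\0&0\end{pmatrix}$, and with $m_s(\zeta)\,\mathrm{diag}(\zeta^{-k},\zeta^k)\to I$ as $\zeta\to\infty$, such that for all $\zeta\in\mathbb C\setminus\{\pi_0,\dots,\pi_s\}$ $$m_{s+1}(\zeta)=\left(I+\frac1{\zeta-\pi_s}\begin{pmatrix}p_s&q_s\\r_s&-p_s\end{pmatrix}\right)m_s(\zeta),$$ $$m_s(q\zeta)=\begin{pmatrix}q^k\zeta+\alpha_s&\beta_s\\\gamma_s&aq^{-k}\end{pmatrix}m_{s+1}(\zeta)\begin{pmatrix}(\zeta-1)^{-1}&0\\0&a^{-1}\end{pmatrix},$$ and $h_s$ is the $(1,1)$ entry of $m_s(\pi_s)$. -/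

import Mathlib

open Filter Topology

noncomputable section

namespace QCharlier

/-- The `q`-shifted factorial `(x;q)_n = (1 - x)(1 - xq) ⋯ (1 - xq^{n-1})`. -/
def qPoch (x q : ℝ) (n : ℕ) : ℝ := ∏ l ∈ Finset.range n, (1 - x * q ^ l)

/-- The infinite product `(x;q)_∞ = ∏_{l ≥ 0} (1 - x q^l)`. -/
def qPochInf (x q : ℝ) : ℝ := ∏' l : ℕ, (1 - x * q ^ l)

/-- The basic hypergeometric series `ᵣφₛ(A; B; q, z)`, with upper parameters `A` (a list of
length `r`) and lower parameters `B` (a list of length `s`). -/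
def basicHyp (A B : List ℝ) (q z : ℝ) : ℝ :=
  ∑' n : ℕ, (A.map fun x => qPoch x q n).prod / (B.map fun x => qPoch x q n).prod *
    ((-1 : ℝ) ^ n * q ^ (n.choose 2)) ^ (1 + (B.length : ℤ) - (A.length : ℤ)) *
    (z ^ n / qPoch q q n)

/-- `G_q(u, v; z) = ₂φ₀(u, v; -; q, z)`. -/
def G (q u v z : ℝ) : ℝ := basicHyp [u, v] [] q z

/-- The points `π_x = q^{-x}` of the orthogonality set. -/
def node (q : ℝ) (x : ℕ) : ℝ := q ^ (-(x : ℤ))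

/-- The `q`-Charlier weight `ω(x) = a^x q^{x(x-1)/2} / (q;q)_x`. -/
def weight (q a : ℝ) (x : ℕ) : ℝ := a ^ x / qPoch q q x * q ^ (x.choose 2)

/-- The `n`-th `q`-Charlier polynomial `C_n(ζ;a;q) = ₂φ₁(q^{-n}, ζ; 0; q, -q^{n+1}/a)`. -/
def charlier (q a : ℝ) (n : ℕ) (ζ : ℝ) : ℝ :=
  basicHyp [q ^ (-(n : ℤ)), ζ] [0] q (-(q ^ (n + 1) / a))

/-- The `n`-th normalized (monic) `q`-Charlier polynomial
`P_n(ζ) = (-1)^n a^n q^{-n²} C_n(ζ;a;q)`. -/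
def monicCharlier (q a : ℝ) (n : ℕ) (ζ : ℝ) : ℝ :=
  (-1) ^ n * a ^ n * q ^ (-((n : ℤ) ^ 2)) * charlier q a n ζ

/-- The squared norm `(P_n, P_n)_ω`. -/
def normSq (q a : ℝ) (n : ℕ) : ℝ :=
  ∑' x : ℕ, monicCharlier q a n (node q x) ^ 2 * weight q a x

/-- The Christoffel-Darboux kernel `K(π_x, π_y)` of order `k`, as a function of the indices. -/
def kernel (q a : ℝ) (k x y : ℕ) : ℝ :=
  if x = y then
    (normSq q a (k - 1))⁻¹ * weight q a x *
      (deriv (monicCharlier q a k) (node q x) * monicCharlier q a (k - 1) (node q x) -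
        deriv (monicCharlier q a (k - 1)) (node q x) * monicCharlier q a k (node q x))
  else
    (normSq q a (k - 1))⁻¹ * √(weight q a x * weight q a y) *
      ((monicCharlier q a k (node q x) * monicCharlier q a (k - 1) (node q y) -
          monicCharlier q a (k - 1) (node q x) * monicCharlier q a k (node q y)) /
        (node q x - node q y))

/-- The Fredholm determinant `det(1 - K)` of a kernel `K` on a discrete set, by the Fredholm
expansion `∑_n (-1)^n/n! ∑_{x_1,…,x_n} det [K(x_i, x_j)]`. -/
def fredholmDet {ι : Type*} (K : ι → ι → ℝ) : ℝ :=
  ∑' n : ℕ, (-1 : ℝ) ^ n / (n.factorial : ℝ) *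
    ∑' x : Fin n → ι, (Matrix.of fun i j => K (x i) (x j)).det

/-- `D_s = det(1 - K|_{Y_s × Y_s})`, where `Y_s = {π_x : x ≥ s}`. -/
def D (q a : ℝ) (k s : ℕ) : ℝ :=
  fredholmDet fun x y : Set.Ici s => kernel q a k x y

/-- `m` solves the discrete Riemann-Hilbert problem on `{π_0, …, π_{s-1}}` for the jump matrices
`w(π_x) = [[0, ω(x)], [0, 0]]`, with the asymptotics `diag(ζ^k, ζ^{-k})` at infinity: `m` is
analytic off the points `π_x`, `x < s`, it has there (at most) simple poles with
`Res_{ζ = π_x} m(ζ) = lim_{ζ → π_x} m(ζ) w(π_x)`, and `m(ζ) diag(ζ^{-k}, ζ^k) → I`. -/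
structure IsDRHPSolution (q a : ℝ) (k s : ℕ) (m : ℂ → Matrix (Fin 2) (Fin 2) ℂ) : Prop where
  analytic : ∀ i j, DifferentiableOn ℂ (fun ζ => m ζ i j) {ζ | ∀ x < s, ζ ≠ (node q x : ℂ)}
  jump : ∀ x < s, ∃ R : Matrix (Fin 2) (Fin 2) ℂ,
    Tendsto (fun ζ => (ζ - (node q x : ℂ)) • m ζ) (𝓝[≠] (node q x : ℂ)) (𝓝 R) ∧
    Tendsto (fun ζ => m ζ * !![0, (weight q a x : ℂ); 0, 0]) (𝓝[≠] (node q x : ℂ)) (𝓝 R)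
  asymptotics : Tendsto (fun ζ => m ζ * !![(ζ ^ k)⁻¹, 0; 0, ζ ^ k]) (cocompact ℂ) (𝓝 1)

end QCharlier

end

noncomputable section

namespace QCharlier

/-! ### Positive functionals on polynomials, Hankel matrices and reproducing kernels. -/

open Polynomial

/-! Let `L_s` be summation over the first `s` nodes against `ω`. For `s ≥ k` it is positive definite
in degrees below `k`, so it has a reproducing kernel `K_y` there (`evalKer`), a monic orthogonal
polynomial `P_s` of degree `k`, and a polynomial `R_s` of degree below `k` with `L_s (R_s g)` equal
to the coefficient of `X^(k-1)` in `g`. The pair `(P_s, R_s)` with its Cauchy transforms solves the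
Riemann–Hilbert problem (`isDRHPSolution_rhMatrix`).

The kernel `K` has rank `k`, so the Fredholm determinant is a finite determinant, and `D_s` is the
quotient of the Hankel determinants of `L_s` and of the full Charlier functional
(`fredholmDet_finiteRank`, `D_eq`).

Two operations produce the Lax pair. Passing from `L_s` to `L_{s+1}` adds a point mass: a rank-one
update, so `P_s` and `R_s` change by multiples of `K_{π_s}`, which the Christoffel–Darboux formula
expresses through `P_s` and `R_s` again (`lax_shift_poly`). The same update gives `D_{s+1}/D_s = 1 +
ω(s) κ_s` with `κ_s = K_{π_s}(π_s)` (`D_succ_div`). The dilation `ζ ↦ qζ` moves node `x + 1` to node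
`x`, and the first-order difference equation of `ω` then carries `L_{s+1}` to `L_s`
(`partialFunctional_dilation`); degree counting and orthogonality give `lax_dilation_poly`.

The dilation matrix has determinant `a(ζ - 1)` (`lax_det`). Evaluating the dilation relation at
`π_{s+1}`, where `qπ_{s+1} = π_s`, and inverting gives `P_{s+1}(π_{s+1})` and `R_{s+1}(π_{s+1})`
(`eval_succ`); its derivative gives `κ_{s+1}` (`diagKer_succ`). All the nonlinear recurrences follow
by algebra. Denominators are nonzero because `P_s` and `R_s` have no zero at `π_s`, which lies to
the right of the support of `L_s` (`eval_node_ne_zero_of_orth`).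

At `s = k` the functional has exactly `k` nodes, `P_k` is the nodal polynomial, and Lagrange
interpolation makes everything explicit. The sums that appear run over the weights `1/(ω N'²)` and
are terminating `₂φ₀` series (`dualMass_eq`, `sum_dualWeight_mul_sub`). -/

/-- The Hankel matrix of the moments of a linear functional on polynomials. -/
def hankel (L : ℝ[X] →ₗ[ℝ] ℝ) (k : ℕ) : Matrix (Fin k) (Fin k) ℝ :=
  Matrix.of fun i j => L (X ^ ((i : ℕ) + (j : ℕ)))

/-- The functional `L` is positive definite on polynomials of degree less than `k`. -/
def PosOn (L : ℝ[X] →ₗ[ℝ] ℝ) (k : ℕ) : Prop :=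
  ∀ f : ℝ[X], f ≠ 0 → f.degree < k → 0 < L (f * f)

/-- The polynomial with a given vector of coefficients. -/
def vecPoly {k : ℕ} (c : Fin k → ℝ) : ℝ[X] := ∑ i : Fin k, C (c i) * X ^ (i : ℕ)

theorem degree_vecPoly_lt {k : ℕ} (c : Fin k → ℝ) : (vecPoly c).degree < k := by
  unfold vecPoly
  refine lt_of_le_of_lt (degree_sum_le _ _) ?_
  rw [Finset.sup_lt_iff (by exact_mod_cast WithBot.bot_lt_coe k)]
  intro i _
  refine lt_of_le_of_lt (degree_C_mul_X_pow_le _ _) ?_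
  exact_mod_cast i.2

theorem coeff_vecPoly {k : ℕ} (c : Fin k → ℝ) (i : Fin k) : (vecPoly c).coeff i = c i := by
  unfold vecPoly
  simp [coeff_C_mul, coeff_X_pow, Fin.val_inj]

theorem map_vecPoly_mul {k : ℕ} (L : ℝ[X] →ₗ[ℝ] ℝ) (c : Fin k → ℝ) (g : ℝ[X]) :
    L (vecPoly c * g) = ∑ i : Fin k, c i * L (X ^ (i : ℕ) * g) := by
  unfold vecPoly
  rw [Finset.sum_mul, map_sum]
  refine Finset.sum_congr rfl fun i _ => ?_
  rw [mul_assoc, C_mul', map_smul, smul_eq_mul]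

theorem eq_vecPoly {k : ℕ} {f : ℝ[X]} (hf : f.degree < k) :
    f = vecPoly fun i : Fin k => f.coeff i := by
  unfold vecPoly
  rw [Fin.sum_univ_eq_sum_range (fun i => C (f.coeff i) * X ^ i) k]
  by_cases h0 : f = 0
  · simp [h0]
  · exact as_sum_range_C_mul_X_pow' _ ((natDegree_lt_iff_degree_lt h0).2 hf)

theorem linear_ext {k : ℕ} {φ ψ : ℝ[X] →ₗ[ℝ] ℝ} (h : ∀ j < k, φ (X ^ j) = ψ (X ^ j))
    {g : ℝ[X]} (hg : g.degree < k) : φ g = ψ g := by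
  rw [eq_vecPoly hg]
  have h1 := map_vecPoly_mul φ (fun i : Fin k => g.coeff i) 1
  have h2 := map_vecPoly_mul ψ (fun i : Fin k => g.coeff i) 1
  simp only [mul_one] at h1 h2
  rw [h1, h2]
  exact Finset.sum_congr rfl fun i _ => by rw [h i i.2]

/-- `L (f * ·)` agrees with `ψ` in degrees below `k` as soon as it does on monomials. -/
theorem map_mul_eq_of_moments {k : ℕ} {L ψ : ℝ[X] →ₗ[ℝ] ℝ} {f : ℝ[X]}
    (h : ∀ j < k, L (f * X ^ j) = ψ (X ^ j)) {g : ℝ[X]} (hg : g.degree < k) :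
    L (f * g) = ψ g :=
  linear_ext (φ := L ∘ₗ LinearMap.mulLeft ℝ f) h hg

/-- By linearity `f` may be tested against itself, and `L (f * f) = 0` contradicts positivity. The
polynomial identities characterising `P` and `R` below are proved this way: bound the degree of the
difference, then check `k` moments. -/
theorem PosOn.eq_zero {k : ℕ} {L : ℝ[X] →ₗ[ℝ] ℝ} (hL : PosOn L k) {f : ℝ[X]}
    (hf : f.degree < k) (h : ∀ j < k, L (f * X ^ j) = 0) : f = 0 := by
  by_contra h0
  have h1 := hL f h0 hf
  rw [map_mul_eq_of_moments (ψ := 0) (by simpa using h) hf] at h1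
  simp at h1

theorem hankel_mulVec {k : ℕ} (L : ℝ[X] →ₗ[ℝ] ℝ) (c : Fin k → ℝ) (j : Fin k) :
    (hankel L k).mulVec c j = L (vecPoly c * X ^ (j : ℕ)) := by
  rw [map_vecPoly_mul]
  simp only [Matrix.mulVec, dotProduct, hankel, Matrix.of_apply]
  refine Finset.sum_congr rfl fun i _ => ?_
  rw [mul_comm, ← pow_add, add_comm]

theorem PosOn.det_ne_zero {k : ℕ} {L : ℝ[X] →ₗ[ℝ] ℝ} (hL : PosOn L k) :
    (hankel L k).det ≠ 0 := by
  intro h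
  obtain ⟨c, hc, h⟩ := Matrix.exists_mulVec_eq_zero_iff.2 h
  apply hc
  have : vecPoly c = 0 := by
    refine hL.eq_zero (degree_vecPoly_lt c) fun j hj => ?_
    rw [← hankel_mulVec L c ⟨j, hj⟩, h]; rfl
  funext i
  rw [← coeff_vecPoly c i, this]; simp

/-- The polynomial of degree less than `k` with prescribed moments. -/
def ofMoments (L : ℝ[X] →ₗ[ℝ] ℝ) {k : ℕ} (b : Fin k → ℝ) : ℝ[X] :=
  vecPoly ((hankel L k)⁻¹.mulVec b)

theorem PosOn.map_ofMoments {k : ℕ} {L : ℝ[X] →ₗ[ℝ] ℝ} (hL : PosOn L k) (b : Fin k → ℝ)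
    (j : Fin k) : L (ofMoments L b * X ^ (j : ℕ)) = b j := by
  unfold ofMoments
  rw [← hankel_mulVec, Matrix.mulVec_mulVec,
    Matrix.mul_nonsing_inv _ (isUnit_iff_ne_zero.2 hL.det_ne_zero), Matrix.one_mulVec]

/-- The reproducing kernel of `L` on polynomials of degree less than `k`, at the point `y`. -/
def evalKer (L : ℝ[X] →ₗ[ℝ] ℝ) (k : ℕ) (y : ℝ) : ℝ[X] :=
  ofMoments L fun i : Fin k => y ^ (i : ℕ)

theorem degree_evalKer_lt (L : ℝ[X] →ₗ[ℝ] ℝ) (k : ℕ) (y : ℝ) : (evalKer L k y).degree < k :=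
  degree_vecPoly_lt _

theorem PosOn.map_evalKer {k : ℕ} {L : ℝ[X] →ₗ[ℝ] ℝ} (hL : PosOn L k) (y : ℝ) {g : ℝ[X]}
    (hg : g.degree < k) : L (evalKer L k y * g) = g.eval y := by
  have := map_mul_eq_of_moments (L := L) (ψ := Polynomial.leval y) (f := evalKer L k y) (k := k)
    (fun j hj => by
      simpa [evalKer] using hL.map_ofMoments (fun i : Fin k => y ^ (i : ℕ)) ⟨j, hj⟩) hg
  simpa using this

theorem PosOn.evalKer_self_nonneg {k : ℕ} {L : ℝ[X] →ₗ[ℝ] ℝ} (hL : PosOn L k) (y : ℝ) :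
    0 ≤ (evalKer L k y).eval y := by
  by_cases h : evalKer L k y = 0
  · simp [h]
  · rw [← hL.map_evalKer y (degree_evalKer_lt L k y)]
    exact (hL _ h (degree_evalKer_lt L k y)).le

/-- `P` is the monic orthogonal polynomial of degree `k` for `L`, and `R` the polynomial of degree
less than `k` that is dual to `X ^ (k - 1)`. -/
structure IsOPPair (L : ℝ[X] →ₗ[ℝ] ℝ) (k : ℕ) (P R : ℝ[X]) : Prop where
  monic : P.Monic
  natDegree : P.natDegree = k
  degree_lt : R.degree < k
  orth : ∀ j < k, L (P * X ^ j) = 0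
  dual : ∀ j < k, L (R * X ^ j) = if j + 1 = k then 1 else 0

theorem PosOn.exists_isOPPair {k : ℕ} {L : ℝ[X] →ₗ[ℝ] ℝ} (hL : PosOn L k) :
    ∃ P R, IsOPPair L k P R := by
  have hd := degree_vecPoly_lt ((hankel L k)⁻¹.mulVec fun i : Fin k => L (X ^ k * X ^ (i : ℕ)))
  refine ⟨X ^ k - ofMoments L fun i : Fin k => L (X ^ k * X ^ (i : ℕ)),
    ofMoments L fun i : Fin k => if (i : ℕ) + 1 = k then 1 else 0, ?_, ?_, ?_, ?_, ?_⟩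
  · exact monic_X_pow_sub hd
  · rw [natDegree_eq_of_degree_eq_some]
    rw [degree_sub_eq_left_of_degree_lt, degree_X_pow]
    rw [degree_X_pow]; exact hd
  · exact degree_vecPoly_lt _
  · intro j hj
    rw [sub_mul, map_sub, hL.map_ofMoments _ ⟨j, hj⟩, sub_self]
  · intro j hj
    exact hL.map_ofMoments _ ⟨j, hj⟩

/-! ### Uniqueness of the pair `(P, R)` and the Christoffel–Darboux formula. -/

namespace IsOPPair

variable {L : ℝ[X] →ₗ[ℝ] ℝ} {k : ℕ} {P R : ℝ[X]}

theorem degree_sub_lt {P' R' : ℝ[X]} {L' : ℝ[X] →ₗ[ℝ] ℝ} (h : IsOPPair L k P R)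
    (h' : IsOPPair L' k P' R') : (P - P').degree < k := by
  have hP : P.degree = k := by rw [degree_eq_natDegree h.monic.ne_zero, h.natDegree]
  have hP' : P'.degree = k := by rw [degree_eq_natDegree h'.monic.ne_zero, h'.natDegree]
  have := Polynomial.degree_sub_lt_left (hP.trans hP'.symm) h.monic.ne_zero
    (by rw [h.monic.leadingCoeff, h'.monic.leadingCoeff])
  rwa [hP] at this

theorem unique {P' R' : ℝ[X]} (hL : PosOn L k) (h : IsOPPair L k P R) (h' : IsOPPair L k P' R') :
    P = P' ∧ R = R' := by
  constructor
  · refine sub_eq_zero.1 (hL.eq_zero (h.degree_sub_lt h') fun j hj => ?_)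
    rw [sub_mul, map_sub, h.orth j hj, h'.orth j hj, sub_self]
  · refine sub_eq_zero.1 (hL.eq_zero ?_ fun j hj => ?_)
    · exact lt_of_le_of_lt (degree_sub_le _ _) (max_lt h.degree_lt h'.degree_lt)
    · rw [sub_mul, map_sub, h.dual j hj, h'.dual j hj, sub_self]

theorem map_P_mul (h : IsOPPair L k P R) {g : ℝ[X]} (hg : g.degree < k) : L (P * g) = 0 := by
  simpa using map_mul_eq_of_moments (ψ := 0) (by simpa using h.orth) hg

theorem map_R_mul (h : IsOPPair L k P R) {g : ℝ[X]} (hg : g.degree < k) :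
    L (R * g) = g.coeff (k - 1) := by
  have := map_mul_eq_of_moments (ψ := Polynomial.lcoeff ℝ (k - 1)) (L := L) (f := R) (k := k)
    (fun j hj => by
      rw [h.dual j hj, lcoeff_apply, coeff_X_pow]
      congr 1
      simp only [eq_iff_iff]
      omega) hg
  simpa using this

/-- Both sides equal `L (K_y * R)`: one by duality of `R`, the other by the reproducing property. -/
theorem coeff_evalKer (hL : PosOn L k) (h : IsOPPair L k P R) (y : ℝ) :
    (evalKer L k y).coeff (k - 1) = R.eval y := by
  rw [← h.map_R_mul (degree_evalKer_lt L k y), mul_comm, hL.map_evalKer y h.degree_lt]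

theorem coeff_P (h : IsOPPair L k P R) : P.coeff k = 1 := by
  have := h.monic.coeff_natDegree
  rwa [h.natDegree] at this

theorem degree_P (h : IsOPPair L k P R) : P.degree = k := by
  rw [degree_eq_natDegree h.monic.ne_zero, h.natDegree]

theorem degree_X_pow_sub (h : IsOPPair L k P R) : ((X : ℝ[X]) ^ k - P).degree < (k : WithBot ℕ) := by
  have := Polynomial.degree_sub_lt_left (p := (X ^ k : ℝ[X])) (q := P)
    (by rw [degree_X_pow, h.degree_P]) (by simp) (by simp [h.monic.leadingCoeff])
  simpa using this

/-- The Christoffel–Darboux formula. -/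
theorem christoffelDarboux (hk : 1 ≤ k) (hL : PosOn L k) (h : IsOPPair L k P R) (y : ℝ) :
    (X - C y) * evalKer L k y = C (R.eval y) * P - C (P.eval y) * R := by
  obtain ⟨n, rfl⟩ : ∃ n, k = n + 1 := ⟨k - 1, by omega⟩
  have hK := degree_evalKer_lt L (n + 1) y
  have hc := coeff_evalKer hL h y
  set K := evalKer L (n + 1) y with hKdef
  -- The coefficient of `X^k` cancels because the top coefficient of `K_y` is `R(y)`; this brings
  -- the difference into the range where `k` moments decide.
  refine sub_eq_zero.1 (hL.eq_zero ?_ fun j hj => ?_)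
  · rw [degree_lt_iff_coeff_zero]
    intro m hm
    have hm' : n + 1 ≤ m := by exact_mod_cast hm
    obtain ⟨i, rfl⟩ : ∃ i, m = i + 1 := ⟨m - 1, by omega⟩
    have hK0 : K.coeff (i + 1) = 0 := coeff_eq_zero_of_degree_lt (lt_of_lt_of_le hK (by exact_mod_cast hm'))
    have hR0 : R.coeff (i + 1) = 0 :=
      coeff_eq_zero_of_degree_lt (lt_of_lt_of_le h.degree_lt (by exact_mod_cast hm'))
    simp only [coeff_sub, sub_mul, coeff_X_mul, coeff_C_mul, hK0, hR0]
    rcases Nat.eq_or_lt_of_le hm' with he | hlt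
    · obtain rfl : n = i := by omega
      rw [h.coeff_P, ← hc]; simp
    · have h1 : K.coeff i = 0 := coeff_eq_zero_of_degree_lt
        (lt_of_lt_of_le hK (by exact_mod_cast (by omega : n + 1 ≤ i)))
      have h2 : P.coeff (i + 1) = 0 := coeff_eq_zero_of_natDegree_lt (by rw [h.natDegree]; exact hlt)
      rw [h1, h2]; simp
  · have hy : L (C y * K * X ^ j) = y * y ^ j := by
      rw [mul_assoc, C_mul', map_smul, hL.map_evalKer y (by rw [degree_X_pow]; exact_mod_cast hj)]
      simp
    have hP : L (C (R.eval y) * P * X ^ j) = 0 := by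
      rw [mul_assoc, C_mul', map_smul, h.orth j hj, smul_zero]
    have hR : L (C (P.eval y) * R * X ^ j) = P.eval y * if j + 1 = n + 1 then 1 else 0 := by
      rw [mul_assoc, C_mul', map_smul, h.dual j hj, smul_eq_mul]
    have hX : L (K * X ^ (j + 1)) = y ^ (j + 1) - P.eval y * if j + 1 = n + 1 then 1 else 0 := by
      -- In the last moment `X^(n+1)` is outside the range of the reproducing property. Replacing it
      -- by `X^(n+1) - P` costs nothing since `L (P * K) = 0`, and produces the term `-P(y)`.
      split_ifs with hjn
      · have e : K * X ^ (j + 1) = P * K + K * (X ^ (n + 1) - P) := by rw [hjn]; ring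
        rw [e, map_add, h.map_P_mul hK, hL.map_evalKer y h.degree_X_pow_sub, hjn]
        simp
      · rw [hL.map_evalKer y (by rw [degree_X_pow]; exact_mod_cast (by omega))]
        simp
    have e : ((X - C y) * K - (C (R.eval y) * P - C (P.eval y) * R)) * X ^ j =
        K * X ^ (j + 1) - C y * K * X ^ j - C (R.eval y) * P * X ^ j + C (P.eval y) * R * X ^ j := by
      ring
    rw [e, map_add, map_sub, map_sub, hX, hy, hP, hR]
    ring

theorem evalKer_eval (hk : 1 ≤ k) (hL : PosOn L k) (h : IsOPPair L k P R) (x y : ℝ) :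
    (x - y) * (evalKer L k y).eval x = R.eval y * P.eval x - P.eval y * R.eval x := by
  have := congrArg (Polynomial.eval x) (h.christoffelDarboux hk hL y)
  simpa using this

theorem evalKer_self (hk : 1 ≤ k) (hL : PosOn L k) (h : IsOPPair L k P R) (y : ℝ) :
    (evalKer L k y).eval y =
      R.eval y * P.derivative.eval y - P.eval y * R.derivative.eval y := by
  have := congrArg (fun f => Polynomial.eval y (Polynomial.derivative f))
    (h.christoffelDarboux hk hL y)
  simpa using this

/-- At a common zero `y` of `P` and `R` the Christoffel–Darboux formula would force `K_y = 0`,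
against `L (K_y * 1) = 1`. -/
theorem eval_ne_zero (hk : 1 ≤ k) (hL : PosOn L k) (h : IsOPPair L k P R) (y : ℝ)
    (hP : P.eval y = 0) : R.eval y ≠ 0 := by
  intro hR
  have h1 := h.christoffelDarboux hk hL y
  rw [hP, hR] at h1
  simp only [C_0, zero_mul, sub_zero, mul_eq_zero, X_sub_C_ne_zero, false_or] at h1
  have h2 := hL.map_evalKer y (g := 1) (by rw [degree_one]; exact_mod_cast hk)
  rw [h1] at h2
  simp at h2

end IsOPPair

/-! ### Adding a point mass -/

section PointMass

variable {L L' : ℝ[X] →ₗ[ℝ] ℝ} {k : ℕ} {P R : ℝ[X]} {w y : ℝ}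

/-- The Hankel matrix changes by `w v vᵀ` with `v` the vector of powers of `y`, and `vᵀ H⁻¹ v =
K_y(y)`; this is the matrix determinant lemma. -/
theorem det_hankel_pointMass (hL : PosOn L k) (hL' : ∀ f, L' f = L f + w * f.eval y) :
    (hankel L' k).det = (hankel L k).det * (1 + w * (evalKer L k y).eval y) := by
  set v : Fin k → ℝ := fun i => y ^ (i : ℕ)
  have e : hankel L' k = hankel L k +
      Matrix.replicateCol (Fin 1) v * Matrix.replicateRow (Fin 1) (w • v) := by
    ext i j
    simp only [hankel, Matrix.of_apply, hL', Matrix.add_apply, Matrix.mul_apply,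
      Matrix.replicateCol_apply, Matrix.replicateRow_apply]
    simp [v, pow_add]; ring
  have hd := isUnit_iff_ne_zero.2 hL.det_ne_zero
  rw [e, Matrix.det_add_mul _ _ hd]
  congr 1
  have e2 : (evalKer L k y).eval y = ∑ i, v i * ((hankel L k)⁻¹.mulVec v) i := by
    simp only [evalKer, ofMoments, vecPoly, eval_finsetSum, eval_mul, eval_C, eval_pow, eval_X]
    exact Finset.sum_congr rfl fun i _ => mul_comm _ _
  rw [e2, Matrix.det_unique]
  rw [Matrix.mul_assoc, ← Matrix.replicateCol_mulVec]
  simp [Matrix.mul_apply, Finset.mul_sum]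

theorem IsOPPair.pointMass (hL : PosOn L k) (h : IsOPPair L k P R) (hw : 0 < w)
    (hL' : ∀ f, L' f = L f + w * f.eval y) :
    IsOPPair L' k
      (P - C (w / (1 + w * (evalKer L k y).eval y) * P.eval y) * evalKer L k y)
      (R - C (w / (1 + w * (evalKer L k y).eval y) * R.eval y) * evalKer L k y) := by
  have hK := degree_evalKer_lt L k y
  have hne : 1 + w * (evalKer L k y).eval y ≠ 0 := by
    have := mul_nonneg hw.le (hL.evalKer_self_nonneg y); positivity
  -- The scalar is chosen so that the corrected `F` takes the value `F(y) / (1 + w K_y(y))` at `y`.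
  -- The new mass then contributes exactly what subtracting the multiple of `K_y` removed, and the
  -- old moments survive.
  have key : ∀ (F : ℝ[X]) (j : ℕ), j < k →
      L' ((F - C (w / (1 + w * (evalKer L k y).eval y) * F.eval y) * evalKer L k y) * X ^ j) =
        L (F * X ^ j) := by
    intro F j hj
    rw [hL', sub_mul, map_sub, mul_assoc, C_mul', map_smul,
      hL.map_evalKer y (by rw [degree_X_pow]; exact_mod_cast hj)]
    simp only [eval_pow, eval_X, smul_eq_mul, eval_sub, eval_mul, eval_smul]
    field_simp
    ring
  have hd : ∀ c : ℝ, (C c * evalKer L k y).degree < k := fun c =>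
    by
    rw [C_mul']
    exact lt_of_le_of_lt (degree_smul_le _ _) hK
  refine ⟨?_, ?_, ?_, ?_, ?_⟩
  · exact h.monic.sub_of_left (by rw [h.degree_P]; exact hd _)
  · rw [natDegree_eq_of_degree_eq_some]
    rw [degree_sub_eq_left_of_degree_lt, h.degree_P]
    rw [h.degree_P]; exact hd _
  · exact lt_of_le_of_lt (degree_sub_le _ _) (max_lt h.degree_lt (hd _))
  · intro j hj; rw [key P j hj, h.orth j hj]
  · intro j hj; rw [key R j hj, h.dual j hj]

end PointMass

/-! ### Dilating the support -/

section Dilation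

variable {L L' : ℝ[X] →ₗ[ℝ] ℝ} {k : ℕ} {P R P' R' : ℝ[X]} {q a : ℝ}

theorem coeff_comp_C_mul_X (f : ℝ[X]) (c : ℝ) (n : ℕ) :
    (f.comp (C c * X)).coeff n = f.coeff n * c ^ n := by
  rw [comp_C_mul_X_coeff]

theorem map_dilation (hq : q ≠ 0)
    (hs : ∀ f : ℝ[X], L' ((X - 1) * f.comp (C q * X)) = a / q * L f) (f : ℝ[X]) (j : ℕ) :
    L' ((X - 1) * f.comp (C q * X) * X ^ j) = a / q ^ (j + 1) * L (f * X ^ j) := by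
  have e : (X - 1) * f.comp (C q * X) * X ^ j =
      C (q ^ j)⁻¹ * ((X - 1) * (f * X ^ j).comp (C q * X)) := by
    have : C (q ^ j)⁻¹ * C (q ^ j) = (1 : ℝ[X]) := by
      rw [← C_mul, inv_mul_cancel₀ (pow_ne_zero _ hq), C_1]
    rw [mul_comp, X_pow_comp, mul_pow, ← C_pow]
    linear_combination (-(X - 1) * f.comp (C q * X) * X ^ j) * this
  rw [e, C_mul', map_smul, hs, smul_eq_mul]
  field_simp
  ring

/-- The left side has degree `k + 1` and is orthogonal under `L'` to degrees below `k`. The linear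
factor in front of `P'` is fixed by the two top coefficients; what remains has degree below `k` and
only its last moment is nonzero, so it is a multiple of `R'`. -/
theorem IsOPPair.dilation_P (hk : 1 ≤ k) (hq : q ≠ 0) (hL' : PosOn L' k) (h : IsOPPair L k P R)
    (h' : IsOPPair L' k P' R')
    (hs : ∀ f : ℝ[X], L' ((X - 1) * f.comp (C q * X)) = a / q * L f) :
    (X - 1) * P.comp (C q * X) =
      (C (q ^ k) * X + C (q ^ (k - 1) * P.coeff (k - 1) - q ^ k - q ^ k * P'.coeff (k - 1))) * P' +
        C (-(q ^ k * L' (P' * X ^ k))) * R' := by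
  obtain ⟨n, rfl⟩ : ∃ n, k = n + 1 := ⟨k - 1, by omega⟩
  simp only [Nat.add_sub_cancel]
  set α := q ^ n * P.coeff n - q ^ (n + 1) - q ^ (n + 1) * P'.coeff n with hα
  have hdeg : ∀ m, n + 1 < m → P.coeff m = 0 ∧ P'.coeff m = 0 := fun m hm =>
    ⟨coeff_eq_zero_of_natDegree_lt (by rw [h.natDegree]; exact hm),
      coeff_eq_zero_of_natDegree_lt (by rw [h'.natDegree]; exact hm)⟩
  refine sub_eq_zero.1 (hL'.eq_zero ?_ fun j hj => ?_)
  · rw [degree_lt_iff_coeff_zero]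
    intro m hm
    have hm' : n + 1 ≤ m := by exact_mod_cast hm
    obtain ⟨i, rfl⟩ : ∃ i, m = i + 1 := ⟨m - 1, by omega⟩
    have hR0 : R'.coeff (i + 1) = 0 :=
      coeff_eq_zero_of_degree_lt (lt_of_lt_of_le h'.degree_lt (by exact_mod_cast hm'))
    have e : (X - 1) * P.comp (C q * X) - ((C (q ^ (n + 1)) * X + C α) * P' +
        C (-(q ^ (n + 1) * L' (P' * X ^ (n + 1)))) * R') =
        X * P.comp (C q * X) - P.comp (C q * X) - C (q ^ (n + 1)) * (X * P') - C α * P' -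
        C (-(q ^ (n + 1) * L' (P' * X ^ (n + 1)))) * R' := by ring
    rw [e]
    simp only [coeff_sub, coeff_X_mul, coeff_C_mul, hR0, coeff_comp_C_mul_X]
    rcases Nat.eq_or_lt_of_le hm' with he | hlt
    · obtain rfl : n = i := by omega
      rw [h.coeff_P, h'.coeff_P, hα]; ring
    · rcases Nat.eq_or_lt_of_le (Nat.lt_succ_iff.1 (by omega : n + 1 < i + 1)) with he | hlt'
      all_goals
        rw [(hdeg (i + 1) hlt).1, (hdeg (i + 1) hlt).2]
        obtain hi | hi : i = n + 1 ∨ n + 1 < i := by omega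
        · subst hi; rw [h.coeff_P, h'.coeff_P]; ring
        · rw [(hdeg i hi).1, (hdeg i hi).2]; ring
  · have e : ((X - 1) * P.comp (C q * X) - ((C (q ^ (n + 1)) * X + C α) * P' +
        C (-(q ^ (n + 1) * L' (P' * X ^ (n + 1)))) * R')) * X ^ j =
        (X - 1) * P.comp (C q * X) * X ^ j - C (q ^ (n + 1)) * (P' * X ^ (j + 1)) -
          C α * (P' * X ^ j) - C (-(q ^ (n + 1) * L' (P' * X ^ (n + 1)))) * (R' * X ^ j) := by ring
    rw [e, map_sub, map_sub, map_sub, map_dilation hq hs, h.orth j hj, C_mul', map_smul, C_mul',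
      map_smul, C_mul', map_smul, h'.orth j hj, h'.dual j hj]
    split_ifs with hj'
    · rw [hj']; simp
    · rw [h'.orth (j + 1) (by omega)]; simp

/-- Here the left side has degree at most `k`, so a constant multiple of `P'` removes the top
coefficient, and the only surviving moment, number `k - 1`, equals `a / q^k`. -/
theorem IsOPPair.dilation_R (hk : 1 ≤ k) (hq : q ≠ 0) (hL' : PosOn L' k) (h : IsOPPair L k P R)
    (h' : IsOPPair L' k P' R')
    (hs : ∀ f : ℝ[X], L' ((X - 1) * f.comp (C q * X)) = a / q * L f) :
    (X - 1) * R.comp (C q * X) =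
      C (q ^ (k - 1) * R.coeff (k - 1)) * P' + C (a / q ^ k) * R' := by
  obtain ⟨n, rfl⟩ : ∃ n, k = n + 1 := ⟨k - 1, by omega⟩
  simp only [Nat.add_sub_cancel]
  refine sub_eq_zero.1 (hL'.eq_zero ?_ fun j hj => ?_)
  · rw [degree_lt_iff_coeff_zero]
    intro m hm
    have hm' : n + 1 ≤ m := by exact_mod_cast hm
    obtain ⟨i, rfl⟩ : ∃ i, m = i + 1 := ⟨m - 1, by omega⟩
    have hR0 : R'.coeff (i + 1) = 0 :=
      coeff_eq_zero_of_degree_lt (lt_of_lt_of_le h'.degree_lt (by exact_mod_cast hm'))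
    have hR1 : R.coeff (i + 1) = 0 :=
      coeff_eq_zero_of_degree_lt (lt_of_lt_of_le h.degree_lt (by exact_mod_cast hm'))
    simp only [coeff_sub, coeff_add, sub_mul, one_mul, coeff_X_mul, coeff_C_mul, hR0, hR1,
      coeff_comp_C_mul_X]
    rcases Nat.eq_or_lt_of_le hm' with he | hlt
    · obtain rfl : n = i := by omega
      rw [h'.coeff_P]; ring
    · rw [coeff_eq_zero_of_natDegree_lt (p := P') (by rw [h'.natDegree]; exact hlt),
        coeff_eq_zero_of_degree_lt (p := R) (lt_of_lt_of_le h.degree_lt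
        (by exact_mod_cast (by omega : n + 1 ≤ i)))]
      ring
  · have e : ((X - 1) * R.comp (C q * X) - (C (q ^ n * R.coeff n) * P' +
        C (a / q ^ (n + 1)) * R')) * X ^ j =
        (X - 1) * R.comp (C q * X) * X ^ j - C (q ^ n * R.coeff n) * (P' * X ^ j) -
          C (a / q ^ (n + 1)) * (R' * X ^ j) := by ring
    rw [e, map_sub, map_sub, map_dilation hq hs, h.dual j hj, C_mul', map_smul, C_mul',
      map_smul, h'.orth j hj, h'.dual j hj]
    split_ifs with hj'
    · rw [hj']; simp
    · simp

end Dilation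

/-! ### Fredholm determinants of finite rank kernels -/

theorem hasSum_pi_prod {ι : Type*} {n : ℕ} (u : Fin n → ι → ℝ) (h : ∀ i, Summable (u i)) :
    HasSum (fun x : Fin n → ι => ∏ i, u i (x i)) (∏ i, ∑' x, u i x) := by
  induction n with
  | zero => simp
  | succ n ih =>
    have ih := ih (fun i : Fin n => u i.succ) fun i => h i.succ
    set v : (Fin n → ι) → ℝ := fun x => ∏ i : Fin n, u i.succ (x i) with hv
    have hn0 : Summable fun x => ‖u 0 x‖ := (h 0).norm
    have hn1 : Summable fun x => ‖v x‖ := ih.summable.norm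
    have hm := (h 0).hasSum.mul ih (summable_mul_of_summable_norm hn0 hn1)
    rw [Fin.prod_univ_succ, ← (Fin.consEquiv fun _ => ι).hasSum_iff]
    have e : (fun x : Fin (n + 1) → ι => ∏ i, u i (x i)) ∘ (Fin.consEquiv fun _ => ι) =
        fun x : ι × (Fin n → ι) => u 0 x.1 * v x.2 := by
      funext x
      simp [Fin.prod_univ_succ, Fin.consEquiv, hv]
    rw [e]
    exact hm

/-- After the Leibniz expansion and multiplying out the finite sums, each variable `x i` occurs in
one factor `g` and one factor `f`. The sum over all `x` therefore factorises and reassembles into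
minors of the `k × k` matrix. -/
theorem hasSum_det_finiteRank {ι : Type*} {k : ℕ} (f g : Fin k → ι → ℝ)
    (hs : ∀ m n, Summable fun x => g m x * f n x) (n : ℕ) :
    HasSum (fun x : Fin n → ι =>
        (Matrix.of fun i j => ∑ m, f m (x i) * g m (x j)).det)
      (∑ μ : Fin n → Fin k,
        ((Matrix.of fun m n => ∑' x, g m x * f n x).submatrix μ μ).det) := by
  have e1 : ∀ x : Fin n → ι, (Matrix.of fun i j => ∑ m, f m (x i) * g m (x j)).det =
      ∑ μ : Fin n → Fin k, ∑ σ : Equiv.Perm (Fin n), ((Equiv.Perm.sign σ : ℤ) : ℝ) *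
        ∏ i, (g (μ i) (x i) * f (μ (σ⁻¹ i)) (x i)) := by
    intro x
    rw [Matrix.det_apply', Finset.sum_comm]
    refine Finset.sum_congr rfl fun σ _ => ?_
    rw [← Finset.mul_sum]
    congr 1
    simp only [Matrix.of_apply]
    rw [Finset.prod_univ_sum, Fintype.piFinset_univ]
    refine Finset.sum_congr rfl fun μ _ => ?_
    rw [Finset.prod_mul_distrib, Finset.prod_mul_distrib, mul_comm]
    congr 1
    -- Reindexing by `σ` makes the argument of `f` match that of `g`, at the price of the index `σ⁻¹
    -- i`.
    rw [← Equiv.prod_comp σ (fun i => f (μ (σ⁻¹ i)) (x i))]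
    simp
  have e2 : ∀ μ : Fin n → Fin k,
      ((Matrix.of fun m n => ∑' x, g m x * f n x).submatrix μ μ).det =
      ∑ σ : Equiv.Perm (Fin n), ((Equiv.Perm.sign σ : ℤ) : ℝ) *
        ∏ i, ∑' x, g (μ i) x * f (μ (σ⁻¹ i)) x := by
    intro μ
    rw [Matrix.det_apply']
    refine Finset.sum_congr rfl fun σ _ => ?_
    congr 1
    rw [← Equiv.prod_comp σ (fun i => ∑' x, g (μ i) x * f (μ (σ⁻¹ i)) x)]
    simp
  simp only [e1, e2]
  refine hasSum_sum fun μ _ => hasSum_sum fun σ _ => HasSum.mul_left _ ?_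
  exact hasSum_pi_prod (fun i x => g (μ i) x * f (μ (σ⁻¹ i)) x) fun i => hs _ _

/-- Non-injective `μ` give repeated rows. Injective ones are grouped by image, and the `n!`
enumerations of a given image all yield the same principal minor. -/
theorem sum_det_submatrix {k : ℕ} (A : Matrix (Fin k) (Fin k) ℝ) (n : ℕ) :
    ∑ μ : Fin n → Fin k, (A.submatrix μ μ).det =
      (n.factorial : ℝ) * ∑ s ∈ Finset.univ.powersetCard n,
        (A.submatrix (Subtype.val : {x // x ∈ s} → Fin k) Subtype.val).det := by
  classical
  have h1 : ∑ μ : Fin n → Fin k, (A.submatrix μ μ).det =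
      ∑ μ ∈ Finset.univ.filter (fun μ : Fin n → Fin k => Function.Injective μ),
        (A.submatrix μ μ).det := by
    symm
    refine Finset.sum_subset (Finset.filter_subset _ _) fun μ _ hμ => ?_
    have : ¬ Function.Injective μ := by simpa using hμ
    obtain ⟨i, j, hij, hne⟩ := Function.not_injective_iff.1 this
    exact Matrix.det_zero_of_row_eq hne (by funext l; simp [hij])
  rw [h1, ← Finset.sum_fiberwise_of_maps_to (t := Finset.univ.powersetCard n)
    (g := fun μ : Fin n → Fin k => Finset.univ.image μ), Finset.mul_sum]
  · refine Finset.sum_congr rfl fun s hs => ?_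
    have hcard : s.card = n := (Finset.mem_powersetCard.1 hs).2
    have h2 : ∑ _e : Fin n ≃ {x // x ∈ s},
        (A.submatrix (Subtype.val : {x // x ∈ s} → Fin k) Subtype.val).det =
        ∑ μ ∈ (Finset.univ.filter (fun μ : Fin n → Fin k => Function.Injective μ)).filter
          (fun μ => Finset.univ.image μ = s), (A.submatrix μ μ).det := by
      refine Finset.sum_bij (fun e _ => fun i => ((e i : {x // x ∈ s}) : Fin k)) ?_ ?_ ?_ ?_
      · intro e _
        simp only [Finset.mem_filter, Finset.mem_univ, true_and]
        refine ⟨Subtype.val_injective.comp e.injective, ?_⟩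
        ext x
        simp only [Finset.mem_image, Finset.mem_univ, true_and]
        exact ⟨fun ⟨i, hi⟩ => hi ▸ (e i).2, fun hx => ⟨e.symm ⟨x, hx⟩, by simp⟩⟩
      · intro e _ e' _ h
        ext i
        exact congrArg Fin.val (congrFun h i)
      · intro μ hμ
        simp only [Finset.mem_filter, Finset.mem_univ, true_and] at hμ
        obtain ⟨hinj, him⟩ := hμ
        have hmem : ∀ i, μ i ∈ s := fun i => him ▸ Finset.mem_image_of_mem _ (Finset.mem_univ i)
        refine ⟨Equiv.ofBijective (fun i => ⟨μ i, hmem i⟩) ⟨?_, ?_⟩, Finset.mem_univ _, ?_⟩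
        · intro i j hij
          exact hinj (congrArg Subtype.val hij)
        · rintro ⟨x, hx⟩
          rw [← him] at hx
          obtain ⟨i, -, hi⟩ := Finset.mem_image.1 hx
          exact ⟨i, Subtype.ext hi⟩
        · funext i; rfl
      · intro e _
        exact (Matrix.det_submatrix_equiv_self e _).symm
    rw [← h2, Finset.sum_const, Finset.card_univ, nsmul_eq_mul,
      Fintype.card_equiv (Fintype.equivOfCardEq (by simp [hcard])), Fintype.card_fin]
  · intro μ hμ
    simp only [Finset.mem_filter, Finset.mem_univ, true_and] at hμ
    rw [Finset.mem_powersetCard]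
    exact ⟨Finset.subset_univ _, by rw [Finset.card_image_of_injective _ hμ]; simp⟩

/-- The expansion of `det (1 + X A)` in principal minors, evaluated at `X = -1`. -/
theorem det_one_sub_eq_sum_minors {k : ℕ} (A : Matrix (Fin k) (Fin k) ℝ) :
    (1 - A).det = ∑ n ∈ Finset.range (k + 1), (-1 : ℝ) ^ n *
      ∑ s ∈ Finset.univ.powersetCard n,
        (A.submatrix (Subtype.val : {x // x ∈ s} → Fin k) Subtype.val).det := by
  have h0 : ((1 + (X : ℝ[X]) • A.map C).det).eval (-1) = (1 - A).det := by
    rw [← coe_evalRingHom, RingHom.map_det]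
    congr 1
    ext i j
    by_cases h : i = j <;>
    simp [h, sub_eq_add_neg]
  have hc := Matrix.coeff_det_one_add_X_smul_eq_sum_minors A
  rw [← h0, eval_eq_sum_range' (n := k + 1)]
  · refine Finset.sum_congr rfl fun n _ => ?_
    rw [hc, mul_comm]
  · refine Nat.lt_succ_of_le (natDegree_le_iff_coeff_eq_zero.2 fun n hn => ?_)
    rw [hc, Finset.powersetCard_eq_empty.2 (by simpa using hn), Finset.sum_empty]

/-- An instance of `det (1 - AB) = det (1 - BA)`. The factorials cancel against the enumerations,
and minors of size above `k` do not exist, so the Fredholm series stops. -/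
theorem fredholmDet_finiteRank {ι : Type*} {k : ℕ} (f g : Fin k → ι → ℝ)
    (hs : ∀ m n, Summable fun x => g m x * f n x) :
    fredholmDet (fun x y => ∑ m, f m x * g m y) =
      (1 - Matrix.of fun m n => ∑' x, g m x * f n x).det := by
  unfold fredholmDet
  simp only [(hasSum_det_finiteRank f g hs _).tsum_eq, sum_det_submatrix]
  rw [det_one_sub_eq_sum_minors, tsum_eq_sum (s := Finset.range (k + 1))]
  · refine Finset.sum_congr rfl fun n _ => ?_
    have : (n.factorial : ℝ) ≠ 0 := by exact_mod_cast n.factorial_ne_zero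
    field_simp
  · intro n hn
    rw [Finset.powersetCard_eq_empty.2 (by simpa using hn)]
    simp

/-! ### `q`-shifted factorials, nodes and weights -/

section Basics

variable {q a b : ℝ}

theorem choose_two_succ (n : ℕ) : (n + 1).choose 2 = n + n.choose 2 := by
  rw [Nat.choose_succ_succ' n 1, Nat.choose_one_right]

theorem qPoch_zero (x q : ℝ) : qPoch x q 0 = 1 := by simp [qPoch]

theorem qPoch_succ (x q : ℝ) (n : ℕ) : qPoch x q (n + 1) = qPoch x q n * (1 - x * q ^ n) :=
  Finset.prod_range_succ _ _

theorem qPoch_succ' (x q : ℝ) (n : ℕ) : qPoch x q (n + 1) = (1 - x) * qPoch (x * q) q n := by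
  unfold qPoch
  rw [Finset.prod_range_succ', mul_comm]
  simp [pow_succ', mul_assoc]

theorem qPoch_self_pos (hq0 : 0 < q) (hq1 : q < 1) (n : ℕ) : 0 < qPoch q q n := by
  refine Finset.prod_pos fun l _ => ?_
  have : q * q ^ l < 1 := by
    rw [← pow_succ']; exact pow_lt_one₀ hq0.le hq1 (by omega)
  linarith

theorem qPoch_self_succ (q : ℝ) (n : ℕ) : qPoch q q (n + 1) = qPoch q q n * (1 - q ^ (n + 1)) := by
  rw [qPoch_succ, pow_succ']

theorem qPoch_inv_pow (hq0 : 0 < q) (n : ℕ) :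
    qPoch (q ^ n)⁻¹ q n = (-1) ^ n * qPoch q q n / q ^ (n + 1).choose 2 := by
  induction n with
  | zero => simp [qPoch_zero]
  | succ n ih =>
    have e : (q ^ (n + 1))⁻¹ * q = (q ^ n)⁻¹ := by rw [pow_succ]; field_simp
    rw [qPoch_succ', e, ih, qPoch_self_succ, choose_two_succ (n + 1), pow_add]
    field_simp
    ring

theorem qPoch_inv_pow_eq_zero (hq0 : 0 < q) {n j : ℕ} (h : n < j) : qPoch (q ^ n)⁻¹ q j = 0 :=
  Finset.prod_eq_zero (Finset.mem_range.2 h) (by field_simp; simp)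

theorem node_eq (q : ℝ) (x : ℕ) : node q x = (q ^ x)⁻¹ := by
  rw [node, zpow_neg, zpow_natCast]

theorem node_zero (q : ℝ) : node q 0 = 1 := by simp [node_eq]

theorem node_pos (hq0 : 0 < q) (x : ℕ) : 0 < node q x := by rw [node_eq]; positivity

theorem node_succ_mul (hq0 : 0 < q) (x : ℕ) : node q (x + 1) * q = node q x := by
  rw [node_eq, node_eq, pow_succ]; field_simp

theorem node_strictMono (hq0 : 0 < q) (hq1 : q < 1) : StrictMono (node q) := by
  refine strictMono_nat_of_lt_succ fun x => ?_
  rw [← node_succ_mul hq0 x]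
  have := node_pos hq0 (x + 1)
  nlinarith

theorem weight_zero (q a : ℝ) : weight q a 0 = 1 := by simp [weight, qPoch_zero]

theorem weight_pos (hq0 : 0 < q) (hq1 : q < 1) (ha : 0 < a) (x : ℕ) : 0 < weight q a x := by
  have := qPoch_self_pos hq0 hq1 x
  unfold weight; positivity

theorem weight_succ (hq0 : 0 < q) (hq1 : q < 1) (a : ℝ) (x : ℕ) :
    (1 - q ^ (x + 1)) * weight q a (x + 1) = a * q ^ x * weight q a x := by
  have h1 := (qPoch_self_pos hq0 hq1 x).ne'
  have h2 := (qPoch_self_pos hq0 hq1 (x + 1)).ne'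
  rw [qPoch_self_succ] at h2
  unfold weight
  rw [qPoch_self_succ, choose_two_succ, pow_add q x (x.choose 2), pow_succ a]
  have h3 := right_ne_zero_of_mul h2
  generalize 1 - q ^ (x + 1) = c at *
  field_simp

theorem weight_mul_pow (q a : ℝ) (c : ℝ) (x : ℕ) : weight q (a * c) x = weight q a x * c ^ x := by
  unfold weight; rw [mul_pow]; ring

/-- The discrete Pearson equation of the weight. It is the only property of `ω` used for the
dilation step. -/
theorem node_sub_one_mul_weight (hq0 : 0 < q) (hq1 : q < 1) (a : ℝ) (x : ℕ) :
    (node q (x + 1) - 1) * weight q a (x + 1) = a / q * weight q a x := by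
  have h := weight_succ hq0 hq1 a x
  have e : node q (x + 1) - 1 = (1 - q ^ (x + 1)) * (q ^ (x + 1))⁻¹ := by
    rw [node_eq]; field_simp
  rw [e, mul_right_comm, h, pow_succ]
  field_simp

/-- Powers of the node are absorbed into the parameter, so every moment reduces to Euler's sum with
`a` replaced by `a / q^i`. -/
theorem weight_mul_node_pow (q a : ℝ) (i x : ℕ) :
    weight q a x * node q x ^ i = weight q (a / q ^ i) x := by
  rw [div_eq_mul_inv, weight_mul_pow, node_eq, inv_pow, inv_pow, ← pow_mul, ← pow_mul, mul_comm i]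

theorem summable_weight (hq0 : 0 < q) (hq1 : q < 1) (ha : 0 < a) : Summable (weight q a) := by
  refine summable_of_ratio_test_tendsto_lt_one (l := 0) one_pos
    (Eventually.of_forall fun n => (weight_pos hq0 hq1 ha n).ne') ?_
  have e : ∀ n, ‖weight q a (n + 1)‖ / ‖weight q a n‖ = a * q ^ n / (1 - q ^ (n + 1)) := by
    intro n
    have h0 := weight_pos hq0 hq1 ha n
    have h1 : 0 < 1 - q ^ (n + 1) := by
      have := pow_lt_one₀ hq0.le hq1 (n := n + 1) (by omega); linarith
    rw [Real.norm_of_nonneg h0.le, Real.norm_of_nonneg (weight_pos hq0 hq1 ha _).le,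
      div_eq_div_iff h0.ne' h1.ne', ← weight_succ hq0 hq1]
    ring
  simp only [e]
  have h1 := tendsto_pow_atTop_nhds_zero_of_lt_one hq0.le hq1
  have h2 := (tendsto_add_atTop_iff_nat 1).2 h1
  have h3 : Tendsto (fun n => a * q ^ n / (1 - q ^ (n + 1))) atTop (𝓝 (a * 0 / (1 - 0))) :=
    (h1.const_mul a).div (h2.const_sub 1) (by norm_num)
  simpa using h3

theorem tsum_weight_succ (hq0 : 0 < q) (hq1 : q < 1) (hb : 0 < b) :
    ∑' x, weight q b x = (1 + b) * ∑' x, weight q (b * q) x := by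
  have hs := summable_weight hq0 hq1 hb
  have hs' := summable_weight hq0 hq1 (mul_pos hb hq0)
  have h1 : ∑' x, (weight q b x - weight q (b * q) x) = b * ∑' x, weight q (b * q) x := by
    rw [(hs.sub hs').tsum_eq_zero_add, weight_zero, weight_zero, sub_self, zero_add,
      ← tsum_mul_left]
    refine tsum_congr fun x => ?_
    have := weight_succ hq0 hq1 b x
    rw [weight_mul_pow, weight_mul_pow]
    linear_combination this
  rw [hs.tsum_sub hs'] at h1
  linarith

theorem tsum_weight_eq_prod (hq0 : 0 < q) (hq1 : q < 1) (hb : 0 < b) (n : ℕ) :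
    ∑' x, weight q b x = qPoch (-b) q n * ∑' x, weight q (b * q ^ n) x := by
  induction n with
  | zero => simp [qPoch_zero]
  | succ n ih =>
    rw [ih, tsum_weight_succ hq0 hq1 (by positivity : 0 < b * q ^ n), qPoch_succ, mul_assoc b,
      ← pow_succ]
    ring

theorem multipliable_qPochInf (hq0 : 0 < q) (hq1 : q < 1) (x : ℝ) :
    Multipliable fun l : ℕ => 1 - x * q ^ l := by
  have : Multipliable fun l : ℕ => 1 + (-x * q ^ l) := by
    refine multipliable_one_add_of_summable ?_
    exact ((summable_geometric_of_lt_one hq0.le hq1).mul_left (-x)).norm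
  simpa [sub_eq_add_neg] using this

/-- Euler's identity `∑ b^x q^{x(x-1)/2} / (q;q)_x = (-b;q)_∞`. -/
theorem tsum_weight (hq0 : 0 < q) (hq1 : q < 1) (hb : 0 < b) :
    ∑' x, weight q b x = qPochInf (-b) q := by
  have h1 : Tendsto (fun n => qPoch (-b) q n) atTop (𝓝 (qPochInf (-b) q)) :=
    (multipliable_qPochInf hq0 hq1 (-b)).hasProd.tendsto_prod_nat
  -- Iterating the functional equation `S(b) = (1 + b) S(bq)` drives the parameter to `0`, where
  -- only the term `x = 0` survives; the series at `b` itself is the dominating one.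
  have h2 : Tendsto (fun n : ℕ => ∑' x, weight q (b * q ^ n) x) atTop
      (𝓝 (∑' x, if x = 0 then 1 else 0)) := by
    refine tendsto_tsum_of_dominated_convergence (summable_weight hq0 hq1 hb) ?_ ?_
    · intro x
      simp only [weight_mul_pow]
      split_ifs with hx
      · subst hx; simp [weight_zero]
      · have h := tendsto_pow_atTop_nhds_zero_of_lt_one (pow_nonneg hq0.le x)
          (pow_lt_one₀ hq0.le hq1 hx)
        have := h.const_mul (weight q b x)
        rw [mul_zero] at this
        refine this.congr fun n => ?_
        rw [← pow_mul, ← pow_mul, mul_comm n]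
    · refine Eventually.of_forall fun n x => ?_
      have hw := weight_pos hq0 hq1 hb x
      rw [weight_mul_pow, Real.norm_of_nonneg (by positivity)]
      exact mul_le_of_le_one_right hw.le (pow_le_one₀ (by positivity) (pow_le_one₀ hq0.le hq1.le))
  rw [tsum_ite_eq] at h2
  have h3 := h1.mul h2
  rw [mul_one] at h3
  refine tendsto_nhds_unique ?_ h3
  simp only [← tsum_weight_eq_prod hq0 hq1 hb]
  exact tendsto_const_nhds

theorem qPochInf_split (hq0 : 0 < q) (hq1 : q < 1) (hb : 0 < b) (n : ℕ) :
    qPochInf (-b) q = qPoch (-b) q n * qPochInf (-(b * q ^ n)) q := by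
  rw [← tsum_weight hq0 hq1 hb, tsum_weight_eq_prod hq0 hq1 hb n,
    tsum_weight hq0 hq1 (by positivity)]

theorem qPochInf_pos (hq0 : 0 < q) (hq1 : q < 1) (hb : 0 < b) : 0 < qPochInf (-b) q := by
  rw [← tsum_weight hq0 hq1 hb]
  exact (summable_weight hq0 hq1 hb).tsum_pos (fun x => (weight_pos hq0 hq1 hb x).le) 0
    (weight_pos hq0 hq1 hb 0)

/-- The factor `1 - π_x` kills the term `x = 0`. For the others the Pearson equation absorbs it and
lowers `x` by one, turning the remaining factors into `(π_{x-1}; q)_j`. -/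
theorem hasSum_qPoch_node (hq0 : 0 < q) (hq1 : q < 1) (hb : 0 < b) (j : ℕ) :
    HasSum (fun x => qPoch (node q x) q j * weight q b x)
      ((-(b / q)) ^ j * qPochInf (-b) q) := by
  induction j with
  | zero =>
    simpa [qPoch_zero, tsum_weight hq0 hq1 hb] using (summable_weight hq0 hq1 hb).hasSum
  | succ j ih =>
    rw [← hasSum_nat_add_iff' 1]
    simp only [Finset.range_one, Finset.sum_singleton, qPoch_succ', node_zero, sub_self, zero_mul,
      sub_zero, node_succ_mul hq0]
    have := ih.mul_left (-(b / q))
    rw [← mul_assoc, ← pow_succ'] at this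
    refine this.congr_fun fun x => ?_
    have h := node_sub_one_mul_weight hq0 hq1 b x
    linear_combination (-qPoch (node q x) q j) * h

/-- The coefficients of the terminating `q`-binomial series. -/
def qBinomCoeff (q : ℝ) (n j : ℕ) : ℝ := qPoch (q ^ n)⁻¹ q j / qPoch q q j

theorem qBinomCoeff_succ (hq0 : 0 < q) (hq1 : q < 1) (n j : ℕ) :
    qBinomCoeff q (n + 1) (j + 1) =
      qBinomCoeff q n (j + 1) - (q ^ (n + 1))⁻¹ * qBinomCoeff q n j := by
  have e : (q ^ (n + 1))⁻¹ * q = (q ^ n)⁻¹ := by rw [pow_succ]; field_simp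
  have h1 := (qPoch_self_pos hq0 hq1 j).ne'
  have h2 := (qPoch_self_pos hq0 hq1 (j + 1)).ne'
  rw [qPoch_self_succ] at h2
  have h3 := right_ne_zero_of_mul h2
  unfold qBinomCoeff
  rw [qPoch_succ', e, qPoch_succ (q ^ n)⁻¹, qPoch_self_succ]
  have hq := hq0.ne'
  field_simp
  ring

/-- The terminating `q`-binomial theorem, by induction with the Pascal rule `qBinomCoeff_succ`. -/
theorem sum_qBinomCoeff (hq0 : 0 < q) (hq1 : q < 1) (n : ℕ) (z : ℝ) :
    ∑ j ∈ Finset.range (n + 1), qBinomCoeff q n j * z ^ j = qPoch (z * (q ^ n)⁻¹) q n := by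
  induction n with
  | zero => simp [qPoch_zero, qBinomCoeff]
  | succ n ih =>
    have e : (z * (q ^ (n + 1))⁻¹) * q = z * (q ^ n)⁻¹ := by rw [pow_succ]; field_simp
    have h0 : qBinomCoeff q n (n + 1) = 0 := by
      rw [qBinomCoeff, qPoch_inv_pow_eq_zero hq0 n.lt_succ_self, zero_div]
    have h1 : ∑ j ∈ Finset.range (n + 1), qBinomCoeff q n (j + 1) * z ^ (j + 1) +
        qBinomCoeff q n 0 * z ^ 0 = ∑ j ∈ Finset.range (n + 1), qBinomCoeff q n j * z ^ j := by
      rw [← Finset.sum_range_succ' (fun j => qBinomCoeff q n j * z ^ j), Finset.sum_range_succ, h0]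
      ring
    rw [qPoch_succ', e, ← ih, Finset.sum_range_succ']
    simp only [qBinomCoeff_succ hq0 hq1, sub_mul]
    rw [Finset.sum_sub_distrib]
    have h2 : qBinomCoeff q (n + 1) 0 = qBinomCoeff q n 0 := by simp [qBinomCoeff, qPoch_zero]
    rw [h2]
    have h3 : ∑ j ∈ Finset.range (n + 1), (q ^ (n + 1))⁻¹ * qBinomCoeff q n j * z ^ (j + 1) =
        z * (q ^ (n + 1))⁻¹ * ∑ j ∈ Finset.range (n + 1), qBinomCoeff q n j * z ^ j := by
      rw [Finset.mul_sum]
      exact Finset.sum_congr rfl fun j _ => by ring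
    rw [h3]
    linear_combination h1

end Basics

/-! ### The moment functionals -/

/-- Summation over the first `s` nodes against the `q`-Charlier weight. -/
def partialFunctional (q a : ℝ) (s : ℕ) : ℝ[X] →ₗ[ℝ] ℝ :=
  ∑ x ∈ Finset.range s, weight q a x • Polynomial.leval (node q x)

/-- The moment functional of the `q`-Charlier weight. -/
def charlierFunctional (q a : ℝ) : ℝ[X] →ₗ[ℝ] ℝ :=
  Polynomial.lsum fun i => (∑' x, node q x ^ i * weight q a x) • LinearMap.id

section Functionals

variable {q a : ℝ}

theorem partialFunctional_apply (q a : ℝ) (s : ℕ) (f : ℝ[X]) :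
    partialFunctional q a s f = ∑ x ∈ Finset.range s, f.eval (node q x) * weight q a x := by
  simp [partialFunctional, mul_comm]

theorem partialFunctional_succ (q a : ℝ) (s : ℕ) (f : ℝ[X]) :
    partialFunctional q a (s + 1) f =
      partialFunctional q a s f + weight q a s * f.eval (node q s) := by
  rw [partialFunctional_apply, partialFunctional_apply, Finset.sum_range_succ, mul_comm (weight _ _ _)]

theorem hasSum_charlierFunctional (hq0 : 0 < q) (hq1 : q < 1) (ha : 0 < a) (f : ℝ[X]) :
    HasSum (fun x => f.eval (node q x) * weight q a x) (charlierFunctional q a f) := by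
  induction f using Polynomial.induction_on' with
  | add f g hf hg =>
    rw [map_add]
    simpa [add_mul] using hf.add hg
  | monomial i c =>
    have hs : Summable fun x => node q x ^ i * weight q a x := by
      have := summable_weight hq0 hq1 (div_pos ha (pow_pos hq0 i))
      refine this.congr fun x => ?_
      rw [← weight_mul_node_pow, mul_comm]
    have : charlierFunctional q a (monomial i c) = c * ∑' x, node q x ^ i * weight q a x := by
      simp [charlierFunctional, Polynomial.lsum_apply, Polynomial.sum_monomial_index, mul_comm]
    rw [this]
    simpa [mul_assoc] using hs.hasSum.mul_left c

theorem exists_eval_node_ne_zero (hq0 : 0 < q) (hq1 : q < 1) {k : ℕ} {f : ℝ[X]} (hf : f ≠ 0)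
    (hd : f.degree < k) : ∃ x < k, f.eval (node q x) ≠ 0 := by
  by_contra! h
  refine hf (eq_zero_of_degree_lt_of_eval_index_eq_zero (s := Finset.range k) (v := node q)
    ((node_strictMono hq0 hq1).injective.injOn) (by simpa using hd) ?_)
  intro i hi
  exact h i (Finset.mem_range.1 hi)

theorem posOn_partialFunctional (hq0 : 0 < q) (hq1 : q < 1) (ha : 0 < a) {k s : ℕ} (hks : k ≤ s) :
    PosOn (partialFunctional q a s) k := by
  intro f hf hd
  obtain ⟨x, hx, hfx⟩ := exists_eval_node_ne_zero hq0 hq1 hf hd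
  rw [partialFunctional_apply]
  refine Finset.sum_pos' (fun i _ => ?_) ⟨x, Finset.mem_range.2 (by omega), ?_⟩
  · rw [eval_mul]; exact mul_nonneg (mul_self_nonneg _) (weight_pos hq0 hq1 ha i).le
  · rw [eval_mul]; exact mul_pos (mul_self_pos.2 hfx) (weight_pos hq0 hq1 ha x)

theorem posOn_charlierFunctional (hq0 : 0 < q) (hq1 : q < 1) (ha : 0 < a) (k : ℕ) :
    PosOn (charlierFunctional q a) k := by
  intro f hf hd
  obtain ⟨x, -, hfx⟩ := exists_eval_node_ne_zero hq0 hq1 hf hd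
  have hs := hasSum_charlierFunctional hq0 hq1 ha (f * f)
  rw [← hs.tsum_eq]
  refine hs.summable.tsum_pos (fun i => ?_) x ?_
  · rw [eval_mul]; exact mul_nonneg (mul_self_nonneg _) (weight_pos hq0 hq1 ha i).le
  · rw [eval_mul]; exact mul_pos (mul_self_pos.2 hfx) (weight_pos hq0 hq1 ha x)

/-! ### `q`-Charlier polynomials -/

/-- `(X;q)_j` as a polynomial. -/
def qPochPoly (q : ℝ) (j : ℕ) : ℝ[X] := ∏ l ∈ Finset.range j, (1 - C (q ^ l) * X)

theorem eval_qPochPoly (q : ℝ) (j : ℕ) (x : ℝ) : (qPochPoly q j).eval x = qPoch x q j := by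
  simp [qPochPoly, qPoch, eval_prod, mul_comm]

theorem qPochPoly_natDegree_le_coeff (q : ℝ) (j : ℕ) :
    (qPochPoly q j).natDegree ≤ j ∧ (qPochPoly q j).coeff j = (-1) ^ j * q ^ j.choose 2 := by
  induction j with
  | zero => simp [qPochPoly]
  | succ j ih =>
    have e : qPochPoly q (j + 1) = qPochPoly q j - C (q ^ j) * (X * qPochPoly q j) := by
      rw [qPochPoly, Finset.prod_range_succ, ← qPochPoly]; ring
    constructor
    · rw [natDegree_le_iff_coeff_eq_zero]
      intro m hm
      obtain ⟨i, rfl⟩ : ∃ i, m = i + 1 := ⟨m - 1, by omega⟩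
      rw [e, coeff_sub, coeff_C_mul, coeff_X_mul,
        coeff_eq_zero_of_natDegree_lt (by omega : (qPochPoly q j).natDegree < i + 1),
        coeff_eq_zero_of_natDegree_lt (by omega : (qPochPoly q j).natDegree < i)]
      simp
    · rw [e, coeff_sub, coeff_C_mul, coeff_X_mul,
        coeff_eq_zero_of_natDegree_lt (by omega : (qPochPoly q j).natDegree < j + 1), ih.2,
        choose_two_succ, pow_add, pow_succ]
      ring

/-- The monic `q`-Charlier polynomial as a polynomial. -/
def charlierPoly (q a : ℝ) (n : ℕ) : ℝ[X] :=
  ∑ j ∈ Finset.range (n + 1),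
    C ((-1) ^ n * a ^ n * (q ^ n ^ 2)⁻¹ * (qBinomCoeff q n j * (-(q ^ (n + 1) / a)) ^ j)) *
      qPochPoly q j

theorem eval_charlierPoly (hq0 : 0 < q) (n : ℕ) (ζ : ℝ) :
    (charlierPoly q a n).eval ζ = monicCharlier q a n ζ := by
  unfold monicCharlier charlier basicHyp charlierPoly
  have e : q ^ (-((n : ℤ) ^ 2)) = (q ^ n ^ 2)⁻¹ := by
    rw [zpow_neg]; congr 1
  rw [tsum_eq_sum (s := Finset.range (n + 1)), eval_finsetSum, Finset.mul_sum, e]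
  · refine Finset.sum_congr rfl fun j _ => ?_
    have h0 : qPoch 0 q j = 1 := by simp [qPoch]
    simp [eval_qPochPoly, qBinomCoeff, h0]
    ring
  · intro j hj
    simp [qPoch_inv_pow_eq_zero hq0 (by simpa using hj : n < j)]

theorem monicCharlier_eq_eval (hq0 : 0 < q) (n : ℕ) :
    monicCharlier q a n = fun ζ => (charlierPoly q a n).eval ζ :=
  funext fun ζ => (eval_charlierPoly hq0 n ζ).symm

theorem charlierPoly_natDegree_le (q a : ℝ) (n : ℕ) : (charlierPoly q a n).natDegree ≤ n := by
  refine natDegree_sum_le_of_forall_le _ _ fun j hj => ?_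
  exact (natDegree_C_mul_le _ _).trans ((qPochPoly_natDegree_le_coeff q j).1.trans
    (Nat.lt_succ_iff.1 (Finset.mem_range.1 hj)))

theorem charlierPoly_coeff (hq0 : 0 < q) (hq1 : q < 1) (ha : 0 < a) (n : ℕ) :
    (charlierPoly q a n).coeff n = 1 := by
  unfold charlierPoly
  rw [finsetSum_coeff, Finset.sum_range_succ, Finset.sum_eq_zero, zero_add, coeff_C_mul,
    (qPochPoly_natDegree_le_coeff q n).2, qBinomCoeff, qPoch_inv_pow hq0, choose_two_succ]
  · have h1 := (qPoch_self_pos hq0 hq1 n).ne'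
    have hs : ((-1 : ℝ) ^ n) ^ 2 = 1 := by rw [← pow_mul, mul_comm, pow_mul]; simp
    have hqn : q ^ n ≠ 0 := (pow_pos hq0 n).ne'
    rw [neg_pow (q ^ (n + 1) / a), div_pow, ← pow_mul, show (n + 1) * n = n ^ 2 + n by ring]
    simp only [pow_add]
    field_simp
    -- Four sign factors occur, hence `t⁴ - 1 = (t² + 1)(t² - 1)` with `t = (-1)^n`.
    linear_combination (((-1 : ℝ) ^ n) ^ 2 + 1) * hs
  · intro j hj
    rw [coeff_C_mul, coeff_eq_zero_of_natDegree_lt, mul_zero]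
    exact lt_of_le_of_lt (qPochPoly_natDegree_le_coeff q j).1 (Finset.mem_range.1 hj)

theorem charlierPoly_natDegree (hq0 : 0 < q) (hq1 : q < 1) (ha : 0 < a) (n : ℕ) :
    (charlierPoly q a n).natDegree = n :=
  le_antisymm (charlierPoly_natDegree_le q a n)
    (le_natDegree_of_ne_zero (by rw [charlierPoly_coeff hq0 hq1 ha]; exact one_ne_zero))

theorem charlierPoly_monic (hq0 : 0 < q) (hq1 : q < 1) (ha : 0 < a) (n : ℕ) :
    (charlierPoly q a n).Monic := by
  rw [Monic, leadingCoeff, charlierPoly_natDegree hq0 hq1 ha, charlierPoly_coeff hq0 hq1 ha]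

theorem charlierFunctional_qPochPoly_mul_X_pow (hq0 : 0 < q) (hq1 : q < 1) (ha : 0 < a)
    (i j : ℕ) : charlierFunctional q a (qPochPoly q j * X ^ i) =
      (-(a / q ^ i / q)) ^ j * qPochInf (-(a / q ^ i)) q := by
  refine (hasSum_charlierFunctional hq0 hq1 ha _).unique ?_
  refine (hasSum_qPoch_node hq0 hq1 (div_pos ha (pow_pos hq0 i)) j).congr_fun fun x => ?_
  rw [← weight_mul_node_pow]
  simp [eval_qPochPoly]
  ring

/-- Expanded in the basis `(X; q)_j`, the moment becomes a `q`-binomial sum with value `(q^{-i};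
q)_n`. This vanishes for `i < n`, which is orthogonality, and gives the norm for `i = n`. -/
theorem charlierFunctional_charlierPoly_mul_X_pow (hq0 : 0 < q) (hq1 : q < 1) (ha : 0 < a)
    (n i : ℕ) : charlierFunctional q a (charlierPoly q a n * X ^ i) =
      (-1) ^ n * a ^ n * (q ^ n ^ 2)⁻¹ * qPochInf (-(a / q ^ i)) q * qPoch (q ^ i)⁻¹ q n := by
  have h := sum_qBinomCoeff hq0 hq1 n (q ^ n * (q ^ i)⁻¹)
  have e : q ^ n * (q ^ i)⁻¹ * (q ^ n)⁻¹ = (q ^ i)⁻¹ := by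
    have := (pow_pos hq0 n).ne'
    field_simp
  rw [e] at h
  unfold charlierPoly
  rw [Finset.sum_mul, map_sum, ← h, Finset.mul_sum]
  refine Finset.sum_congr rfl fun j _ => ?_
  rw [mul_assoc, C_mul', map_smul, charlierFunctional_qPochPoly_mul_X_pow hq0 hq1 ha, smul_eq_mul]
  have e2 : (-(q ^ (n + 1) / a)) ^ j * (-(a / q ^ i / q)) ^ j = (q ^ n * (q ^ i)⁻¹) ^ j := by
    rw [← mul_pow]
    congr 1
    rw [pow_succ]
    field_simp
  linear_combination ((-1) ^ n * a ^ n * (q ^ n ^ 2)⁻¹ * qPochInf (-(a / q ^ i)) q *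
    qBinomCoeff q n j) * e2

theorem charlierFunctional_orth (hq0 : 0 < q) (hq1 : q < 1) (ha : 0 < a) {n i : ℕ} (h : i < n) :
    charlierFunctional q a (charlierPoly q a n * X ^ i) = 0 := by
  rw [charlierFunctional_charlierPoly_mul_X_pow hq0 hq1 ha, qPoch_inv_pow_eq_zero hq0 h, mul_zero]

theorem charlierFunctional_orth' (hq0 : 0 < q) (hq1 : q < 1) (ha : 0 < a) {n : ℕ} {g : ℝ[X]}
    (h : g.degree < n) : charlierFunctional q a (charlierPoly q a n * g) = 0 := by
  simpa using map_mul_eq_of_moments (L := charlierFunctional q a) (ψ := 0)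
    (fun j hj => by simpa using charlierFunctional_orth hq0 hq1 ha hj) h

theorem charlierFunctional_mul_self (hq0 : 0 < q) (hq1 : q < 1) (ha : 0 < a) (n : ℕ) :
    charlierFunctional q a (charlierPoly q a n * charlierPoly q a n) = normSq q a n := by
  rw [← (hasSum_charlierFunctional hq0 hq1 ha _).tsum_eq, normSq]
  exact tsum_congr fun x => by rw [eval_mul, eval_charlierPoly hq0, sq]

theorem degree_X_pow_sub_charlierPoly (hq0 : 0 < q) (hq1 : q < 1) (ha : 0 < a) (n : ℕ) :
    ((X : ℝ[X]) ^ n - charlierPoly q a n).degree < (n : WithBot ℕ) := by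
  have hm := charlierPoly_monic hq0 hq1 ha n
  have := degree_sub_lt_left (p := (X ^ n : ℝ[X])) (q := charlierPoly q a n)
    (by rw [degree_X_pow, degree_eq_natDegree hm.ne_zero, charlierPoly_natDegree hq0 hq1 ha])
    (by simp) (by simp [hm.leadingCoeff])
  simpa using this

theorem charlierFunctional_mul_X_pow_self (hq0 : 0 < q) (hq1 : q < 1) (ha : 0 < a) (n : ℕ) :
    charlierFunctional q a (charlierPoly q a n * X ^ n) = normSq q a n := by
  have e : charlierPoly q a n * X ^ n = charlierPoly q a n * charlierPoly q a n +
      charlierPoly q a n * (X ^ n - charlierPoly q a n) := by ring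
  rw [e, map_add, charlierFunctional_mul_self hq0 hq1 ha, charlierFunctional_orth' hq0 hq1 ha
    (degree_X_pow_sub_charlierPoly hq0 hq1 ha n), add_zero]

theorem normSq_pos (hq0 : 0 < q) (hq1 : q < 1) (ha : 0 < a) (n : ℕ) : 0 < normSq q a n := by
  rw [← charlierFunctional_mul_self hq0 hq1 ha]
  have hm := charlierPoly_monic hq0 hq1 ha n
  refine posOn_charlierFunctional hq0 hq1 ha (n + 1) _ hm.ne_zero ?_
  rw [degree_eq_natDegree hm.ne_zero, charlierPoly_natDegree hq0 hq1 ha]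
  exact_mod_cast n.lt_succ_self

theorem qPoch_neg_div (hq0 : 0 < q) (ha : 0 < a) (n : ℕ) :
    qPoch (-(a / q ^ n)) q n = a ^ n / q ^ (n + 1).choose 2 * qPoch (-(a⁻¹ * q)) q n := by
  induction n with
  | zero => simp [qPoch_zero]
  | succ n ih =>
    have e : -(a / q ^ (n + 1)) * q = -(a / q ^ n) := by rw [pow_succ]; field_simp
    rw [qPoch_succ', e, ih, qPoch_succ, choose_two_succ (n + 1), pow_add]
    field_simp
    ring

theorem normSq_eq (hq0 : 0 < q) (hq1 : q < 1) (ha : 0 < a) (n : ℕ) :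
    normSq q a n = qPochInf (-a) q * a ^ (2 * n) * (q ^ n ^ 2)⁻¹ *
      ((q ^ (n + 1).choose 2)⁻¹) ^ 2 * qPoch (-(a⁻¹ * q)) q n * qPoch q q n := by
  rw [← charlierFunctional_mul_X_pow_self hq0 hq1 ha,
    charlierFunctional_charlierPoly_mul_X_pow hq0 hq1 ha, qPoch_inv_pow hq0,
    qPochInf_split hq0 hq1 (div_pos ha (pow_pos hq0 n)) n, qPoch_neg_div hq0 ha,
    div_mul_cancel₀ _ (pow_pos hq0 n).ne']
  have hs : ((-1 : ℝ) ^ n) ^ 2 = 1 := by rw [← pow_mul, mul_comm, pow_mul]; simp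
  field_simp
  linear_combination (a ^ (n * 2) * qPoch (-(q / a)) q n * qPochInf (-a) q * qPoch q q n) * hs

theorem isOPPair_charlier (hq0 : 0 < q) (hq1 : q < 1) (ha : 0 < a) {k : ℕ} (hk : 1 ≤ k) :
    IsOPPair (charlierFunctional q a) k (charlierPoly q a k)
      (C (normSq q a (k - 1))⁻¹ * charlierPoly q a (k - 1)) := by
  refine ⟨charlierPoly_monic hq0 hq1 ha k, charlierPoly_natDegree hq0 hq1 ha k, ?_,
    fun j hj => charlierFunctional_orth hq0 hq1 ha hj, fun j hj => ?_⟩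
  · rw [C_mul']
    refine lt_of_le_of_lt ((degree_smul_le _ _).trans degree_le_natDegree) ?_
    rw [charlierPoly_natDegree hq0 hq1 ha]
    exact_mod_cast (by omega)
  · rw [mul_assoc, C_mul', map_smul, smul_eq_mul]
    split_ifs with h
    · obtain rfl : j = k - 1 := by omega
      rw [charlierFunctional_mul_X_pow_self hq0 hq1 ha,
        inv_mul_cancel₀ (normSq_pos hq0 hq1 ha _).ne']
    · rw [charlierFunctional_orth hq0 hq1 ha (by omega), mul_zero]

/-- The off-diagonal case is the Christoffel–Darboux formula for the pair `P_k`, `P_{k-1} /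
‖P_{k-1}‖²`; the diagonal case is its confluent form. -/
theorem kernel_eq (hq0 : 0 < q) (hq1 : q < 1) (ha : 0 < a) {k : ℕ} (hk : 1 ≤ k) (x y : ℕ) :
    kernel q a k x y = √(weight q a x) * √(weight q a y) *
      (evalKer (charlierFunctional q a) k (node q y)).eval (node q x) := by
  have hp := isOPPair_charlier hq0 hq1 ha hk
  have hL := posOn_charlierFunctional hq0 hq1 ha k
  unfold kernel
  rw [monicCharlier_eq_eval hq0, monicCharlier_eq_eval hq0]
  simp only [Polynomial.deriv]
  split_ifs with hxy
  · subst hxy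
    rw [Real.mul_self_sqrt (weight_pos hq0 hq1 ha x).le, hp.evalKer_self hk hL]
    simp
    ring
  · have hne : node q x - node q y ≠ 0 :=
      sub_ne_zero.2 fun h => hxy ((node_strictMono hq0 hq1).injective h)
    have := hp.evalKer_eval hk hL (node q x) (node q y)
    have e : (evalKer (charlierFunctional q a) k (node q y)).eval (node q x) =
        ((normSq q a (k - 1))⁻¹ * ((charlierPoly q a k).eval (node q x) *
          (charlierPoly q a (k - 1)).eval (node q y) - (charlierPoly q a (k - 1)).eval (node q x) *
          (charlierPoly q a k).eval (node q y))) / (node q x - node q y) := by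
      rw [eq_div_iff hne, mul_comm, this]
      simp
      ring
    rw [e, Real.sqrt_mul (weight_pos hq0 hq1 ha x).le]
    ring

/-- The gap probability `D_s` is a quotient of Hankel determinants. -/
theorem D_eq (hq0 : 0 < q) (hq1 : q < 1) (ha : 0 < a) {k : ℕ} (hk : 1 ≤ k) (s : ℕ) :
    D q a k s = (hankel (partialFunctional q a s) k).det /
      (hankel (charlierFunctional q a) k).det := by
  have hL := posOn_charlierFunctional hq0 hq1 ha k
  set H := hankel (charlierFunctional q a) k with hH
  have hdet : H.det ≠ 0 := hL.det_ne_zero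
  -- The kernel is factored through monomials, the inverse moment matrix going into `g`. The Gram
  -- matrix of `g` and `f` over `x ≥ s` is then `H⁻¹ (H - H_s)`, and `1` minus it is `H⁻¹ H_s`.
  set f : Fin k → Set.Ici s → ℝ := fun m x => √(weight q a x) * node q x ^ (m : ℕ) with hf
  set g : Fin k → Set.Ici s → ℝ := fun m y =>
    √(weight q a y) * H⁻¹.mulVec (fun i : Fin k => node q y ^ (i : ℕ)) m with hg
  have hK : (fun x y : Set.Ici s => kernel q a k x y) = fun x y => ∑ m, f m x * g m y := by
    funext x y
    rw [kernel_eq hq0 hq1 ha hk]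
    simp only [evalKer, ofMoments, vecPoly, eval_finsetSum, eval_mul, eval_C, eval_pow, eval_X,
      Finset.mul_sum, hf, hg]
    exact Finset.sum_congr rfl fun m _ => by ring
  have htail : ∀ i : ℕ, HasSum (fun x : Set.Ici s => weight q a x * node q x ^ i)
      (charlierFunctional q a (X ^ i) - partialFunctional q a s (X ^ i)) := by
    intro i
    have h := hasSum_charlierFunctional hq0 hq1 ha (X ^ i)
    have h2 := (Finset.hasSum_compl_iff (s := Finset.range s)
      (f := fun x => (X ^ i : ℝ[X]).eval (node q x) * weight q a x)
      (a := charlierFunctional q a (X ^ i) - partialFunctional q a s (X ^ i))).2 (by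
        rw [partialFunctional_apply, sub_add_cancel]; exact h)
    let e : Set.Ici s ≃ {x // x ∉ Finset.range s} :=
      Equiv.subtypeEquivRight fun x => by simp
    rw [← e.hasSum_iff] at h2
    refine h2.congr_fun fun x => ?_
    simp [e, mul_comm]
  have hgf : ∀ m n, HasSum (fun x => g m x * f n x)
      ((H⁻¹ * (H - hankel (partialFunctional q a s) k)) m n) := by
    intro m n
    have h1 : HasSum (fun x : Set.Ici s => ∑ i, H⁻¹ m i * (weight q a x * node q x ^ ((i : ℕ) + n)))
        (∑ i, H⁻¹ m i * (charlierFunctional q a (X ^ ((i : ℕ) + n)) -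
          partialFunctional q a s (X ^ ((i : ℕ) + n)))) :=
      hasSum_sum fun i _ => (htail _).mul_left _
    rw [Matrix.mul_apply]
    refine h1.congr_fun fun x => ?_
    have hw := Real.mul_self_sqrt (weight_pos hq0 hq1 ha x).le
    simp only [hg, hf, Matrix.mulVec, dotProduct]
    rw [Finset.mul_sum, Finset.sum_mul]
    refine Finset.sum_congr rfl fun i _ => ?_
    rw [pow_add]
    linear_combination (H⁻¹ m i * node q x ^ (i : ℕ) * node q x ^ (n : ℕ)) * hw
  rw [D, hK, fredholmDet_finiteRank f g fun m n => (hgf m n).summable]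
  have hA : (Matrix.of fun m n => ∑' x, g m x * f n x) =
      H⁻¹ * (H - hankel (partialFunctional q a s) k) := by
    ext m n
    exact (hgf m n).tsum_eq
  rw [hA, mul_sub, Matrix.nonsing_inv_mul _ (isUnit_iff_ne_zero.2 hdet), sub_sub_cancel,
    Matrix.det_mul, Matrix.det_nonsing_inv, Ring.inverse_eq_inv', inv_mul_eq_div]

end Functionals

/-! ### The entries of the Lax pair -/

section Entries

/-- The diagonal value `κ_s` of the reproducing kernel of the first `s` nodes at `π_s`. -/
def diagKer (q a : ℝ) (k s : ℕ) : ℝ :=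
  (evalKer (partialFunctional q a s) k (node q s)).eval (node q s)

/-- The scale `ω(s) / (1 + ω(s) κ_s)` of the residue matrix at `π_s`. -/
def residueScale (q a : ℝ) (k s : ℕ) : ℝ :=
  weight q a s / (1 + weight q a s * diagKer q a k s)

variable (q a : ℝ) (k : ℕ) (P R : ℕ → ℝ[X])

/-- With `μ` the residue scale and `P`, `R` evaluated at `π_s`, the residue matrix is `μ` times the
column `(P, R)` times the row `(-R, P)`: rank one and nilpotent, as forced by the
Christoffel–Darboux formula. -/
def entryP (s : ℕ) : ℝ :=
  -(residueScale q a k s * (P s).eval (node q s) * (R s).eval (node q s))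

def entryQ (s : ℕ) : ℝ := residueScale q a k s * (P s).eval (node q s) ^ 2

def entryR (s : ℕ) : ℝ := -(residueScale q a k s * (R s).eval (node q s) ^ 2)

def entryAlpha (s : ℕ) : ℝ :=
  q ^ (k - 1) * (P s).coeff (k - 1) - q ^ k - q ^ k * (P (s + 1)).coeff (k - 1)

def entryBeta (s : ℕ) : ℝ := -(q ^ k * partialFunctional q a (s + 1) (P (s + 1) * X ^ k))

def entryGamma (s : ℕ) : ℝ := q ^ (k - 1) * (R s).coeff (k - 1)

def entryEps (s : ℕ) : ℝ :=
  a * (q ^ (-(s : ℤ) - 1) - 1) + q ^ ((k : ℤ) - 1) *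
    (a * q ^ (-(k : ℤ)) * entryP q a k P R s - entryR q a k R s * entryBeta q a k P s)

def entryU (s : ℕ) : ℝ :=
  q ^ k * (entryP q a k P R s / entryQ q a k P s ^ 2) *
    (entryP q a k P R s * entryBeta q a k P s + a * q ^ (-(k : ℤ)) * entryQ q a k P s)

end Entries

/-! ### The two Lax equations for polynomials and the data they transport. -/

section Relations

variable {q a : ℝ} {k : ℕ} {P R : ℕ → ℝ[X]}

theorem diagKer_nonneg (hq0 : 0 < q) (hq1 : q < 1) (ha : 0 < a) {s : ℕ} (hs : k ≤ s) :
    0 ≤ diagKer q a k s := (posOn_partialFunctional hq0 hq1 ha hs).evalKer_self_nonneg _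

theorem one_add_weight_mul_diagKer_pos (hq0 : 0 < q) (hq1 : q < 1) (ha : 0 < a) {s : ℕ}
    (hs : k ≤ s) : 0 < 1 + weight q a s * diagKer q a k s := by
  have := diagKer_nonneg hq0 hq1 ha hs
  have := weight_pos hq0 hq1 ha s
  positivity

theorem residueScale_pos (hq0 : 0 < q) (hq1 : q < 1) (ha : 0 < a) {s : ℕ} (hs : k ≤ s) :
    0 < residueScale q a k s :=
  div_pos (weight_pos hq0 hq1 ha s) (one_add_weight_mul_diagKer_pos hq0 hq1 ha hs)

theorem D_ne_zero (hq0 : 0 < q) (hq1 : q < 1) (ha : 0 < a) (hk : 1 ≤ k) {s : ℕ} (hs : k ≤ s) :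
    D q a k s ≠ 0 := by
  rw [D_eq hq0 hq1 ha hk]
  exact div_ne_zero (posOn_partialFunctional hq0 hq1 ha hs).det_ne_zero
    (posOn_charlierFunctional hq0 hq1 ha k).det_ne_zero

theorem D_succ_div (hq0 : 0 < q) (hq1 : q < 1) (ha : 0 < a) (hk : 1 ≤ k) {s : ℕ} (hs : k ≤ s) :
    D q a k (s + 1) / D q a k s = 1 + weight q a s * diagKer q a k s := by
  have h0 := D_ne_zero hq0 hq1 ha hk hs
  rw [div_eq_iff h0, D_eq hq0 hq1 ha hk, D_eq hq0 hq1 ha hk,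
    det_hankel_pointMass (posOn_partialFunctional hq0 hq1 ha hs)
      (partialFunctional_succ q a s), diagKer]
  ring

/-- If `f = (X - π_s) g`, then `L_s (f g) = 0`, although `f g = (X - π_s) g²` is nonpositive at
every node `π_x` with `x < s` and negative at some of them. -/
theorem eval_node_ne_zero_of_orth (hq0 : 0 < q) (hq1 : q < 1) (ha : 0 < a) {s : ℕ} (hs : k ≤ s)
    {f : ℝ[X]} (hf : f ≠ 0) (hd : f.natDegree ≤ k)
    (h : ∀ g : ℝ[X], g.natDegree + 1 = f.natDegree → partialFunctional q a s (f * g) = 0) :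
    f.eval (node q s) ≠ 0 := by
  intro h0
  obtain ⟨g, rfl⟩ := dvd_iff_isRoot.2 h0
  have hg : g ≠ 0 := right_ne_zero_of_mul hf
  have hdeg : ((X - C (node q s)) * g).natDegree = g.natDegree + 1 := by
    rw [natDegree_mul (X_sub_C_ne_zero _) hg, natDegree_X_sub_C, add_comm]
  have h1 := h g hdeg.symm
  obtain ⟨x, hx, hgx⟩ := exists_eval_node_ne_zero hq0 hq1 hg (k := k)
    ((natDegree_lt_iff_degree_lt hg).1 (by omega))
  rw [partialFunctional_apply] at h1
  have h2 : 0 < ∑ x ∈ Finset.range s,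
      -(((X - C (node q s)) * g * g).eval (node q x) * weight q a x) := by
    have e : ∀ y, -(((X - C (node q s)) * g * g).eval (node q y) * weight q a y) =
        (node q s - node q y) * (g.eval (node q y)) ^ 2 * weight q a y := by
      intro y; simp; ring
    simp only [e]
    refine Finset.sum_pos' (fun y hy => ?_) ⟨x, Finset.mem_range.2 (by omega), ?_⟩
    · have := node_strictMono hq0 hq1 (Finset.mem_range.1 hy)
      have := weight_pos hq0 hq1 ha y
      exact mul_nonneg (mul_nonneg (by linarith) (sq_nonneg _)) this.le
    · have := node_strictMono hq0 hq1 (by omega : x < s)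
      have := weight_pos hq0 hq1 ha x
      exact mul_pos (mul_pos (by linarith) (by positivity)) this
  rw [Finset.sum_neg_distrib, h1] at h2
  simp at h2

theorem eval_P_ne_zero (hq0 : 0 < q) (hq1 : q < 1) (ha : 0 < a) {s : ℕ} (hs : k ≤ s) {P R : ℝ[X]}
    (h : IsOPPair (partialFunctional q a s) k P R) : P.eval (node q s) ≠ 0 := by
  refine eval_node_ne_zero_of_orth hq0 hq1 ha hs h.monic.ne_zero h.natDegree.le fun g hg => ?_
  refine h.map_P_mul ?_
  by_cases h0 : g = 0
  · rw [h0, degree_zero]; exact WithBot.bot_lt_coe k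
  · rw [h.natDegree] at hg
    exact (natDegree_lt_iff_degree_lt h0).1 (by omega)

theorem eval_R_ne_zero (hq0 : 0 < q) (hq1 : q < 1) (ha : 0 < a) (hk : 1 ≤ k) {s : ℕ} (hs : k ≤ s)
    {P R : ℝ[X]} (h : IsOPPair (partialFunctional q a s) k P R) : R.eval (node q s) ≠ 0 := by
  have hR : R ≠ 0 := by
    rintro rfl
    have := h.dual (k - 1) (by omega)
    simp [Nat.sub_add_cancel hk] at this
  have hRd : R.natDegree < k := (natDegree_lt_iff_degree_lt hR).2 h.degree_lt
  refine eval_node_ne_zero_of_orth hq0 hq1 ha hs hR hRd.le fun g hg => ?_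
  rw [h.map_R_mul, coeff_eq_zero_of_natDegree_lt (by omega)]
  by_cases h0 : g = 0
  · rw [h0, degree_zero]; exact WithBot.bot_lt_coe k
  · exact (natDegree_lt_iff_degree_lt h0).1 (by omega)

/-- The factor `X - 1` removes node `0`; at node `x + 1` the argument `q π_{x+1}` is `π_x`, and the
Pearson equation converts the weight. -/
theorem partialFunctional_dilation (hq0 : 0 < q) (hq1 : q < 1) (s : ℕ) (f : ℝ[X]) :
    partialFunctional q a (s + 1) ((X - 1) * f.comp (C q * X)) =
      a / q * partialFunctional q a s f := by
  rw [partialFunctional_apply, partialFunctional_apply, Finset.sum_range_succ', Finset.mul_sum]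
  simp only [eval_mul, eval_sub, eval_X, eval_one, eval_comp, eval_C, node_zero, sub_self,
    zero_mul, add_zero]
  refine Finset.sum_congr rfl fun x _ => ?_
  rw [mul_comm q, node_succ_mul hq0]
  linear_combination f.eval (node q x) * node_sub_one_mul_weight hq0 hq1 a x

variable (hq0 : 0 < q) (hq1 : q < 1) (ha : 0 < a) (hk : 1 ≤ k)
  (h : ∀ s, k ≤ s → IsOPPair (partialFunctional q a s) k (P s) (R s))

include hq0 hq1 ha h

theorem pair_succ {s : ℕ} (hs : k ≤ s) :
    P (s + 1) = P s - C (residueScale q a k s * (P s).eval (node q s)) *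
        evalKer (partialFunctional q a s) k (node q s) ∧
      R (s + 1) = R s - C (residueScale q a k s * (R s).eval (node q s)) *
        evalKer (partialFunctional q a s) k (node q s) :=
  (h (s + 1) (by omega)).unique (posOn_partialFunctional hq0 hq1 ha (by omega))
    ((h s hs).pointMass (posOn_partialFunctional hq0 hq1 ha hs) (weight_pos hq0 hq1 ha s)
      (partialFunctional_succ q a s))

theorem functional_P_succ {s : ℕ} (hs : k ≤ s) :
    partialFunctional q a (s + 1) (P (s + 1) * X ^ k) =
      partialFunctional q a s (P s * X ^ k) + entryQ q a k P s := by
  have hL := posOn_partialFunctional hq0 hq1 ha hs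
  have h1 := h s hs
  have h2 := h (s + 1) (by omega)
  -- `X^k` may be replaced by any monic polynomial of degree `k`. Choosing `P s` for both
  -- functionals makes the two sides comparable.
  have key : ∀ (L : ℝ[X] →ₗ[ℝ] ℝ) (A B : ℝ[X]), IsOPPair L k A B →
      ∀ A' B', ∀ L', IsOPPair L' k A' B' → L (A * X ^ k) = L (A * A') := by
    intro L A B hA A' B' L' hA'
    rw [← sub_eq_zero, ← map_sub, ← mul_sub]
    exact hA.map_P_mul hA'.degree_X_pow_sub
  rw [key _ _ _ h2 _ _ _ h1, key _ _ _ h1 _ _ _ h1, partialFunctional_succ,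
    (pair_succ hq0 hq1 ha h hs).1]
  have e1 : (P s - C (residueScale q a k s * (P s).eval (node q s)) *
      evalKer (partialFunctional q a s) k (node q s)) * P s = P s * P s -
      C (residueScale q a k s * (P s).eval (node q s)) *
        (P s * evalKer (partialFunctional q a s) k (node q s)) := by ring
  rw [e1, map_sub, C_mul', map_smul, h1.map_P_mul (degree_evalKer_lt _ _ _)]
  have hne := (one_add_weight_mul_diagKer_pos hq0 hq1 ha hs).ne'
  simp only [eval_sub, eval_mul, eval_smul, smul_eq_mul, entryQ, residueScale] at hne ⊢
  rw [← diagKer]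
  field_simp
  ring

theorem coeff_P_succ {s : ℕ} (hs : k ≤ s) :
    (P (s + 1)).coeff (k - 1) = (P s).coeff (k - 1) + entryP q a k P R s := by
  rw [(pair_succ hq0 hq1 ha h hs).1, coeff_sub, coeff_C_mul,
    (h s hs).coeff_evalKer (posOn_partialFunctional hq0 hq1 ha hs), entryP]
  ring

theorem coeff_R_succ {s : ℕ} (hs : k ≤ s) :
    (R (s + 1)).coeff (k - 1) = (R s).coeff (k - 1) + entryR q a k R s := by
  rw [(pair_succ hq0 hq1 ha h hs).2, coeff_sub, coeff_C_mul,
    (h s hs).coeff_evalKer (posOn_partialFunctional hq0 hq1 ha hs), entryR]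
  ring

include hk

/-- The point-mass update multiplied by `X - π_s`; Christoffel–Darboux then eliminates the kernel.
-/
theorem lax_shift_poly {s : ℕ} (hs : k ≤ s) :
    (X - C (node q s)) * P (s + 1) = (X - C (node q s) + C (entryP q a k P R s)) * P s +
        C (entryQ q a k P s) * R s ∧
      (X - C (node q s)) * R (s + 1) = C (entryR q a k R s) * P s +
        (X - C (node q s) - C (entryP q a k P R s)) * R s := by
  have hcd := (h s hs).christoffelDarboux hk (posOn_partialFunctional hq0 hq1 ha hs) (node q s)
  obtain ⟨h1, h2⟩ := pair_succ hq0 hq1 ha h hs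
  constructor
  · rw [h1]
    simp only [entryP, entryQ, C_neg, C_mul, C_pow]
    linear_combination -(C (residueScale q a k s) * C ((P s).eval (node q s))) * hcd
  · rw [h2]
    simp only [entryP, entryR, C_neg, C_mul, C_pow]
    linear_combination -(C (residueScale q a k s) * C ((R s).eval (node q s))) * hcd

theorem lax_dilation_poly {s : ℕ} (hs : k ≤ s) :
    (X - 1) * (P s).comp (C q * X) =
        (C (q ^ k) * X + C (entryAlpha q k P s)) * P (s + 1) +
          C (entryBeta q a k P s) * R (s + 1) ∧
      (X - 1) * (R s).comp (C q * X) =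
        C (entryGamma q k R s) * P (s + 1) + C (a / q ^ k) * R (s + 1) := by
  have hL := posOn_partialFunctional hq0 hq1 ha (show k ≤ s + 1 by omega)
  exact ⟨(h s hs).dilation_P hk hq0.ne' hL (h (s + 1) (by omega))
      (partialFunctional_dilation hq0 hq1 s),
    (h s hs).dilation_R hk hq0.ne' hL (h (s + 1) (by omega))
      (partialFunctional_dilation hq0 hq1 s)⟩

/-- At `ζ = 1` the dilation relation says that the coefficient matrix annihilates `(P_{s+1}(1),
R_{s+1}(1))`. This vector is nonzero, so the determinant vanishes there; being linear in `ζ` with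
slope `a`, it is `a(ζ - 1)`. -/
theorem lax_det {s : ℕ} (hs : k ≤ s) :
    a / q ^ k * entryAlpha q k P s - entryBeta q a k P s * entryGamma q k R s = -a := by
  obtain ⟨h1, h2⟩ := lax_dilation_poly hq0 hq1 ha hk h hs
  have e1 := congrArg (Polynomial.eval 1) h1
  have e2 := congrArg (Polynomial.eval 1) h2
  simp only [eval_mul, eval_add, eval_sub, eval_X, eval_one, eval_C, sub_self, zero_mul,
    mul_one] at e1 e2
  have hne := (h (s + 1) (by omega)).eval_ne_zero hk
    (posOn_partialFunctional hq0 hq1 ha (show k ≤ s + 1 by omega)) 1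
  set x := (P (s + 1)).eval 1
  set y := (R (s + 1)).eval 1
  have hqk : q ^ k ≠ 0 := (pow_pos hq0 k).ne'
  have hx : (a / q ^ k * (q ^ k + entryAlpha q k P s) -
      entryBeta q a k P s * entryGamma q k R s) * x = 0 := by
    linear_combination -(a / q ^ k) * e1 + entryBeta q a k P s * e2
  have hy : (a / q ^ k * (q ^ k + entryAlpha q k P s) -
      entryBeta q a k P s * entryGamma q k R s) * y = 0 := by
    linear_combination -(q ^ k + entryAlpha q k P s) * e2 + entryGamma q k R s * e1
  have h0 : a / q ^ k * (q ^ k + entryAlpha q k P s) -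
      entryBeta q a k P s * entryGamma q k R s = 0 := by
    rcases mul_eq_zero.1 hx with h0 | h0
    · exact h0
    · exact (mul_eq_zero.1 hy).resolve_right (hne h0)
  have e : a / q ^ k * q ^ k = a := div_mul_cancel₀ _ hqk
  linear_combination h0 - e

/-- Cramer's rule for the dilation relation at `π_{s+1}`, where its left side involves the values at
`π_s`. The determinant cancels the factor `π_{s+1} - 1`. -/
theorem eval_succ {s : ℕ} (hs : k ≤ s) :
    a * (P (s + 1)).eval (node q (s + 1)) =
        a / q ^ k * (P s).eval (node q s) - entryBeta q a k P s * (R s).eval (node q s) ∧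
      a * (R (s + 1)).eval (node q (s + 1)) =
        (q ^ k * node q (s + 1) + entryAlpha q k P s) * (R s).eval (node q s) -
          entryGamma q k R s * (P s).eval (node q s) := by
  obtain ⟨h1, h2⟩ := lax_dilation_poly hq0 hq1 ha hk h hs
  have e1 := congrArg (Polynomial.eval (node q (s + 1))) h1
  have e2 := congrArg (Polynomial.eval (node q (s + 1))) h2
  have hn : q * node q (s + 1) = node q s := by rw [mul_comm, node_succ_mul hq0]
  simp only [eval_mul, eval_add, eval_sub, eval_X, eval_one, eval_C, eval_comp, hn] at e1 e2
  have hdet := lax_det hq0 hq1 ha hk h hs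
  have hne : node q (s + 1) - 1 ≠ 0 := by
    have := node_strictMono hq0 hq1 (Nat.succ_pos s)
    rw [node_zero] at this
    exact (sub_pos.2 this).ne'
  have e : a / q ^ k * q ^ k = a := div_mul_cancel₀ _ (pow_pos hq0 k).ne'
  constructor
  · refine mul_left_cancel₀ hne ?_
    linear_combination -(a / q ^ k) * e1 + entryBeta q a k P s * e2 -
      (P (s + 1)).eval (node q (s + 1)) * (hdet + node q (s + 1) * e)
  · refine mul_left_cancel₀ hne ?_
    linear_combination -(q ^ k * node q (s + 1) + entryAlpha q k P s) * e2 +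
      entryGamma q k R s * e1 -
      (R (s + 1)).eval (node q (s + 1)) * (hdet + node q (s + 1) * e)

/-- By the confluent Christoffel–Darboux formula `κ_s` is a Wronskian of `P_s` and `R_s`. Under the
dilation relation a Wronskian is multiplied by the determinant `a(ζ - 1)`, with one extra term from
differentiating `q^k ζ`. -/
theorem diagKer_succ {s : ℕ} (hs : k ≤ s) :
    a * diagKer q a k (s + 1) = q * (node q (s + 1) - 1) * diagKer q a k s -
      q ^ k * (P (s + 1)).eval (node q (s + 1)) * (R s).eval (node q s) := by
  have hκ := (h s hs).evalKer_self hk (posOn_partialFunctional hq0 hq1 ha hs) (node q s)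
  have hκ' := (h (s + 1) (by omega)).evalKer_self hk
    (posOn_partialFunctional hq0 hq1 ha (by omega)) (node q (s + 1))
  rw [← diagKer] at hκ hκ'
  obtain ⟨h1, h2⟩ := lax_dilation_poly hq0 hq1 ha hk h hs
  have e1 := congrArg (Polynomial.eval (node q (s + 1))) h1
  have e2 := congrArg (Polynomial.eval (node q (s + 1))) h2
  have d1 := congrArg (fun f => Polynomial.eval (node q (s + 1)) (derivative f)) h1
  have d2 := congrArg (fun f => Polynomial.eval (node q (s + 1)) (derivative f)) h2
  have hn : q * node q (s + 1) = node q s := by rw [mul_comm, node_succ_mul hq0]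
  simp only [eval_mul, eval_add, eval_sub, eval_X, eval_one, eval_C, eval_comp, hn, derivative_mul,
    derivative_add, derivative_sub, derivative_X, derivative_one, derivative_C, derivative_comp,
    zero_mul, zero_add, mul_one, one_mul, sub_zero, add_zero] at e1 e2 d1 d2
  have hdet := lax_det hq0 hq1 ha hk h hs
  have e : a / q ^ k * q ^ k = a := div_mul_cancel₀ _ (pow_pos hq0 k).ne'
  have hne : node q (s + 1) - 1 ≠ 0 := by
    have := node_strictMono hq0 hq1 (Nat.succ_pos s)
    rw [node_zero] at this
    exact (sub_pos.2 this).ne'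
  rw [hκ, hκ']
  refine mul_left_cancel₀ hne ?_
  set x := (P s).eval (node q s)
  set y := (R s).eval (node q s)
  set dx := (derivative (P s)).eval (node q s)
  set dy := (derivative (R s)).eval (node q s)
  set x' := (P (s + 1)).eval (node q (s + 1))
  set y' := (R (s + 1)).eval (node q (s + 1))
  set dx' := (derivative (P (s + 1))).eval (node q (s + 1))
  set dy' := (derivative (R (s + 1))).eval (node q (s + 1))
  set t := node q (s + 1)
  set α := entryAlpha q k P s
  set β := entryBeta q a k P s
  set γ := entryGamma q k R s
  linear_combination (-(t - 1) * y) * d1 + ((t - 1) * x) * d2 +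
    (-q ^ k * x' - (q ^ k * t + α) * dx' - β * dy') * e2 + (γ * dx' + a / q ^ k * dy') * e1 +
    (x' * dy' - y' * dx') * (hdet + t * e) + q ^ k * x' * e2

end Relations

/-! ### The recurrence relations -/

section Recurrence

variable {q a : ℝ} {k : ℕ} {P R : ℕ → ℝ[X]}
  (hq0 : 0 < q) (hq1 : q < 1) (ha : 0 < a)
  (h : ∀ s, k ≤ s → IsOPPair (partialFunctional q a s) k (P s) (R s))

include hq0 hq1 ha h

theorem entryBeta_succ {s : ℕ} (hs : k ≤ s) :
    entryBeta q a k P (s + 1) = entryBeta q a k P s - q ^ k * entryQ q a k P (s + 1) := by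
  have := functional_P_succ hq0 hq1 ha h (show k ≤ s + 1 by omega)
  simp only [entryBeta]
  rw [this]; ring

theorem entryQ_pos {s : ℕ} (hs : k ≤ s) : 0 < entryQ q a k P s :=
  mul_pos (residueScale_pos hq0 hq1 ha hs)
    (by have := eval_P_ne_zero hq0 hq1 ha hs (h s hs); positivity)

theorem entryAlpha_succ {s : ℕ} (hs : k ≤ s) :
    entryAlpha q k P (s + 1) = entryAlpha q k P s + q ^ (k - 1) * entryP q a k P R s -
      q ^ k * entryP q a k P R (s + 1) := by
  have h1 := coeff_P_succ hq0 hq1 ha h hs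
  have h2 := coeff_P_succ hq0 hq1 ha h (show k ≤ s + 1 by omega)
  simp only [entryAlpha]
  rw [h2, h1]; ring

theorem entryGamma_succ {s : ℕ} (hs : k ≤ s) :
    entryGamma q k R (s + 1) = entryGamma q k R s + q ^ (k - 1) * entryR q a k R s := by
  have h1 := coeff_R_succ hq0 hq1 ha h hs
  simp only [entryGamma]
  rw [h1]; ring

variable (hk : 1 ≤ k)

include hk

theorem entryP_ne_zero {s : ℕ} (hs : k ≤ s) : entryP q a k P R s ≠ 0 :=
  neg_ne_zero.2 (mul_ne_zero (mul_ne_zero (residueScale_pos hq0 hq1 ha hs).ne'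
    (eval_P_ne_zero hq0 hq1 ha hs (h s hs))) (eval_R_ne_zero hq0 hq1 ha hk hs (h s hs)))

theorem entryR_ne_zero {s : ℕ} (hs : k ≤ s) : entryR q a k R s ≠ 0 :=
  neg_ne_zero.2 (mul_ne_zero (residueScale_pos hq0 hq1 ha hs).ne'
    (pow_ne_zero 2 (eval_R_ne_zero hq0 hq1 ha hk hs (h s hs))))

/-! ### Closed forms for the combinations in the recurrences, and the recurrences themselves. -/

theorem entry_combination_P {s : ℕ} (hs : k ≤ s) :
    entryP q a k P R s * entryBeta q a k P s + a * q ^ (-(k : ℤ)) * entryQ q a k P s =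
      a * residueScale q a k s * (P s).eval (node q s) *
        (P (s + 1)).eval (node q (s + 1)) := by
  have h1 := (eval_succ hq0 hq1 ha hk h hs).1
  rw [zpow_neg, zpow_natCast, ← div_eq_mul_inv, entryP, entryQ]
  linear_combination (-residueScale q a k s * (P s).eval (node q s)) * h1

theorem entry_combination_R {s : ℕ} (hs : k ≤ s) :
    entryR q a k R s * entryAlpha q k P s - entryP q a k P R s * entryGamma q k R s +
        q ^ ((k : ℤ) - s - 1) * entryR q a k R s =
      -(a * residueScale q a k s * (R s).eval (node q s) *
        (R (s + 1)).eval (node q (s + 1))) := by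
  have h1 := (eval_succ hq0 hq1 ha hk h hs).2
  have e : q ^ ((k : ℤ) - s - 1) = q ^ k * node q (s + 1) := by
    rw [node, ← zpow_natCast, ← zpow_add₀ hq0.ne']
    congr 1; push_cast; ring
  rw [e, entryR, entryP]
  linear_combination (residueScale q a k s * (R s).eval (node q s)) * h1

theorem entryEps_eq {s : ℕ} (hs : k ≤ s) :
    entryEps q a k P R s = a * (node q (s + 1) - 1) - a * q ^ (k - 1) * residueScale q a k s *
      (R s).eval (node q s) * (P (s + 1)).eval (node q (s + 1)) := by
  have h1 := (eval_succ hq0 hq1 ha hk h hs).1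
  have e1 : q ^ ((k : ℤ) - 1) = q ^ (k - 1) := by
    rw [← zpow_natCast, Nat.cast_sub hk]; simp
  have e2 : q ^ (-(s : ℤ) - 1) = node q (s + 1) := by
    rw [node]; congr 1; push_cast; ring
  rw [entryEps, e1, e2, zpow_neg, zpow_natCast, ← div_eq_mul_inv, entryP, entryR]
  linear_combination (q ^ (k - 1) * residueScale q a k s * (R s).eval (node q s)) * h1

/-- This explains `ε_s`: up to the factor `a² / q` it is the ratio of consecutive residue scales. It
follows from the recursion for `κ_s` and the Pearson equation, and shows that `ε_s` cannot vanish.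
-/
theorem residueScale_succ {s : ℕ} (hs : k ≤ s) :
    q * entryEps q a k P R s * residueScale q a k (s + 1) = a ^ 2 * residueScale q a k s := by
  rw [entryEps_eq hq0 hq1 ha h hk hs]
  have hκ := diagKer_succ hq0 hq1 ha hk h hs
  have hw := node_sub_one_mul_weight hq0 hq1 a s
  have h0 := (one_add_weight_mul_diagKer_pos hq0 hq1 ha hs).ne'
  have h1 := (one_add_weight_mul_diagKer_pos hq0 hq1 ha (show k ≤ s + 1 by omega)).ne'
  have eqk : q ^ k = q * q ^ (k - 1) := by rw [← pow_succ', Nat.sub_add_cancel hk]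
  rw [eqk] at hκ
  have hw' : q * ((node q (s + 1) - 1) * weight q a (s + 1)) = a * weight q a s := by
    rw [hw]
    have := hq0.ne'
    field_simp
  unfold residueScale
  field_simp
  linear_combination hw' - weight q a s * weight q a (s + 1) * hκ

theorem entryEps_ne_zero {s : ℕ} (hs : k ≤ s) : entryEps q a k P R s ≠ 0 := by
  intro h0
  have h1 := residueScale_succ hq0 hq1 ha h hk hs
  rw [h0] at h1
  have := residueScale_pos hq0 hq1 ha hs
  have h2 : 0 < a ^ 2 * residueScale q a k s := by positivity
  rw [← h1] at h2
  simp at h2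

/-- Each new entry is a residue scale times a product of values at `π_{s+1}`. `eval_succ` supplies
the values and `residueScale_succ` the scale. -/
theorem recurrence_entries {s : ℕ} (hs : k ≤ s) :
    entryP q a k P R (s + 1) = -q⁻¹ * (entryP q a k P R s)⁻¹ * (entryEps q a k P R s)⁻¹ *
        (entryP q a k P R s * entryBeta q a k P s + a * q ^ (-(k : ℤ)) * entryQ q a k P s) *
        (entryR q a k R s * entryAlpha q k P s - entryP q a k P R s * entryGamma q k R s +
          q ^ ((k : ℤ) - s - 1) * entryR q a k R s) ∧
      entryQ q a k P (s + 1) = q⁻¹ * (entryQ q a k P s)⁻¹ * (entryEps q a k P R s)⁻¹ *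
        (entryP q a k P R s * entryBeta q a k P s + a * q ^ (-(k : ℤ)) * entryQ q a k P s) ^ 2 ∧
      entryR q a k R (s + 1) = q⁻¹ * (entryR q a k R s)⁻¹ * (entryEps q a k P R s)⁻¹ *
        (entryR q a k R s * entryAlpha q k P s - entryP q a k P R s * entryGamma q k R s +
          q ^ ((k : ℤ) - s - 1) * entryR q a k R s) ^ 2 := by
  rw [entry_combination_P hq0 hq1 ha h hk hs, entry_combination_R hq0 hq1 ha h hk hs]
  have hμ := residueScale_succ hq0 hq1 ha h hk hs
  have h0 := (residueScale_pos hq0 hq1 ha hs).ne'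
  have h1 := eval_P_ne_zero hq0 hq1 ha hs (h s hs)
  have h2 := eval_R_ne_zero hq0 hq1 ha hk hs (h s hs)
  have h3 := entryEps_ne_zero hq0 hq1 ha h hk hs
  have h4 := hq0.ne'
  refine ⟨?_, ?_, ?_⟩
  · unfold entryP
    field_simp
    linear_combination (-(P (s + 1)).eval (node q (s + 1)) *
      (R (s + 1)).eval (node q (s + 1))) * hμ
  · unfold entryQ
    field_simp
    linear_combination (P (s + 1)).eval (node q (s + 1)) ^ 2 * hμ
  · unfold entryR
    field_simp
    linear_combination (-(R (s + 1)).eval (node q (s + 1)) ^ 2) * hμ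

theorem recurrence_h {s : ℕ} (hs : k ≤ s) :
    (P (s + 1)).eval (node q (s + 1)) =
      (entryP q a k P R s * entryBeta q a k P s + a * q ^ (-(k : ℤ)) * entryQ q a k P s) /
        (a * entryQ q a k P s) * (P s).eval (node q s) := by
  rw [entry_combination_P hq0 hq1 ha h hk hs]
  have h0 := (residueScale_pos hq0 hq1 ha hs).ne'
  have h1 := eval_P_ne_zero hq0 hq1 ha hs (h s hs)
  unfold entryQ
  field_simp

/-- The left side is `ω(s+1) κ_{s+1} - ω(s) κ_s`. By the Pearson equation the first term of the
recursion for `κ_{s+1}` cancels `ω(s) κ_s`, leaving only the product of values. -/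
theorem recurrence_D {s : ℕ} (hs : k ≤ s) :
    D q a k (s + 2) / D q a k (s + 1) - D q a k (s + 1) / D q a k s =
      a ^ ((s : ℤ) - 1) / qPoch q q (s + 1) * q ^ ((s + 1).choose 2) *
        entryU q a k P R s * (P s).eval (node q s) ^ 2 := by
  rw [D_succ_div hq0 hq1 ha hk hs, D_succ_div hq0 hq1 ha hk (show k ≤ s + 1 by omega)]
  have hκ := diagKer_succ hq0 hq1 ha hk h hs
  have hw := node_sub_one_mul_weight hq0 hq1 a s
  have h0 := (residueScale_pos hq0 hq1 ha hs).ne'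
  have h1 := eval_P_ne_zero hq0 hq1 ha hs (h s hs)
  have e1 : a ^ ((s : ℤ) - 1) / qPoch q q (s + 1) * q ^ ((s + 1).choose 2) =
      weight q a (s + 1) / a ^ 2 := by
    have : a ^ ((s : ℤ) - 1) = a ^ (s + 1) / a ^ 2 := by
      rw [← zpow_natCast, ← zpow_natCast, ← zpow_sub₀ ha.ne']; congr 1; push_cast; ring
    rw [this, weight]; ring
  have e2 : entryU q a k P R s * (P s).eval (node q s) ^ 2 =
      -(a * q ^ k * (R s).eval (node q s) * (P (s + 1)).eval (node q (s + 1))) := by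
    unfold entryU
    rw [entry_combination_P hq0 hq1 ha h hk hs]
    unfold entryP entryQ
    field_simp
  have hw' : q * ((node q (s + 1) - 1) * weight q a (s + 1)) = a * weight q a s := by
    rw [hw]
    have := hq0.ne'
    field_simp
  rw [e1, mul_assoc, e2]
  have ha' := ha.ne'
  field_simp
  linear_combination weight q a (s + 1) * hκ + diagKer q a k s * hw'

end Recurrence

/-! ### The solution of the discrete Riemann–Hilbert problem -/

/-- The discrete Cauchy transform over the first `s` nodes. -/
def cauchy (q a : ℝ) (s : ℕ) (f : ℝ[X]) (ζ : ℂ) : ℂ :=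
  ∑ x ∈ Finset.range s, ((f.eval (node q x) * weight q a x : ℝ) : ℂ) / (ζ - (node q x : ℂ))

/-- The matrix built from a pair of polynomials and their Cauchy transforms. -/
def rhMatrix (q a : ℝ) (s : ℕ) (P R : ℝ[X]) (ζ : ℂ) : Matrix (Fin 2) (Fin 2) ℂ :=
  !![aeval ζ P, cauchy q a s P ζ; aeval ζ R, cauchy q a s R ζ]

section Cauchy

variable {q a : ℝ}

theorem cauchy_add (q a : ℝ) (s : ℕ) (f g : ℝ[X]) (ζ : ℂ) :
    cauchy q a s (f + g) ζ = cauchy q a s f ζ + cauchy q a s g ζ := by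
  simp only [cauchy, ← Finset.sum_add_distrib]
  exact Finset.sum_congr rfl fun x _ => by simp; ring

theorem cauchy_C_mul (q a : ℝ) (s : ℕ) (c : ℝ) (f : ℝ[X]) (ζ : ℂ) :
    cauchy q a s (C c * f) ζ = c * cauchy q a s f ζ := by
  simp only [cauchy, Finset.mul_sum]
  exact Finset.sum_congr rfl fun x _ => by simp; ring

theorem cauchy_X_mul {s : ℕ} (f : ℝ[X]) {ζ : ℂ} (hζ : ∀ x < s, ζ ≠ (node q x : ℂ)) :
    cauchy q a s (X * f) ζ =
      ζ * cauchy q a s f ζ - ((partialFunctional q a s f : ℝ) : ℂ) := by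
  rw [partialFunctional_apply]
  simp only [cauchy, Finset.mul_sum, Complex.ofReal_sum, ← Finset.sum_sub_distrib]
  refine Finset.sum_congr rfl fun x hx => ?_
  have := sub_ne_zero.2 (hζ x (Finset.mem_range.1 hx))
  simp
  field_simp
  ring

theorem cauchy_X_sub_C_mul {s : ℕ} (f : ℝ[X]) (c : ℝ) {ζ : ℂ}
    (hζ : ∀ x < s, ζ ≠ (node q x : ℂ)) :
    cauchy q a s ((X - C c) * f) ζ =
      (ζ - c) * cauchy q a s f ζ - ((partialFunctional q a s f : ℝ) : ℂ) := by
  rw [sub_mul, sub_eq_add_neg, ← neg_mul, ← C_neg, cauchy_add, cauchy_X_mul f hζ, cauchy_C_mul]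
  push_cast; ring

/-- The factor `X - π_s` vanishes at the added node, so the extra term is zero. -/
theorem cauchy_succ (q a : ℝ) (s : ℕ) (f : ℝ[X]) (ζ : ℂ) :
    cauchy q a (s + 1) ((X - C (node q s)) * f) ζ = cauchy q a s ((X - C (node q s)) * f) ζ := by
  simp [cauchy, Finset.sum_range_succ]

theorem cauchy_dilation (hq0 : 0 < q) (hq1 : q < 1) (s : ℕ) (f : ℝ[X]) {ζ : ℂ}
    (hζ : ∀ x ≤ s, ζ ≠ (node q x : ℂ)) :
    cauchy q a (s + 1) ((X - 1) * f.comp (C q * X)) ζ = a * cauchy q a s f (q * ζ) := by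
  simp only [cauchy]
  rw [Finset.sum_range_succ', Finset.mul_sum]
  simp only [eval_mul, eval_sub, eval_X, eval_one, eval_comp, eval_C, node_zero, sub_self,
    zero_mul, add_zero, Complex.ofReal_zero, zero_div]
  refine Finset.sum_congr rfl fun x hx => ?_
  have hn := node_succ_mul hq0 x
  have h1 := sub_ne_zero.2 (hζ (x + 1) (Finset.mem_range.1 hx))
  have hq : (q : ℂ) ≠ 0 := by exact_mod_cast hq0.ne'
  have e : (q : ℂ) * ζ - (node q x : ℂ) = q * (ζ - (node q (x + 1) : ℂ)) := by
    rw [← hn]; push_cast; ring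
  have hw : (((node q (x + 1) - 1) * weight q a (x + 1) : ℝ) : ℂ) = a / q * weight q a x := by
    rw [node_sub_one_mul_weight hq0 hq1]; push_cast; ring
  rw [e, mul_comm q, hn]
  push_cast at hw ⊢
  rw [div_eq_iff h1]
  have e2 : (a : ℂ) * (((f.eval (node q x) : ℝ) : ℂ) * weight q a x / (q * (ζ - (node q (x + 1) : ℂ)))) *
      (ζ - (node q (x + 1) : ℂ)) = ((f.eval (node q x) : ℝ) : ℂ) * (a / q * weight q a x) := by
    field_simp
  rw [e2, ← hw]
  ring

/-- Moving one `ζ` inside the transform costs a moment, and the first `n` moments vanish. This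
yields the decay at infinity. -/
theorem pow_mul_cauchy {s n : ℕ} {f : ℝ[X]} (hf : ∀ i < n, partialFunctional q a s (f * X ^ i) = 0)
    {ζ : ℂ} (hζ : ∀ x < s, ζ ≠ (node q x : ℂ)) :
    ζ ^ n * cauchy q a s f ζ = cauchy q a s (f * X ^ n) ζ := by
  induction n with
  | zero => simp
  | succ n ih =>
    have e : f * X ^ (n + 1) = X * (f * X ^ n) := by ring
    rw [e, cauchy_X_mul _ hζ, hf n (by omega), ← ih fun i hi => hf i (by omega), pow_succ]
    simp; ring

theorem tendsto_cauchy (q a : ℝ) (s : ℕ) (f : ℝ[X]) :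
    Tendsto (cauchy q a s f) (cocompact ℂ) (𝓝 0) := by
  rw [← Metric.cobounded_eq_cocompact]
  have : (0 : ℂ) = ∑ x ∈ Finset.range s, ((f.eval (node q x) * weight q a x : ℝ) : ℂ) * 0 := by simp
  rw [this]
  refine tendsto_finsetSum _ fun x _ => ?_
  simp only [div_eq_mul_inv]
  refine Tendsto.const_mul _ (tendsto_inv₀_cobounded.comp ?_)
  simp [sub_eq_add_neg]

theorem eventually_ne_nodes (q : ℝ) (s : ℕ) :
    ∀ᶠ ζ in cocompact ℂ, ∀ x < s, ζ ≠ (node q x : ℂ) := by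
  have : ∀ᶠ ζ in cocompact ℂ, ∀ x ∈ Finset.range s, ζ ≠ (node q x : ℂ) := by
    rw [eventually_all_finset]
    intro x _
    exact (isCompact_singleton (x := (node q x : ℂ))).compl_mem_cocompact
  simpa using this

theorem tendsto_pow_mul_cauchy {s n : ℕ} {f : ℝ[X]}
    (hf : ∀ i < n, partialFunctional q a s (f * X ^ i) = 0) :
    Tendsto (fun ζ => cauchy q a s f ζ * ζ ^ (n + 1)) (cocompact ℂ)
      (𝓝 ((partialFunctional q a s (f * X ^ n) : ℝ) : ℂ)) := by
  have h1 := (tendsto_cauchy q a s (X * (f * X ^ n))).add_const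
    ((partialFunctional q a s (f * X ^ n) : ℝ) : ℂ)
  rw [zero_add] at h1
  refine h1.congr' ?_
  filter_upwards [eventually_ne_nodes q s] with ζ hζ
  rw [cauchy_X_mul _ hζ, ← pow_mul_cauchy hf hζ]
  ring

theorem tendsto_aeval_mul_inv_pow {f : ℝ[X]} {k : ℕ} (hf : f.natDegree ≤ k) :
    Tendsto (fun ζ : ℂ => aeval ζ f * (ζ ^ k)⁻¹) (cocompact ℂ) (𝓝 (f.coeff k : ℂ)) := by
  have h1 : Tendsto (fun ζ : ℂ => ∑ i ∈ Finset.range (k + 1), (f.coeff i : ℂ) * (ζ⁻¹) ^ (k - i))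
      (cocompact ℂ) (𝓝 (∑ i ∈ Finset.range (k + 1), (f.coeff i : ℂ) * 0 ^ (k - i))) := by
    refine tendsto_finsetSum _ fun i _ => Tendsto.const_mul _ (Tendsto.pow ?_ _)
    rw [← Metric.cobounded_eq_cocompact]
    exact tendsto_inv₀_cobounded
  have e : ∑ i ∈ Finset.range (k + 1), (f.coeff i : ℂ) * 0 ^ (k - i) = (f.coeff k : ℂ) := by
    rw [Finset.sum_range_succ, Finset.sum_eq_zero]
    · simp
    · intro i hi
      have := Finset.mem_range.1 hi
      rw [zero_pow (by omega), mul_zero]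
  rw [e] at h1
  refine h1.congr' ?_
  have h0 : ∀ᶠ ζ in cocompact ℂ, ζ ≠ (0 : ℂ) :=
    (isCompact_singleton (x := (0 : ℂ))).compl_mem_cocompact
  filter_upwards [h0] with ζ hζ
  rw [aeval_eq_sum_range' (Nat.lt_succ_of_le hf), Finset.sum_mul]
  refine Finset.sum_congr rfl fun i hi => ?_
  have hi' : i ≤ k := Nat.lt_succ_iff.1 (Finset.mem_range.1 hi)
  obtain ⟨d, rfl⟩ := Nat.exists_eq_add_of_le hi'
  rw [Complex.real_smul, Nat.add_sub_cancel_left, pow_add, inv_pow]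
  field_simp

theorem tendsto_sub_mul_cauchy (hq0 : 0 < q) (hq1 : q < 1) {s x : ℕ} (hx : x < s) (f : ℝ[X]) :
    Tendsto (fun ζ => (ζ - (node q x : ℂ)) * cauchy q a s f ζ) (𝓝[≠] (node q x : ℂ))
      (𝓝 ((f.eval (node q x) * weight q a x : ℝ) : ℂ)) := by
  have h1 : Tendsto (fun ζ => ((f.eval (node q x) * weight q a x : ℝ) : ℂ) +
      (ζ - (node q x : ℂ)) * ∑ y ∈ (Finset.range s).erase x,
        ((f.eval (node q y) * weight q a y : ℝ) : ℂ) / (ζ - (node q y : ℂ))) (𝓝 (node q x : ℂ))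
      (𝓝 (((f.eval (node q x) * weight q a x : ℝ) : ℂ) + ((node q x : ℂ) - (node q x : ℂ)) *
        ∑ y ∈ (Finset.range s).erase x, ((f.eval (node q y) * weight q a y : ℝ) : ℂ) /
          ((node q x : ℂ) - (node q y : ℂ)))) := by
    refine Tendsto.const_add _ (Tendsto.mul (tendsto_id.sub_const _) ?_)
    refine tendsto_finsetSum _ fun y hy => ?_
    refine Tendsto.div tendsto_const_nhds (tendsto_id.sub_const _) (sub_ne_zero.2 ?_)
    intro he
    exact (Finset.mem_erase.1 hy).1
      ((node_strictMono hq0 hq1).injective (by exact_mod_cast he)).symm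
  rw [sub_self, zero_mul, add_zero] at h1
  refine (h1.mono_left nhdsWithin_le_nhds).congr' ?_
  filter_upwards [self_mem_nhdsWithin] with ζ hζ
  have : ζ - (node q x : ℂ) ≠ 0 := sub_ne_zero.2 hζ
  rw [cauchy, ← Finset.add_sum_erase _ _ (Finset.mem_range.2 hx), mul_add]
  congr 1
  field_simp

theorem isDRHPSolution_rhMatrix (hq0 : 0 < q) (hq1 : q < 1) {k s : ℕ} (hk : 1 ≤ k) {P R : ℝ[X]}
    (h : IsOPPair (partialFunctional q a s) k P R) :
    IsDRHPSolution q a k s (rhMatrix q a s P R) := by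
  have hpoly : ∀ f : ℝ[X], Differentiable ℂ fun ζ : ℂ => aeval ζ f := fun f =>
    Polynomial.differentiable_aeval f
  have hcau : ∀ f : ℝ[X],
      DifferentiableOn ℂ (cauchy q a s f) {ζ | ∀ x < s, ζ ≠ (node q x : ℂ)} := by
    intro f ζ hζ
    unfold cauchy
    refine DifferentiableWithinAt.fun_sum fun x hx => ?_
    refine DifferentiableWithinAt.div (differentiableWithinAt_const _)
      (differentiableWithinAt_id.sub_const _) (sub_ne_zero.2 (hζ x (Finset.mem_range.1 hx)))
  constructor
  · intro i j
    fin_cases i <;> fin_cases j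
    · exact (hpoly P).differentiableOn
    · exact hcau P
    · exact (hpoly R).differentiableOn
    · exact hcau R
  · intro x hx
    have h2 : ∀ f : ℝ[X], Tendsto (fun ζ : ℂ => aeval ζ f) (𝓝[≠] (node q x : ℂ))
        (𝓝 ((f.eval (node q x) : ℝ) : ℂ)) := by
      intro f
      rw [show ((f.eval (node q x) : ℝ) : ℂ) = aeval (node q x : ℂ) f from
        (Polynomial.aeval_ofReal f _).symm]
      exact ((hpoly f).continuous.tendsto _).mono_left nhdsWithin_le_nhds
    have h3 : Tendsto (fun ζ => ζ - (node q x : ℂ)) (𝓝[≠] (node q x : ℂ)) (𝓝 0) := by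
      have : Tendsto (fun ζ => ζ - (node q x : ℂ)) (𝓝 (node q x : ℂ))
        (𝓝 ((node q x : ℂ) - (node q x : ℂ))) := tendsto_id.sub_const _
      rw [sub_self] at this
      exact this.mono_left nhdsWithin_le_nhds
    refine ⟨!![0, ((P.eval (node q x) * weight q a x : ℝ) : ℂ);
      0, ((R.eval (node q x) * weight q a x : ℝ) : ℂ)], ?_, ?_⟩
    · refine tendsto_pi_nhds.2 fun i => tendsto_pi_nhds.2 fun j => ?_
      fin_cases i <;> fin_cases j
      · simpa [rhMatrix] using h3.mul (h2 P)
      · simpa [rhMatrix] using tendsto_sub_mul_cauchy hq0 hq1 hx P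
      · simpa [rhMatrix] using h3.mul (h2 R)
      · simpa [rhMatrix] using tendsto_sub_mul_cauchy hq0 hq1 hx R
    · refine tendsto_pi_nhds.2 fun i => tendsto_pi_nhds.2 fun j => ?_
      fin_cases i <;> fin_cases j
      · simp [rhMatrix, Matrix.mul_apply, Fin.sum_univ_two]
      · simpa [rhMatrix, Matrix.mul_apply, Fin.sum_univ_two] using (h2 P).mul_const (weight q a x : ℂ)
      · simp [rhMatrix, Matrix.mul_apply, Fin.sum_univ_two]
      · simpa [rhMatrix, Matrix.mul_apply, Fin.sum_univ_two] using (h2 R).mul_const (weight q a x : ℂ)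
  -- With `n = k - 1` vanishing moments available for both polynomials, the second column times
  -- `ζ^k` tends to the moments of order `k - 1`: `0` for `P` and `1` for `R`.
  · obtain ⟨n, rfl⟩ : ∃ n, k = n + 1 := ⟨k - 1, by omega⟩
    have hR : R.natDegree ≤ n + 1 := natDegree_le_of_degree_le h.degree_lt.le
    have hR0 : R.coeff (n + 1) = 0 := coeff_eq_zero_of_degree_lt h.degree_lt
    have h00 := tendsto_aeval_mul_inv_pow h.natDegree.le
    have h10 := tendsto_aeval_mul_inv_pow hR
    have h01 := tendsto_pow_mul_cauchy (q := q) (a := a) (s := s) (n := n) (f := P)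
      fun i hi => h.orth i (by omega)
    have h11 := tendsto_pow_mul_cauchy (q := q) (a := a) (s := s) (n := n) (f := R)
      fun i hi => by rw [h.dual i (by omega), if_neg (by omega)]
    rw [h.coeff_P] at h00
    rw [hR0] at h10
    rw [h.orth n (by omega)] at h01
    rw [h.dual n (by omega), if_pos rfl] at h11
    refine tendsto_pi_nhds.2 fun i => tendsto_pi_nhds.2 fun j => ?_
    fin_cases i <;> fin_cases j
    · simpa [rhMatrix, Matrix.mul_apply, Fin.sum_univ_two] using h00
    · simpa [rhMatrix, Matrix.mul_apply, Fin.sum_univ_two] using h01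
    · simpa [rhMatrix, Matrix.mul_apply, Fin.sum_univ_two] using h10
    · simpa [rhMatrix, Matrix.mul_apply, Fin.sum_univ_two] using h11

/-- The polynomial identities give the first column on evaluation at `ζ` and the second on taking
Cauchy transforms at `ζ`. Multiplication by `X` leaves moments of order zero behind, and these
vanish or agree on both sides. -/
theorem rhMatrix_lax {k : ℕ} {P R : ℕ → ℝ[X]}
    (hq0 : 0 < q) (hq1 : q < 1) (ha : 0 < a) (hk : 1 ≤ k)
    (h : ∀ s, k ≤ s → IsOPPair (partialFunctional q a s) k (P s) (R s)) {s : ℕ} (hs : k ≤ s)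
    {ζ : ℂ} (hζ : ∀ x ≤ s, ζ ≠ (node q x : ℂ)) :
    rhMatrix q a (s + 1) (P (s + 1)) (R (s + 1)) ζ =
        (1 + (ζ - (node q s : ℂ))⁻¹ •
          !![(entryP q a k P R s : ℂ), (entryQ q a k P s : ℂ);
            (entryR q a k R s : ℂ), -(entryP q a k P R s : ℂ)]) *
          rhMatrix q a s (P s) (R s) ζ ∧
      rhMatrix q a s (P s) (R s) ((q : ℂ) * ζ) =
        !![(q : ℂ) ^ k * ζ + (entryAlpha q k P s : ℂ), (entryBeta q a k P s : ℂ);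
            (entryGamma q k R s : ℂ), (a : ℂ) * ((q : ℂ) ^ k)⁻¹] *
          rhMatrix q a (s + 1) (P (s + 1)) (R (s + 1)) ζ * !![(ζ - 1)⁻¹, 0; 0, (a : ℂ)⁻¹] := by
  have h0 := h s hs
  have h1 := h (s + 1) (by omega)
  have hζ' : ∀ x < s, ζ ≠ (node q x : ℂ) := fun x hx => hζ x hx.le
  have hζ'' : ∀ x < s + 1, ζ ≠ (node q x : ℂ) := fun x hx => hζ x (by omega)
  have hπ : ζ - (node q s : ℂ) ≠ 0 := sub_ne_zero.2 (hζ s le_rfl)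
  have hone : ζ - 1 ≠ 0 := by
    have := hζ 0 (Nat.zero_le _)
    rw [node_zero] at this
    exact sub_ne_zero.2 (by simpa using this)
  have haC : (a : ℂ) ≠ 0 := by exact_mod_cast ha.ne'
  have oP0 : partialFunctional q a s (P s) = 0 := by simpa using h0.orth 0 (by omega)
  have oP1 : partialFunctional q a (s + 1) (P (s + 1)) = 0 := by simpa using h1.orth 0 (by omega)
  -- Both equal `1` if `k = 1` and `0` otherwise, so this moment cancels in the second row even when
  -- it is nonzero.
  have oR : partialFunctional q a (s + 1) (R (s + 1)) = partialFunctional q a s (R s) := by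
    have e0 := h0.dual 0 (by omega)
    have e1 := h1.dual 0 (by omega)
    simp only [pow_zero, mul_one] at e0 e1
    rw [e0, e1]
  obtain ⟨s1, s2⟩ := lax_shift_poly hq0 hq1 ha hk h hs
  obtain ⟨d1, d2⟩ := lax_dilation_poly hq0 hq1 ha hk h hs
  have as1 := congrArg (aeval ζ) s1
  have as2 := congrArg (aeval ζ) s2
  have ad1 := congrArg (aeval ζ) d1
  have ad2 := congrArg (aeval ζ) d2
  simp only [map_mul, map_add, map_sub, aeval_X, aeval_C, aeval_comp, map_one,
    Complex.coe_algebraMap] at as1 as2 ad1 ad2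
  have cs1 := congrArg (fun f => cauchy q a s f ζ) s1
  have cs2 := congrArg (fun f => cauchy q a s f ζ) s2
  have cd1 := congrArg (fun f => cauchy q a (s + 1) f ζ) d1
  have cd2 := congrArg (fun f => cauchy q a (s + 1) f ζ) d2
  have r1 : (X - C (node q s) + C (entryP q a k P R s)) * P s =
      (X - C (node q s)) * P s + C (entryP q a k P R s) * P s := by ring
  have r2 : (X - C (node q s) - C (entryP q a k P R s)) * R s =
      (X - C (node q s)) * R s + C (-entryP q a k P R s) * R s := by rw [C_neg]; ring
  have r3 : (C (q ^ k) * X + C (entryAlpha q k P s)) * P (s + 1) =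
      C (q ^ k) * (X * P (s + 1)) + C (entryAlpha q k P s) * P (s + 1) := by ring
  -- The left side is rewritten over `s + 1` nodes, so that it involves the Cauchy transforms of the
  -- next solution.
  rw [← cauchy_succ] at cs1 cs2
  simp only [r1, r2, r3, cauchy_add, cauchy_C_mul, cauchy_X_sub_C_mul _ _ hζ',
    cauchy_X_sub_C_mul _ _ hζ'', cauchy_X_mul _ hζ'', cauchy_dilation hq0 hq1 s _ hζ, oP0, oP1, oR,
    Complex.ofReal_zero, Complex.ofReal_neg, Complex.ofReal_div, Complex.ofReal_pow]
    at cs1 cs2 cd1 cd2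
  simp only [Complex.ofReal_div, Complex.ofReal_pow] at ad1 ad2
  constructor
  · ext i j
    fin_cases i <;> fin_cases j <;>
    simp [rhMatrix, Matrix.mul_apply, Fin.sum_univ_two] <;> field_simp
    · linear_combination as1
    · linear_combination cs1
    · linear_combination as2
    · linear_combination cs2
  · ext i j
    fin_cases i <;> fin_cases j <;>
    simp [rhMatrix, Matrix.mul_apply, Fin.sum_univ_two] <;>
    rw [← div_eq_mul_inv, eq_div_iff (by assumption)]
    · linear_combination ad1
    · linear_combination cd1
    · linear_combination ad2
    · linear_combination cd2

end Cauchy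

/-! ### Initial conditions -/

theorem pow_sq_eq (q : ℝ) (n : ℕ) : q ^ n ^ 2 = q ^ n * (q ^ n.choose 2) ^ 2 := by
  rw [← pow_mul, ← pow_add, Nat.choose_two_right,
    Nat.div_mul_cancel (Nat.even_mul_pred_self n).two_dvd]
  congr 1
  rcases n with _ | n
  · simp
  · rw [Nat.add_sub_cancel]; ring

/-- Monic polynomials of degrees `0, …, k - 1` are a unitriangular change of basis from the
monomials. -/
theorem det_gram {k : ℕ} (L : ℝ[X] →ₗ[ℝ] ℝ) (p : ℕ → ℝ[X]) (hd : ∀ i, (p i).natDegree = i)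
    (hm : ∀ i, (p i).Monic) :
    (Matrix.of fun i j : Fin k => L (p i * p j)).det = (hankel L k).det := by
  set T : Matrix (Fin k) (Fin k) ℝ := Matrix.of fun i j => (p j).coeff i with hT
  have hT1 : T.det = 1 := Matrix.det_matrixOfPolynomials (fun i : Fin k => p i)
    (fun i => hd i) fun i => hm i
  have e : (Matrix.of fun i j : Fin k => L (p i * p j)) = T.transpose * hankel L k * T := by
    ext i j
    have hdeg : ∀ l : Fin k, (p l).degree < k := fun l => by
      rw [degree_eq_natDegree (hm l).ne_zero, hd]; exact_mod_cast l.2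
    rw [Matrix.of_apply, eq_vecPoly (hdeg i), map_vecPoly_mul]
    have h2 : ∀ m : Fin k, L (X ^ (m : ℕ) * p j) = ((hankel L k) * T) m j := by
      intro m
      rw [mul_comm, eq_vecPoly (hdeg j), ← hankel_mulVec]
      simp [Matrix.mulVec, dotProduct, Matrix.mul_apply, hT]
    rw [Matrix.mul_assoc, Matrix.mul_apply]
    exact Finset.sum_congr rfl fun m _ => by rw [h2]; simp [hT]
  rw [e, Matrix.det_mul, Matrix.det_mul, Matrix.det_transpose, hT1]
  ring

section Initial

variable {q a : ℝ}

theorem det_hankel_charlier (hq0 : 0 < q) (hq1 : q < 1) (ha : 0 < a) (k : ℕ) :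
    (hankel (charlierFunctional q a) k).det = ∏ n ∈ Finset.range k, normSq q a n := by
  rw [← det_gram (charlierFunctional q a) (charlierPoly q a)
    (charlierPoly_natDegree hq0 hq1 ha) (charlierPoly_monic hq0 hq1 ha),
    ← Fin.prod_univ_eq_prod_range (normSq q a) k]
  have e : (Matrix.of fun i j : Fin k =>
      charlierFunctional q a (charlierPoly q a i * charlierPoly q a j)) =
      Matrix.diagonal fun i : Fin k => normSq q a i := by
    ext i j
    have hdeg : ∀ m, (charlierPoly q a m).degree = m := fun m => by
      rw [degree_eq_natDegree (charlierPoly_monic hq0 hq1 ha m).ne_zero,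
        charlierPoly_natDegree hq0 hq1 ha]
    rw [Matrix.of_apply, Matrix.diagonal_apply]
    split_ifs with hij
    · rw [hij, charlierFunctional_mul_self hq0 hq1 ha]
    · rcases lt_or_gt_of_ne (fun h => hij (Fin.ext h) : (i : ℕ) ≠ j) with h | h
      · rw [mul_comm]
        exact charlierFunctional_orth' hq0 hq1 ha (by rw [hdeg]; exact_mod_cast h)
      · exact charlierFunctional_orth' hq0 hq1 ha (by rw [hdeg]; exact_mod_cast h)
  rw [e, Matrix.det_diagonal]

/-- The monic polynomial vanishing at the first `k` nodes. -/
def nodePoly (q : ℝ) (k : ℕ) : ℝ[X] := Lagrange.nodal (Finset.range k) (node q)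

theorem eval_nodePoly_of_lt (q : ℝ) {k x : ℕ} (hx : x < k) :
    (nodePoly q k).eval (node q x) = 0 :=
  Lagrange.eval_nodal_at_node (Finset.mem_range.2 hx)

theorem eval_nodePoly_self (hq0 : 0 < q) (k : ℕ) :
    (nodePoly q k).eval (node q k) = (q ^ k ^ 2)⁻¹ * qPoch q q k := by
  rw [nodePoly, Lagrange.eval_nodal, qPoch, ← Finset.prod_range_reflect]
  have e : (q ^ k ^ 2)⁻¹ = ∏ _x ∈ Finset.range k, (q ^ k)⁻¹ := by
    rw [Finset.prod_const, Finset.card_range, inv_pow, ← pow_mul, sq]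
  rw [e, ← Finset.prod_mul_distrib]
  refine Finset.prod_congr rfl fun x hx => ?_
  have hx' := Finset.mem_range.1 hx
  obtain ⟨d, rfl⟩ : ∃ d, k = x + 1 + d := ⟨k - x - 1, by omega⟩
  rw [node_eq, node_eq, show x + 1 + d - 1 - x = d by omega]
  field_simp
  ring

theorem eval_nodePoly_self_ne_zero (hq0 : 0 < q) (hq1 : q < 1) (k : ℕ) :
    (nodePoly q k).eval (node q k) ≠ 0 := by
  rw [eval_nodePoly_self hq0]
  have := qPoch_self_pos hq0 hq1 k
  positivity

/-- In the basis of nodal polynomials the evaluation matrix is triangular, because the `j`-th one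
vanishes at the nodes before `j`. -/
theorem det_hankel_partial (q a : ℝ) (k : ℕ) :
    (hankel (partialFunctional q a k) k).det =
      ∏ x ∈ Finset.range k, weight q a x * (nodePoly q x).eval (node q x) ^ 2 := by
  rw [← det_gram (partialFunctional q a k) (nodePoly q)
    (fun i => by rw [nodePoly, Lagrange.natDegree_nodal, Finset.card_range])
    (fun i => Lagrange.nodal_monic)]
  set A : Matrix (Fin k) (Fin k) ℝ := Matrix.of fun x j => (nodePoly q j).eval (node q x) with hA
  have e : (Matrix.of fun i j : Fin k => partialFunctional q a k (nodePoly q i * nodePoly q j)) =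
      A.transpose * Matrix.diagonal (fun x : Fin k => weight q a x) * A := by
    ext i j
    rw [Matrix.of_apply, partialFunctional_apply, Matrix.mul_apply,
      ← Fin.sum_univ_eq_sum_range (fun x => (nodePoly q i * nodePoly q j).eval (node q x) *
        weight q a x) k]
    refine Finset.sum_congr rfl fun x _ => ?_
    rw [Matrix.mul_diagonal]
    simp [hA]
    ring
  have hdet : A.det = ∏ x : Fin k, (nodePoly q x).eval (node q x) := by
    rw [Matrix.det_of_isLowerTriangular]
    · rfl
    · intro x j hxj
      exact eval_nodePoly_of_lt q hxj
  rw [e, Matrix.det_mul, Matrix.det_mul, Matrix.det_transpose, hdet, Matrix.det_diagonal,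
    ← Finset.prod_mul_distrib, ← Finset.prod_mul_distrib,
    ← Fin.prod_univ_eq_prod_range (fun x => weight q a x * (nodePoly q x).eval (node q x) ^ 2) k]
  exact Finset.prod_congr rfl fun x _ => by ring

theorem D_self (hq0 : 0 < q) (hq1 : q < 1) (ha : 0 < a) {k : ℕ} (hk : 1 ≤ k) :
    D q a k k = (qPochInf (-a) q ^ k)⁻¹ * a ^ (-(k.choose 2 : ℤ)) *
      ∏ n ∈ Finset.range k, ((qPoch (-(a⁻¹ * q)) q n)⁻¹ * q ^ ((n + 1).choose 2)) := by
  rw [D_eq hq0 hq1 ha hk, det_hankel_charlier hq0 hq1 ha, det_hankel_partial,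
    ← Finset.prod_div_distrib]
  have hinf := (qPochInf_pos hq0 hq1 ha).ne'
  have key : ∀ n, weight q a n * (nodePoly q n).eval (node q n) ^ 2 / normSq q a n =
      (qPochInf (-a) q)⁻¹ * (a ^ n)⁻¹ *
        ((qPoch (-(a⁻¹ * q)) q n)⁻¹ * q ^ ((n + 1).choose 2)) := by
    intro n
    have hn := normSq_pos hq0 hq1 ha n
    rw [normSq_eq hq0 hq1 ha] at hn
    have h1 := (qPoch_self_pos hq0 hq1 n).ne'
    have h2 : qPoch (-(a⁻¹ * q)) q n ≠ 0 := by
      intro h0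
      rw [h0] at hn
      simp at hn
    rw [normSq_eq hq0 hq1 ha, eval_nodePoly_self hq0, weight, mul_comm 2 n, pow_mul]
    generalize qPoch (-(a⁻¹ * q)) q n = B at *
    generalize qPoch q q n = A at *
    rw [choose_two_succ, pow_add, pow_sq_eq]
    field_simp
  simp only [key]
  rw [Finset.prod_mul_distrib, Finset.prod_mul_distrib, Finset.prod_const, Finset.card_range,
    inv_pow, zpow_neg, zpow_natCast, Finset.prod_inv_distrib, Finset.prod_pow_eq_pow_sum,
    Finset.sum_range_id, ← Nat.choose_two_right]

/-! ### Dual weights and their sums as terminating basic hypergeometric series. -/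

/-- The weights `1 / (ω(x) N'(π_x)²)` dual to the `q`-Charlier weight on the first `k` nodes,
`N` being the nodal polynomial. -/
def dualWeight (q a : ℝ) (k x : ℕ) : ℝ :=
  Lagrange.nodalWeight (Finset.range k) (node q) x ^ 2 / weight q a x

theorem injOn_node (hq0 : 0 < q) (hq1 : q < 1) (s : Set ℕ) : Set.InjOn (node q) s :=
  (node_strictMono hq0 hq1).injective.injOn

theorem node_sub_ne_zero (hq0 : 0 < q) (hq1 : q < 1) {x y : ℕ} (h : x ≠ y) :
    node q x - node q y ≠ 0 :=
  sub_ne_zero.2 ((node_strictMono hq0 hq1).injective.ne h)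

theorem dualWeight_pos (hq0 : 0 < q) (hq1 : q < 1) (ha : 0 < a) {k x : ℕ} (hx : x < k) :
    0 < dualWeight q a k x := by
  have h1 := Lagrange.nodalWeight_ne_zero (injOn_node hq0 hq1 (Finset.range k : Finset ℕ))
    (Finset.mem_range.2 hx)
  have h2 := weight_pos hq0 hq1 ha x
  unfold dualWeight
  positivity

theorem dualWeight_succ (hq0 : 0 < q) (hq1 : q < 1) {k x : ℕ} (hx : x < k) :
    dualWeight q a k x = dualWeight q a (k + 1) x * (node q k - node q x) ^ 2 := by
  have e : Lagrange.nodalWeight (Finset.range (k + 1)) (node q) x =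
      (node q x - node q k)⁻¹ * Lagrange.nodalWeight (Finset.range k) (node q) x := by
    unfold Lagrange.nodalWeight
    rw [Finset.range_add_one, Finset.erase_insert_of_ne (by omega), Finset.prod_insert]
    simp
  have := node_sub_ne_zero hq0 hq1 hx.ne
  unfold dualWeight
  rw [e]
  have e2 : (node q k - node q x) ^ 2 = (node q x - node q k) ^ 2 := by ring
  rw [e2]
  field_simp

theorem dualWeight_self (q a : ℝ) (k : ℕ) :
    dualWeight q a (k + 1) k = (weight q a k * (nodePoly q k).eval (node q k) ^ 2)⁻¹ := by
  unfold dualWeight nodePoly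
  rw [Lagrange.nodalWeight_eq_eval_nodal_erase_inv, Finset.range_add_one,
    Finset.erase_insert (by simp), inv_pow, mul_inv, div_eq_mul_inv, mul_comm]

/-- Induction on the number of nodes, starting where `x` is the last node and its weight comes from
the nodal polynomial; each added node divides by the square of a node difference. -/
theorem dualWeight_eq (hq0 : 0 < q) (hq1 : q < 1) (ha : 0 < a) {n x : ℕ} (hx : x ≤ n) :
    dualWeight q a (n + 1) x = q ^ (n ^ 2 + n) / qPoch q q n ^ 2 *
      (qPoch (q ^ n)⁻¹ q x ^ 2 * (q ^ n) ^ (2 * x) /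
        (a ^ x * q ^ x.choose 2 * qPoch q q x)) := by
  have hqx := (qPoch_self_pos hq0 hq1 x).ne'
  induction n, hx using Nat.le_induction with
  | base =>
    rw [dualWeight_self, eval_nodePoly_self hq0, qPoch_inv_pow hq0, weight, choose_two_succ]
    have hs : ((-1 : ℝ) ^ x) ^ 2 = 1 := by rw [← pow_mul, mul_comm, pow_mul]; simp
    rw [div_pow, mul_pow ((-1 : ℝ) ^ x), hs, pow_add q x, pow_add q (x ^ 2), ← pow_mul,
      show x * (2 * x) = x ^ 2 + x ^ 2 by ring, pow_add q (x ^ 2)]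
    rw [pow_sq_eq q x]
    field_simp
  | succ n hn ih =>
    have hstep := dualWeight_succ (a := a) hq0 hq1 (show x < n + 1 by omega)
    rw [ih] at hstep
    have hne := node_sub_ne_zero hq0 hq1 (show n + 1 ≠ x by omega)
    have hpn := (qPoch_self_pos hq0 hq1 n).ne'
    have hpn' := (qPoch_self_pos hq0 hq1 (n + 1)).ne'
    have e1 : qPoch (q ^ (n + 1))⁻¹ q x * (1 - (q ^ (n + 1))⁻¹ * q ^ x) =
        (1 - (q ^ (n + 1))⁻¹) * qPoch (q ^ n)⁻¹ q x := by
      rw [← qPoch_succ, qPoch_succ']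
      congr 2
      rw [pow_succ]; field_simp
    have e2 : node q (n + 1) - node q x =
        -((q ^ x)⁻¹ * (1 - (q ^ (n + 1))⁻¹ * q ^ x)) := by
      rw [node_eq, node_eq]; field_simp; ring
    have e3 : 1 - q ^ (n + 1) = -(q ^ (n + 1) * (1 - (q ^ (n + 1))⁻¹)) := by
      field_simp; ring
    rw [qPoch_self_succ, e3] at hpn' ⊢
    rw [← mul_left_inj' (pow_ne_zero 2 hne), ← hstep, e2]
    have hd : 1 - (q ^ (n + 1))⁻¹ ≠ 0 := by
      intro h0
      rw [h0] at hpn'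
      simp at hpn'
    have e4 : qPoch (q ^ (n + 1))⁻¹ q x ^ 2 * (q ^ (n + 1)) ^ (2 * x) *
        (-((q ^ x)⁻¹ * (1 - (q ^ (n + 1))⁻¹ * q ^ x))) ^ 2 =
        (1 - (q ^ (n + 1))⁻¹) ^ 2 * (qPoch (q ^ n)⁻¹ q x ^ 2 * (q ^ n) ^ (2 * x)) := by
      rw [neg_sq, mul_pow]
      have : (q ^ (n + 1)) ^ (2 * x) * ((q ^ x)⁻¹) ^ 2 = (q ^ n) ^ (2 * x) := by
        rw [pow_succ q n, mul_pow, inv_pow, ← pow_mul q x, mul_comm x 2]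
        field_simp
      -- `e1` is needed squared, so it is multiplied by the sum of its two sides.
      linear_combination (qPoch (q ^ (n + 1))⁻¹ q x * (1 - (q ^ (n + 1))⁻¹ * q ^ x)) ^ 2 * this +
        (q ^ n) ^ (2 * x) * (qPoch (q ^ (n + 1))⁻¹ q x * (1 - (q ^ (n + 1))⁻¹ * q ^ x) +
          (1 - (q ^ (n + 1))⁻¹) * qPoch (q ^ n)⁻¹ q x) * e1
    have e5 : q ^ ((n + 1) ^ 2 + (n + 1)) = q ^ (n ^ 2 + n) * (q ^ (n + 1)) ^ 2 := by
      rw [← pow_mul, ← pow_add]; congr 1; ring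
    rw [e5]
    have e6 : q ^ (n ^ 2 + n) * (q ^ (n + 1)) ^ 2 /
        (qPoch q q n * -(q ^ (n + 1) * (1 - (q ^ (n + 1))⁻¹))) ^ 2 =
        q ^ (n ^ 2 + n) / qPoch q q n ^ 2 / (1 - (q ^ (n + 1))⁻¹) ^ 2 := by
      generalize 1 - (q ^ (n + 1))⁻¹ = d at *
      field_simp
    rw [e6]
    generalize a ^ x * q ^ x.choose 2 * qPoch q q x = E
    generalize q ^ (n ^ 2 + n) / qPoch q q n ^ 2 = A
    have e7 : ∀ B W Z d : ℝ, A / d ^ 2 * (W ^ 2 * B / E) * Z ^ 2 =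
        A / E * (W ^ 2 * B * Z ^ 2) / d ^ 2 := fun _ _ _ _ => by ring
    rw [e7, e4, mul_left_comm (A / E), mul_div_cancel_left₀ _ (pow_ne_zero 2 hd)]
    ring

/-- The sum of the dual weights, `1 / ‖P_k‖²` on the first `k + 1` nodes. -/
def dualMass (q a : ℝ) (k : ℕ) : ℝ := ∑ x ∈ Finset.range (k + 1), dualWeight q a (k + 1) x

theorem dualMass_pos (hq0 : 0 < q) (hq1 : q < 1) (ha : 0 < a) (k : ℕ) : 0 < dualMass q a k :=
  Finset.sum_pos (fun _ hx => dualWeight_pos hq0 hq1 ha (Finset.mem_range.1 hx)) ⟨0, by simp⟩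

theorem G_inv_pow (hq0 : 0 < q) (m : ℕ) (v z : ℝ) :
    G q (q ^ m)⁻¹ v z = ∑ n ∈ Finset.range (m + 1), qPoch (q ^ m)⁻¹ q n * qPoch v q n *
      ((-1) ^ n * q ^ n.choose 2)⁻¹ * (z ^ n / qPoch q q n) := by
  unfold G basicHyp
  rw [tsum_eq_sum (s := Finset.range (m + 1))]
  · refine Finset.sum_congr rfl fun n _ => ?_
    simp [zpow_neg]
  · intro n hn
    simp [qPoch_inv_pow_eq_zero hq0 (by simpa using hn : m < n)]

theorem dualMass_eq (hq0 : 0 < q) (hq1 : q < 1) (ha : 0 < a) (n : ℕ) :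
    dualMass q a n = q ^ (n ^ 2 + n) / qPoch q q n ^ 2 *
      G q (q ^ n)⁻¹ (q ^ n)⁻¹ (-(q ^ (2 * n) / a)) := by
  rw [dualMass, G_inv_pow hq0, Finset.mul_sum]
  refine Finset.sum_congr rfl fun x hx => ?_
  rw [dualWeight_eq hq0 hq1 ha (Nat.lt_succ_iff.1 (Finset.mem_range.1 hx))]
  congr 1
  rw [neg_pow (q ^ (2 * n) / a), div_pow, ← pow_mul, ← pow_mul,
    show n * (2 * x) = 2 * n * x by ring]
  have h1 := (qPoch_self_pos hq0 hq1 x).ne'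
  field_simp

/-- The node difference turns one factor `(q^{-n-1}; q)_x` into a multiple of `(q^{-n}; q)_x`, while
its factor `q^{-x}` lowers the argument of the series by one power of `q`. -/
theorem sum_dualWeight_mul_sub (hq0 : 0 < q) (hq1 : q < 1) (ha : 0 < a) (n : ℕ) :
    ∑ x ∈ Finset.range (n + 2), dualWeight q a (n + 2) x * (node q (n + 1) - node q x) =
      ((q ^ (n + 1))⁻¹ - 1) * (q ^ ((n + 1) ^ 2 + (n + 1)) / qPoch q q (n + 1) ^ 2) *
        G q (q ^ (n + 1))⁻¹ (q ^ n)⁻¹ (-(q ^ (2 * n + 1) / a)) := by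
  rw [G_inv_pow hq0, Finset.mul_sum]
  refine Finset.sum_congr rfl fun x hx => ?_
  rw [dualWeight_eq hq0 hq1 ha (Nat.lt_succ_iff.1 (Finset.mem_range.1 hx))]
  have h1 := (qPoch_self_pos hq0 hq1 x).ne'
  have e1 : qPoch (q ^ (n + 1))⁻¹ q x * (1 - (q ^ (n + 1))⁻¹ * q ^ x) =
      (1 - (q ^ (n + 1))⁻¹) * qPoch (q ^ n)⁻¹ q x := by
    rw [← qPoch_succ, qPoch_succ']
    congr 2
    rw [pow_succ]; field_simp
  have e2 : node q (n + 1) - node q x = -((q ^ x)⁻¹ * (1 - (q ^ (n + 1))⁻¹ * q ^ x)) := by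
    rw [node_eq, node_eq]; field_simp; ring
  have e3 : (q ^ (n + 1)) ^ (2 * x) * (q ^ x)⁻¹ = (q ^ (2 * n + 1)) ^ x := by
    rw [← pow_mul, ← pow_mul, show (n + 1) * (2 * x) = (2 * n + 1) * x + x by ring, pow_add]
    have := (pow_pos hq0 x).ne'
    field_simp
  have e4 : ((-1) ^ x * q ^ x.choose 2)⁻¹ * ((-(q ^ (2 * n + 1) / a)) ^ x / qPoch q q x) =
      (q ^ (2 * n + 1)) ^ x / (a ^ x * q ^ x.choose 2 * qPoch q q x) := by
    rw [neg_pow (q ^ (2 * n + 1) / a), div_pow]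
    field_simp
  rw [mul_assoc (_ * _) ((-1) ^ x * q ^ x.choose 2)⁻¹, e4, ← e3, e2]
  generalize q ^ ((n + 1) ^ 2 + (n + 1)) / qPoch q q (n + 1) ^ 2 = A at *
  generalize (q ^ (n + 1)) ^ (2 * x) = B at *
  generalize a ^ x * q ^ x.choose 2 * qPoch q q x = E at *
  linear_combination (-A * qPoch (q ^ (n + 1))⁻¹ q x * B * (q ^ x)⁻¹ / E) * e1

/-! ### Lagrange interpolation on the first `k` nodes. -/

variable {k : ℕ} {R : ℝ[X]}

theorem nodePoly_isOPPair {P : ℝ[X]} (h : IsOPPair (partialFunctional q a k) k P R) :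
    IsOPPair (partialFunctional q a k) k (nodePoly q k) R := by
  refine ⟨Lagrange.nodal_monic, by rw [nodePoly, Lagrange.natDegree_nodal, Finset.card_range],
    h.degree_lt, fun j _ => ?_, h.dual⟩
  rw [partialFunctional_apply]
  refine Finset.sum_eq_zero fun x hx => ?_
  rw [eval_mul, eval_nodePoly_of_lt q (Finset.mem_range.1 hx)]
  simp

theorem partialFunctional_mul_basis (hq0 : 0 < q) (hq1 : q < 1) (f : ℝ[X]) {x : ℕ} (hx : x < k) :
    partialFunctional q a k (f * Lagrange.basis (Finset.range k) (node q) x) =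
      f.eval (node q x) * weight q a x := by
  rw [partialFunctional_apply, Finset.sum_eq_single_of_mem x (Finset.mem_range.2 hx)]
  · rw [eval_mul, Lagrange.eval_basis_self (injOn_node hq0 hq1 _) (Finset.mem_range.2 hx), mul_one]
  · intro y hy hyx
    rw [eval_mul, Lagrange.eval_basis_of_ne (Ne.symm hyx) hy, mul_zero, zero_mul]

theorem degree_basis_lt (hq0 : 0 < q) (hq1 : q < 1) {x : ℕ} (hx : x < k) :
    (Lagrange.basis (Finset.range k) (node q) x).degree < k := by
  rw [Lagrange.degree_basis (injOn_node hq0 hq1 _) (Finset.mem_range.2 hx), Finset.card_range]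
  exact_mod_cast (by omega)

/-- Test `R` against the Lagrange basis polynomial at node `x`: duality returns its leading
coefficient, which is the nodal weight, while the sum over nodes has a single term. -/
theorem eval_R_node (hq0 : 0 < q) (hq1 : q < 1) (ha : 0 < a) {P : ℝ[X]}
    (h : IsOPPair (partialFunctional q a k) k P R) {x : ℕ} (hx : x < k) :
    R.eval (node q x) = Lagrange.nodalWeight (Finset.range k) (node q) x / weight q a x := by
  have h1 := partialFunctional_mul_basis (a := a) hq0 hq1 R hx
  have hinj := injOn_node hq0 hq1 (Finset.range k : Finset ℕ)
  have hlc := Lagrange.leadingCoeff_basis hinj (Finset.mem_range.2 hx)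
  rw [leadingCoeff, Lagrange.natDegree_basis hinj (Finset.mem_range.2 hx), Finset.card_range,
    ← Finset.prod_inv_distrib] at hlc
  rw [h.map_R_mul (degree_basis_lt hq0 hq1 hx), hlc] at h1
  rw [eq_div_iff (weight_pos hq0 hq1 ha x).ne', ← h1, Lagrange.nodalWeight]

theorem coeff_R_self (hq0 : 0 < q) (hq1 : q < 1) (ha : 0 < a) {P : ℝ[X]}
    (h : IsOPPair (partialFunctional q a k) k P R) :
    R.coeff (k - 1) = ∑ x ∈ Finset.range k, dualWeight q a k x := by
  have h1 := Lagrange.coeff_eq_sum (P := R) (injOn_node hq0 hq1 (Finset.range k : Finset ℕ))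
    (by rw [Finset.card_range]; exact h.degree_lt)
  rw [Finset.card_range] at h1
  rw [h1]
  refine Finset.sum_congr rfl fun x hx => ?_
  rw [eval_R_node hq0 hq1 ha h (Finset.mem_range.1 hx), dualWeight, div_eq_mul_inv _ (∏ _ ∈ _, _),
    ← Finset.prod_inv_distrib]
  rw [← Lagrange.nodalWeight]
  ring

theorem eval_basis_last (hq0 : 0 < q) (hq1 : q < 1) {x : ℕ} (hx : x < k) :
    (Lagrange.basis (Finset.range k) (node q) x).eval (node q k) =
      (nodePoly q k).eval (node q k) * (Lagrange.nodalWeight (Finset.range k) (node q) x *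
        (node q k - node q x)⁻¹) :=
  Lagrange.eval_basis_not_at_node (Finset.mem_range.2 hx)
    (sub_ne_zero.1 (node_sub_ne_zero hq0 hq1 hx.ne'))

theorem eval_eq_sum_basis (hq0 : 0 < q) (hq1 : q < 1) {f : ℝ[X]} (hf : f.degree < k) (y : ℝ) :
    f.eval y = ∑ x ∈ Finset.range k,
      f.eval (node q x) * (Lagrange.basis (Finset.range k) (node q) x).eval y := by
  conv_lhs => rw [Lagrange.eq_interpolate (f := f)
    (injOn_node hq0 hq1 (Finset.range k : Finset ℕ)) (by rw [Finset.card_range]; exact hf)]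
  simp [Lagrange.interpolate_apply, eval_finsetSum]

theorem eval_R_last (hq0 : 0 < q) (hq1 : q < 1) (ha : 0 < a) {P : ℝ[X]}
    (h : IsOPPair (partialFunctional q a k) k P R) :
    R.eval (node q k) = (nodePoly q k).eval (node q k) *
      ∑ x ∈ Finset.range (k + 1), dualWeight q a (k + 1) x * (node q k - node q x) := by
  -- The term `x = k` of the right side is zero; it is carried only to match the hypergeometric sum
  -- over `k + 1` nodes.
  rw [eval_eq_sum_basis hq0 hq1 h.degree_lt, Finset.sum_range_succ, sub_self, mul_zero, add_zero,
    Finset.mul_sum]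
  refine Finset.sum_congr rfl fun x hx => ?_
  have hx' := Finset.mem_range.1 hx
  have hne := node_sub_ne_zero hq0 hq1 hx'.ne'
  have h1 := dualWeight_succ (a := a) hq0 hq1 hx'
  rw [dualWeight] at h1
  rw [eval_R_node hq0 hq1 ha h hx', eval_basis_last hq0 hq1 hx']
  have h2 : dualWeight q a (k + 1) x * (node q k - node q x) =
      Lagrange.nodalWeight (Finset.range k) (node q) x ^ 2 / weight q a x *
        (node q k - node q x)⁻¹ := by
    rw [h1]; field_simp
  rw [h2]
  ring

/-- The reproducing property applied to Lagrange basis polynomials gives the kernel at the nodes,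
and interpolation gives it at `π_k`. The summand `1` is the contribution of the last node to the
dual mass. -/
theorem one_add_diagKer_self (hq0 : 0 < q) (hq1 : q < 1) (ha : 0 < a) (k : ℕ) :
    1 + weight q a k * diagKer q a k k =
      weight q a k * (nodePoly q k).eval (node q k) ^ 2 * dualMass q a k := by
  have hL := posOn_partialFunctional hq0 hq1 ha (le_refl k)
  have hK := degree_evalKer_lt (partialFunctional q a k) k (node q k)
  have hw := (weight_pos hq0 hq1 ha k).ne'
  have hN := eval_nodePoly_self_ne_zero hq0 hq1 k
  have e : diagKer q a k k = (nodePoly q k).eval (node q k) ^ 2 *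
      ∑ x ∈ Finset.range k, dualWeight q a (k + 1) x := by
    rw [diagKer, eval_eq_sum_basis hq0 hq1 hK, Finset.mul_sum]
    refine Finset.sum_congr rfl fun x hx => ?_
    have hx' := Finset.mem_range.1 hx
    have hne := node_sub_ne_zero hq0 hq1 hx'.ne'
    have hwx := (weight_pos hq0 hq1 ha x).ne'
    have h1 := partialFunctional_mul_basis (a := a) hq0 hq1
      (evalKer (partialFunctional q a k) k (node q k)) hx'
    rw [hL.map_evalKer _ (degree_basis_lt hq0 hq1 hx')] at h1
    have h2 := dualWeight_succ (a := a) hq0 hq1 hx'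
    rw [dualWeight] at h2
    rw [eq_div_of_mul_eq hwx h1.symm, eval_basis_last hq0 hq1 hx']
    have h3 : dualWeight q a (k + 1) x = Lagrange.nodalWeight (Finset.range k) (node q) x ^ 2 /
        weight q a x * ((node q k - node q x)⁻¹) ^ 2 := by
      rw [h2]; field_simp
    rw [h3]
    ring
  rw [e, dualMass, Finset.sum_range_succ, dualWeight_self]
  field_simp
  ring

theorem residueScale_self (hq0 : 0 < q) (hq1 : q < 1) (ha : 0 < a) (k : ℕ) :
    residueScale q a k k * (nodePoly q k).eval (node q k) ^ 2 = (dualMass q a k)⁻¹ := by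
  have hw := (weight_pos hq0 hq1 ha k).ne'
  have hN := eval_nodePoly_self_ne_zero hq0 hq1 k
  have hS := (dualMass_pos hq0 hq1 ha k).ne'
  rw [residueScale, one_add_diagKer_self hq0 hq1 ha]
  field_simp

/-- The coefficient is minus the sum of the nodes, a geometric series; the factor `1 - q` avoids a
division. -/
theorem coeff_nodePoly (hq0 : 0 < q) (hk : 1 ≤ k) :
    q ^ (k - 1) * (nodePoly q k).coeff (k - 1) * (1 - q) = q ^ k - 1 := by
  have h1 := prod_X_sub_C_coeff_card_pred (Finset.range k) (node q)
    (by rw [Finset.card_range]; exact hk)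
  rw [Finset.card_range] at h1
  rw [nodePoly, Lagrange.nodal_eq, h1]
  have h2 : ∀ n, (1 - q) * ∑ x ∈ Finset.range n, node q x = q * node q n - q := by
    intro n
    induction n with
    | zero => simp [node_zero]
    | succ n ih =>
      rw [Finset.sum_range_succ, mul_add, ih]
      linear_combination -node_succ_mul hq0 n
  obtain ⟨n, rfl⟩ : ∃ n, k = n + 1 := ⟨k - 1, by omega⟩
  have h3 : q ^ (n + 1) * node q (n + 1) = 1 := by
    rw [node_eq]; exact mul_inv_cancel₀ (pow_pos hq0 _).ne'
  rw [Nat.add_sub_cancel]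
  linear_combination (-q ^ n) * h2 (n + 1) - h3

end Initial

/-! ### The entries of the Lax pair at `s = k`, with `k = n + 1`. -/

section InitialEntries

variable {q a : ℝ} {n : ℕ} {P R : ℕ → ℝ[X]}
  (hq0 : 0 < q) (hq1 : q < 1) (ha : 0 < a)

theorem isOPPair_self_eq (hq0 : 0 < q) (hq1 : q < 1) (ha : 0 < a) {k : ℕ} {P R : ℝ[X]}
    (h : IsOPPair (partialFunctional q a k) k P R) : P = nodePoly q k :=
  (h.unique (posOn_partialFunctional hq0 hq1 ha le_rfl) (nodePoly_isOPPair h)).1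

include hq0 hq1 ha

/-- Up to a factor it is the dual mass, a sum of positive terms. -/
theorem G_ne_zero (n : ℕ) : G q (q ^ n)⁻¹ (q ^ n)⁻¹ (-(q ^ (2 * n) / a)) ≠ 0 := by
  have h1 := (dualMass_pos hq0 hq1 ha n).ne'
  rw [dualMass_eq hq0 hq1 ha] at h1
  exact right_ne_zero_of_mul h1

theorem D_self_succ {k : ℕ} (hk : 1 ≤ k) :
    D q a k (k + 1) = (qPochInf (-a) q ^ k)⁻¹ * (a ^ ((k : ℤ) - (k.choose 2 : ℤ)) / qPoch q q k) *
      q ^ (-(k.choose 2 : ℤ)) * G q (q ^ k)⁻¹ (q ^ k)⁻¹ (-(q ^ (2 * k) / a)) *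
      ∏ n ∈ Finset.range k, ((qPoch (-(a⁻¹ * q)) q n)⁻¹ * q ^ ((n + 1).choose 2)) := by
  have h1 := D_succ_div hq0 hq1 ha hk (le_refl k)
  rw [div_eq_iff (D_ne_zero hq0 hq1 ha hk le_rfl), one_add_diagKer_self hq0 hq1 ha,
    D_self hq0 hq1 ha hk, dualMass_eq hq0 hq1 ha, eval_nodePoly_self hq0, weight] at h1
  have hp := (qPoch_self_pos hq0 hq1 k).ne'
  rw [h1, zpow_sub₀ ha.ne', zpow_natCast, zpow_natCast, zpow_neg, zpow_neg, zpow_natCast,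
    zpow_natCast, pow_add, pow_sq_eq]
  generalize ∏ n ∈ Finset.range k, ((qPoch (-(a⁻¹ * q)) q n)⁻¹ * q ^ ((n + 1).choose 2)) = E
  generalize G q (q ^ k)⁻¹ (q ^ k)⁻¹ (-(q ^ (2 * k) / a)) = g
  generalize (qPochInf (-a) q ^ k)⁻¹ = I
  field_simp

variable (h : ∀ s, n + 1 ≤ s → IsOPPair (partialFunctional q a s) (n + 1) (P s) (R s))

include h

theorem entryQ_self : entryQ q a (n + 1) P (n + 1) =
    qPoch q q (n + 1) ^ 2 * (q ^ ((n + 1) ^ 2 + (n + 1)))⁻¹ *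
      (G q (q ^ (n + 1))⁻¹ (q ^ (n + 1))⁻¹ (-(q ^ (2 * (n + 1)) / a)))⁻¹ := by
  rw [entryQ, isOPPair_self_eq hq0 hq1 ha (h _ le_rfl), residueScale_self hq0 hq1 ha,
    dualMass_eq hq0 hq1 ha, mul_inv, inv_div, div_eq_mul_inv]

theorem eval_R_self : (R (n + 1)).eval (node q (n + 1)) =
    (nodePoly q (n + 1)).eval (node q (n + 1)) * (((q ^ (n + 1))⁻¹ - 1) *
      (q ^ ((n + 1) ^ 2 + (n + 1)) / qPoch q q (n + 1) ^ 2) *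
        G q (q ^ (n + 1))⁻¹ (q ^ n)⁻¹ (-(q ^ (2 * n + 1) / a))) := by
  rw [eval_R_last hq0 hq1 ha (h _ le_rfl), sum_dualWeight_mul_sub hq0 hq1 ha]

theorem entryP_self : entryP q a (n + 1) P R (n + 1) = (1 - (q ^ (n + 1))⁻¹) *
    (G q (q ^ (n + 1))⁻¹ (q ^ n)⁻¹ (-(q ^ (2 * n + 1) / a)) /
      G q (q ^ (n + 1))⁻¹ (q ^ (n + 1))⁻¹ (-(q ^ (2 * (n + 1)) / a))) := by
  have hμ := residueScale_self hq0 hq1 ha (n + 1)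
  have hG := G_ne_zero hq0 hq1 ha (n + 1)
  have hp := (qPoch_self_pos hq0 hq1 (n + 1)).ne'
  rw [dualMass_eq hq0 hq1 ha] at hμ
  rw [entryP, isOPPair_self_eq hq0 hq1 ha (h _ le_rfl), eval_R_self hq0 hq1 ha h]
  generalize G q (q ^ (n + 1))⁻¹ (q ^ (n + 1))⁻¹ (-(q ^ (2 * (n + 1)) / a)) = g at *
  generalize G q (q ^ (n + 1))⁻¹ (q ^ n)⁻¹ (-(q ^ (2 * n + 1) / a)) = g1 at *
  have hA : q ^ ((n + 1) ^ 2 + (n + 1)) / qPoch q q (n + 1) ^ 2 ≠ 0 :=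
    div_ne_zero (pow_pos hq0 _).ne' (pow_ne_zero 2 hp)
  generalize q ^ ((n + 1) ^ 2 + (n + 1)) / qPoch q q (n + 1) ^ 2 = A at *
  generalize (q ^ (n + 1))⁻¹ = i at *
  have e : A * (A * g)⁻¹ = g⁻¹ := by field_simp
  rw [div_eq_mul_inv]
  linear_combination (-(i - 1) * A * g1) * hμ - (i - 1) * g1 * e

theorem entryR_self : entryR q a (n + 1) R (n + 1) = q ^ (n + 1) ^ 2 * (1 - (q ^ (n + 1))⁻¹) /
      (qPoch q q (n + 1) * qPoch q q n) *
    (G q (q ^ (n + 1))⁻¹ (q ^ n)⁻¹ (-(q ^ (2 * n + 1) / a)) ^ 2 /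
      G q (q ^ (n + 1))⁻¹ (q ^ (n + 1))⁻¹ (-(q ^ (2 * (n + 1)) / a))) := by
  have hμ := residueScale_self hq0 hq1 ha (n + 1)
  have hG := G_ne_zero hq0 hq1 ha (n + 1)
  have hp := (qPoch_self_pos hq0 hq1 (n + 1)).ne'
  have hp' := (qPoch_self_pos hq0 hq1 n).ne'
  rw [dualMass_eq hq0 hq1 ha] at hμ
  rw [entryR, eval_R_self hq0 hq1 ha h]
  generalize G q (q ^ (n + 1))⁻¹ (q ^ (n + 1))⁻¹ (-(q ^ (2 * (n + 1)) / a)) = g at *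
  generalize G q (q ^ (n + 1))⁻¹ (q ^ n)⁻¹ (-(q ^ (2 * n + 1) / a)) = g1 at *
  have hA : q ^ ((n + 1) ^ 2 + (n + 1)) / qPoch q q (n + 1) ^ 2 ≠ 0 :=
    div_ne_zero (pow_pos hq0 _).ne' (pow_ne_zero 2 hp)
  have hi : q ^ (n + 1) ^ 2 / (qPoch q q (n + 1) * qPoch q q n) =
      ((q ^ (n + 1))⁻¹ - 1) * (q ^ ((n + 1) ^ 2 + (n + 1)) / qPoch q q (n + 1) ^ 2) := by
    rw [pow_add q ((n + 1) ^ 2)]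
    have hq := (pow_pos hq0 (n + 1)).ne'
    rw [qPoch_self_succ] at hp ⊢
    have hd := right_ne_zero_of_mul hp
    generalize q ^ (n + 1) = t at *
    field_simp
  rw [mul_div_right_comm, hi]
  generalize q ^ ((n + 1) ^ 2 + (n + 1)) / qPoch q q (n + 1) ^ 2 = A at *
  generalize (q ^ (n + 1))⁻¹ = i at *
  have e : A * (A * g)⁻¹ = g⁻¹ := by field_simp
  rw [div_eq_mul_inv]
  linear_combination (-((i - 1) * A * g1) ^ 2) * hμ - (i - 1) ^ 2 * g1 ^ 2 * A * e

theorem entryAlpha_self : entryAlpha q (n + 1) P (n + 1) =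
    -1 - q ^ (n + 1) * entryP q a (n + 1) P R (n + 1) := by
  have h1 := coeff_nodePoly hq0 (show 1 ≤ n + 1 by omega)
  rw [entryAlpha, coeff_P_succ hq0 hq1 ha h le_rfl, isOPPair_self_eq hq0 hq1 ha (h _ le_rfl)]
  have e : q ^ (n + 1) = q * q ^ (n + 1 - 1) := by rw [Nat.add_sub_cancel, pow_succ']
  linear_combination h1 - (nodePoly q (n + 1)).coeff (n + 1 - 1) * e

theorem entryBeta_self : entryBeta q a (n + 1) P (n + 1) =
    -(q ^ (n + 1) * entryQ q a (n + 1) P (n + 1)) := by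
  have h1 : partialFunctional q a (n + 1) (P (n + 1) * X ^ (n + 1)) = 0 := by
    rw [partialFunctional_apply]
    refine Finset.sum_eq_zero fun x hx => ?_
    rw [isOPPair_self_eq hq0 hq1 ha (h _ le_rfl), eval_mul,
      eval_nodePoly_of_lt q (Finset.mem_range.1 hx)]
    simp
  rw [entryBeta, functional_P_succ hq0 hq1 ha h le_rfl, h1, zero_add]

/-- The top coefficient of `R_k` is the sum of the dual weights on `k = n + 1` nodes, that is, the
dual mass of index `n`; hence the shift from `k` to `k - 1` in this formula. -/
theorem entryGamma_self : entryGamma q (n + 1) R (n + 1) =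
    q ^ (n ^ 2 + 2 * n) / qPoch q q n ^ 2 *
      G q (q ^ n)⁻¹ (q ^ n)⁻¹ (-(q ^ (2 * n) / a)) := by
  have h1 := dualMass_eq hq0 hq1 ha n
  rw [entryGamma, coeff_R_self hq0 hq1 ha (h _ le_rfl), ← dualMass, h1, Nat.add_sub_cancel]
  rw [show n ^ 2 + 2 * n = n + (n ^ 2 + n) by ring, pow_add q n]
  ring

end InitialEntries

end QCharlier

end

/-! ### The main theorem. -/

open Polynomial QCharlier

theorem theorem11p5 (q a : ℝ) (hq0 : 0 < q) (hq1 : q < 1) (ha : 0 < a) (k : ℕ) (hk : 1 ≤ k) :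
    ∃ (m : ℕ → ℂ → Matrix (Fin 2) (Fin 2) ℂ) (p Q r α β γ h ε u : ℕ → ℝ),
      -- the sequences are the entries of the matrices of the Lax pair
      (∀ s, k ≤ s →
        QCharlier.IsDRHPSolution q a k s (m s) ∧
        (∀ ζ : ℂ, (∀ x ≤ s, ζ ≠ (QCharlier.node q x : ℂ)) →
          m (s + 1) ζ =
            (1 + (ζ - (QCharlier.node q s : ℂ))⁻¹ •
              !![(p s : ℂ), (Q s : ℂ); (r s : ℂ), -(p s : ℂ)]) * m s ζ ∧
          m s ((q : ℂ) * ζ) =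
            !![(q : ℂ) ^ k * ζ + (α s : ℂ), (β s : ℂ); (γ s : ℂ), (a : ℂ) * ((q : ℂ) ^ k)⁻¹] *
              m (s + 1) ζ * !![(ζ - 1)⁻¹, 0; 0, (a : ℂ)⁻¹]) ∧
        m s (QCharlier.node q s : ℂ) 0 0 = (h s : ℂ)) ∧
      -- no denominator below vanishes
      (∀ s, k ≤ s → QCharlier.D q a k s ≠ 0 ∧ p s ≠ 0 ∧ Q s ≠ 0 ∧ r s ≠ 0 ∧ ε s ≠ 0) ∧
      QCharlier.G q (q ^ (-(k : ℤ))) (q ^ (-(k : ℤ))) (-(q ^ (2 * k) / a)) ≠ 0 ∧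
      -- the recurrence relations
      (∀ s, k ≤ s →
        QCharlier.D q a k (s + 2) / QCharlier.D q a k (s + 1) -
            QCharlier.D q a k (s + 1) / QCharlier.D q a k s =
          a ^ ((s : ℤ) - 1) / QCharlier.qPoch q q (s + 1) * q ^ ((s + 1).choose 2) *
            u s * h s ^ 2 ∧
        u s = q ^ k * (p s / Q s ^ 2) * (p s * β s + a * q ^ (-(k : ℤ)) * Q s) ∧
        ε s = a * (q ^ (-(s : ℤ) - 1) - 1) +
          q ^ ((k : ℤ) - 1) * (a * q ^ (-(k : ℤ)) * p s - r s * β s) ∧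
        p (s + 1) = -q⁻¹ * (p s)⁻¹ * (ε s)⁻¹ * (p s * β s + a * q ^ (-(k : ℤ)) * Q s) *
          (r s * α s - p s * γ s + q ^ ((k : ℤ) - s - 1) * r s) ∧
        Q (s + 1) = q⁻¹ * (Q s)⁻¹ * (ε s)⁻¹ * (p s * β s + a * q ^ (-(k : ℤ)) * Q s) ^ 2 ∧
        r (s + 1) = q⁻¹ * (r s)⁻¹ * (ε s)⁻¹ *
          (r s * α s - p s * γ s + q ^ ((k : ℤ) - s - 1) * r s) ^ 2 ∧
        α (s + 1) = α s + q ^ ((k : ℤ) - 1) * p s - q ^ k * p (s + 1) ∧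
        β (s + 1) = β s - q ^ k * Q (s + 1) ∧
        γ (s + 1) = γ s + q ^ ((k : ℤ) - 1) * r s ∧
        h (s + 1) = (p s * β s + a * q ^ (-(k : ℤ)) * Q s) / (a * Q s) * h s) ∧
      -- the initial conditions
      QCharlier.D q a k k =
        (QCharlier.qPochInf (-a) q ^ k)⁻¹ * a ^ (-(k.choose 2 : ℤ)) *
          ∏ n ∈ Finset.range k,
            ((QCharlier.qPoch (-(a⁻¹ * q)) q n)⁻¹ * q ^ ((n + 1).choose 2)) ∧
      QCharlier.D q a k (k + 1) =
        (QCharlier.qPochInf (-a) q ^ k)⁻¹ *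
          (a ^ ((k : ℤ) - (k.choose 2 : ℤ)) / QCharlier.qPoch q q k) *
          q ^ (-(k.choose 2 : ℤ)) *
          QCharlier.G q (q ^ (-(k : ℤ))) (q ^ (-(k : ℤ))) (-(q ^ (2 * k) / a)) *
          ∏ n ∈ Finset.range k,
            ((QCharlier.qPoch (-(a⁻¹ * q)) q n)⁻¹ * q ^ ((n + 1).choose 2)) ∧
      p k = (1 - q ^ (-(k : ℤ))) *
        (QCharlier.G q (q ^ (-(k : ℤ))) (q ^ (1 - (k : ℤ))) (-(q ^ (2 * (k : ℤ) - 1) / a)) /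
          QCharlier.G q (q ^ (-(k : ℤ))) (q ^ (-(k : ℤ))) (-(q ^ (2 * k) / a))) ∧
      Q k = QCharlier.qPoch q q k ^ 2 * q ^ (-((k : ℤ) * ((k : ℤ) + 1))) *
        (QCharlier.G q (q ^ (-(k : ℤ))) (q ^ (-(k : ℤ))) (-(q ^ (2 * k) / a)))⁻¹ ∧
      r k = q ^ (k ^ 2) * (1 - q ^ (-(k : ℤ))) /
          (QCharlier.qPoch q q k * QCharlier.qPoch q q (k - 1)) *
        (QCharlier.G q (q ^ (-(k : ℤ))) (q ^ (1 - (k : ℤ))) (-(q ^ (2 * (k : ℤ) - 1) / a)) ^ 2 /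
          QCharlier.G q (q ^ (-(k : ℤ))) (q ^ (-(k : ℤ))) (-(q ^ (2 * k) / a))) ∧
      α k = -1 - q ^ k * p k ∧
      β k = -(q ^ k * Q k) ∧
      γ k = q ^ ((k : ℤ) ^ 2 - 1) / QCharlier.qPoch q q (k - 1) ^ 2 *
        QCharlier.G q (q ^ (1 - (k : ℤ))) (q ^ (1 - (k : ℤ)))
          (-(q ^ (2 * (k : ℤ) - 2) / a)) ∧
      h k = q ^ (-((k : ℤ) ^ 2)) * QCharlier.qPoch q q k := by
  obtain ⟨n, rfl⟩ : ∃ n, k = n + 1 := ⟨k - 1, by omega⟩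
  have hex : ∀ s, ∃ P R : ℝ[X], n + 1 ≤ s → IsOPPair (partialFunctional q a s) (n + 1) P R := by
    intro s
    by_cases hs : n + 1 ≤ s
    · obtain ⟨P, R, h⟩ := (posOn_partialFunctional hq0 hq1 ha hs).exists_isOPPair
      exact ⟨P, R, fun _ => h⟩
    -- Dummy values below `k`, where nothing is asserted about the sequences.
    · exact ⟨0, 0, fun h => absurd h hs⟩
  choose P R h using hex
  have z0 : q ^ (-((n + 1 : ℕ) : ℤ)) = (q ^ (n + 1))⁻¹ := by rw [zpow_neg, zpow_natCast]
  have z1 : q ^ (1 - ((n + 1 : ℕ) : ℤ)) = (q ^ n)⁻¹ := by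
    rw [← zpow_natCast, ← zpow_neg]; congr 1; push_cast; ring
  have z2 : q ^ (2 * ((n + 1 : ℕ) : ℤ) - 1) = q ^ (2 * n + 1) := by
    rw [← zpow_natCast]; congr 1; push_cast; ring
  have z3 : q ^ (2 * ((n + 1 : ℕ) : ℤ) - 2) = q ^ (2 * n) := by
    rw [← zpow_natCast]; congr 1; push_cast; ring
  have z4 : q ^ (((n + 1 : ℕ) : ℤ) ^ 2 - 1) = q ^ (n ^ 2 + 2 * n) := by
    rw [← zpow_natCast]; congr 1; push_cast; ring
  have z5 : q ^ (-(((n + 1 : ℕ) : ℤ) * (((n + 1 : ℕ) : ℤ) + 1))) =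
      (q ^ ((n + 1) ^ 2 + (n + 1)))⁻¹ := by
    rw [← zpow_natCast, ← zpow_neg]; congr 1; push_cast; ring
  have z6 : q ^ (-(((n + 1 : ℕ) : ℤ) ^ 2)) = (q ^ (n + 1) ^ 2)⁻¹ := by
    rw [← zpow_natCast, ← zpow_neg]; congr 1
  have z7 : q ^ (((n + 1 : ℕ) : ℤ) - 1) = q ^ (n + 1 - 1) := by
    rw [← zpow_natCast]; congr 1; push_cast; simp
  refine ⟨fun s => rhMatrix q a s (P s) (R s), entryP q a (n + 1) P R, entryQ q a (n + 1) P,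
    entryR q a (n + 1) R, entryAlpha q (n + 1) P, entryBeta q a (n + 1) P,
    entryGamma q (n + 1) R, fun s => (P s).eval (node q s), entryEps q a (n + 1) P R,
    entryU q a (n + 1) P R, fun s hs => ⟨isDRHPSolution_rhMatrix hq0 hq1 hk (h s hs),
      fun ζ hζ => rhMatrix_lax hq0 hq1 ha hk h hs hζ, Polynomial.aeval_ofReal (P s) (node q s)⟩,
    fun s hs => ⟨D_ne_zero hq0 hq1 ha hk hs, entryP_ne_zero hq0 hq1 ha h hk hs,
      (entryQ_pos hq0 hq1 ha h hs).ne', entryR_ne_zero hq0 hq1 ha h hk hs,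
      entryEps_ne_zero hq0 hq1 ha h hk hs⟩, ?_, fun s hs => ?_, ?_, ?_, ?_, ?_, ?_, ?_, ?_, ?_, ?_⟩
  · rw [z0]; exact G_ne_zero hq0 hq1 ha (n + 1)
  · obtain ⟨r1, r2, r3⟩ := recurrence_entries hq0 hq1 ha h hk hs
    refine ⟨recurrence_D hq0 hq1 ha h hk hs, rfl, rfl, r1, r2, r3, ?_,
      entryBeta_succ hq0 hq1 ha h hs, ?_, recurrence_h hq0 hq1 ha h hk hs⟩
    · rw [z7]; exact entryAlpha_succ hq0 hq1 ha h hs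
    · rw [z7]; exact entryGamma_succ hq0 hq1 ha h hs
  · exact D_self hq0 hq1 ha hk
  · rw [z0]; exact D_self_succ hq0 hq1 ha hk
  · rw [z0, z1, z2]; exact entryP_self hq0 hq1 ha h
  · rw [z0, z5]; exact entryQ_self hq0 hq1 ha h
  · rw [z0, z1, z2]; exact entryR_self hq0 hq1 ha h
  · exact entryAlpha_self hq0 hq1 ha h
  · exact entryBeta_self hq0 hq1 ha h
  · rw [z1, z3, z4]; exact entryGamma_self hq0 hq1 ha h
  · rw [z6, ← eval_nodePoly_self hq0, ← isOPPair_self_eq hq0 hq1 ha (h _ le_rfl)]
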